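/- Fix $m>0$, $M>0$, $\eta\in\mathbb R$, $\omega\in(-m,m)$ and a self-coupling $G:\mathbb R\to\mathbb R$, $g=G'$, such that either $G\equiv0$, or: $G\in C^2(\mathbb R;\mathbb R)$; there is $\theta>1$ with $g(s)s\ge\theta G(s)$ for all $s\in\mathbb R$; $G(0)=G'(0)=0$; $G\ge0$ and $G(A_0)>0$ for some $A_0>0$. Let $\alpha=(\alpha_1,\alpha_2,\alpha_3)$ and $\beta$ be the $4\times4$ Dirac matrices in the standard representation, and write $\bar\psi=\psi^*\beta$. Let $\varphi\in H^1(\mathbb R^3;\mathbb C^4)$ satisfy, almost everywhere with weak derivatives, $$\bigl(\omega+i\alpha\cdot\nabla-m\beta+\eta\chi_0\beta+g(\bar\varphi\varphi)\beta\bigr)\varphi=0,\qquad \chi_0(x)=\int_{\mathbb R^3}\frac{e^{-M|x-y|}}{4\pi|x-y|}\,\eta\,\bar\varphi\varphi(y)\,dy,$$ so that $\psi_0(t,x)=e^{-i\omega t}\varphi(x)$ and $\chi_0$ form a standing wave of the Klein--Gordon--Dirac system $$(-i\gamma^\mu\partial_\mu+m-g(\bar\psi\psi))\psi=\eta\chi\psi,\qquad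 (\partial_t^2-\Delta+M^2)\chi=\eta\bar\psi\psi,\qquad \gamma^0=\beta,\ \gamma^k=\beta\alpha_k .$$ For fields $(\psi,\chi)$ let $$\mathcal E(\psi,\chi)=\int_{\mathbb R^3}\Bigl(\psi^*(-i\alpha\cdot\nabla+m\beta)\psi-G(\bar\psi\psi)+\tfrac12\bigl(|\dot\chi|^2+|\nabla\chi|^2+M^2|\chi|^2\bigr)-\eta\bar\psi\psi\,\chi\Bigr)dx,$$ $$P(\psi,\chi)=-\int_{\mathbb R^3}\bigl(i\psi^*\nabla\psi+\dot\chi\nabla\chi\bigr)dx .$$ Let $\mathbf v\in\mathbb R^3$, $|\mathbf v|<1$, $\gamma=(1-|\mathbf v|^2)^{-1/2}$, let $$\Lambda_{\mathbf v}(t,x)=\Bigl(\gamma(t+\mathbf v\cdot x),\ x+(\gamma-1)\mathbf v\,\frac{x\cdot\mathbf v}{|\mathbf v|^2}+\gamma\mathbf vt\Bigr)$$ (the identity if $\mathbf v=0$), so that $\Lambda_{\mathbf v}^{-1}=\Lambda_{-\mathbf v}$, let $S_{\mathbf v}=\sqrt{\frac{\gamma+1}2}\,\bigl(I+\frac{\gamma}{\gamma+1}\,\alpha\cdot\mathbf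 v\bigr)$, and define the boosted solitary wave by $$\psi_{\mathbf v}(t,x)=S_{\mathbf v}\,\psi_0\bigl(\Lambda_{\mathbf v}^{-1}(t,x)\bigr),\qquad \chi_{\mathbf v}(t,x)=\chi_0(y),$$ where $y$ is the spatial part of $\Lambda_{\mathbf v}^{-1}(t,x)$. Assume * **C1'** $\int\varphi^*\nabla\varphi\,dx=0$; * **C2'** for each $j=1,2,3$, $\sum_{k\ne j}v_k\int\varphi^*\alpha_k\partial_j\varphi\,dx=0$; * **C3'** for each $k=1,2,3$, $\sum_{j\ne k}v_j\int\partial_k\chi_0\,\partial_j\chi_0\,dx=0$. Then at every time the fields $\psi_0,\chi_0,\psi_{\mathbf v},\chi_{\mathbf v}$ belong to $H^1(\mathbb R^3)$ in $x$, $\dot\chi_{\mathbf v}$ exists (as the time derivative of a curve of distributions on $\mathbb R^3$) and lies in $L^2$, the integrals $\mathcal E_0:=\mathcal E(\psi_0,\chi_0)$ and $P_{\mathbf v}:=P(\psi_{\mathbf v},\chi_{\mathbf v})$ converge absolutely, $\mathcal E_0$ does not depend on time, and at every time $$P_{\mathbf v}=\gamma\,\mathbf v\,\mathcal E_0 .$$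 -/

import Mathlib

open MeasureTheory
open scoped Matrix

namespace KGD

noncomputable section

/-- Physical space `ℝ³` with its Euclidean norm. -/
abbrev Space : Type := EuclideanSpace ℝ (Fin 3)

/-- Dirac spinors, i.e. vectors of `ℂ⁴`. -/
abbrev Spinor : Type := Fin 4 → ℂ

/-! ### Weak derivatives -/

/-- `η` is a test function: smooth with compact support. -/
def IsTest (η : Space → ℝ) : Prop := ContDiff ℝ ((⊤ : ℕ∞) : WithTop ℕ∞) η ∧ HasCompactSupport η

/-- The classical partial derivative `∂η/∂x_k` of a test function. -/
def partialDeriv (k : Fin 3) (η : Space → ℝ) (x : Space) : ℝ :=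
  fderiv ℝ η x (EuclideanSpace.single k 1)

/-- `g` is a weak partial derivative of `f` in the direction `x_k`. -/
def HasWeakPartial {F : Type} [NormedAddCommGroup F] [NormedSpace ℝ F]
    (k : Fin 3) (f g : Space → F) : Prop :=
  LocallyIntegrable f ∧ LocallyIntegrable g ∧
    ∀ η : Space → ℝ, IsTest η →
      ∫ x, partialDeriv k η x • f x = - ∫ x, η x • g x

open Classical in
/-- A representative of the weak partial derivative `∂_k f`, which is unique almost everywhere
(and the junk value `0` if there is none). -/
def weakPartial {F : Type} [NormedAddCommGroup F] [NormedSpace ℝ F]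
    (k : Fin 3) (f : Space → F) : Space → F :=
  if h : ∃ g, HasWeakPartial k f g then h.choose else 0

/-- The Sobolev space `H¹(ℝ³; F)`. -/
def MemH1 {F : Type} [NormedAddCommGroup F] [NormedSpace ℝ F] (f : Space → F) : Prop :=
  MemLp f 2 ∧ ∀ k : Fin 3, ∃ g, HasWeakPartial k f g ∧ MemLp g 2

/-- `u` is the time derivative at time `t` of the curve `s ↦ χ(s, ·)`, the derivative being taken
in the space of distributions on `ℝ³`. -/
def HasWeakTimeDeriv (χ : ℝ → Space → ℝ) (t : ℝ) (u : Space → ℝ) : Prop :=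
  (∀ s, LocallyIntegrable (χ s)) ∧ LocallyIntegrable u ∧
    ∀ η : Space → ℝ, IsTest η →
      HasDerivAt (fun s => ∫ x, η x * χ s x) (∫ x, η x * u x) t

open Classical in
/-- A representative of `∂_t χ(t, ·)`, which is unique almost everywhere (and the junk value `0`
if there is none). -/
def weakTimeDeriv (χ : ℝ → Space → ℝ) (t : ℝ) : Space → ℝ :=
  if h : ∃ u, HasWeakTimeDeriv χ t u then h.choose else 0

/-! ### Dirac matrices (standard representation) -/

/-- The Dirac matrices `α₁, α₂, α₃`, with off-diagonal blocks `σ₁, σ₂, σ₃`. -/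
def alpha : Fin 3 → Matrix (Fin 4) (Fin 4) ℂ :=
  ![!![0, 0, 0, 1;
       0, 0, 1, 0;
       0, 1, 0, 0;
       1, 0, 0, 0],
    !![0, 0, 0, -Complex.I;
       0, 0, Complex.I, 0;
       0, -Complex.I, 0, 0;
       Complex.I, 0, 0, 0],
    !![0, 0, 1, 0;
       0, 0, 0, -1;
       1, 0, 0, 0;
       0, -1, 0, 0]]

/-- The Dirac matrix `β = diag(1, 1, -1, -1)`. -/
def beta : Matrix (Fin 4) (Fin 4) ℂ :=
  !![1, 0, 0, 0;
     0, 1, 0, 0;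
     0, 0, -1, 0;
     0, 0, 0, -1]

/-- The Lorentz scalar `ψ̄ψ = ψ* β ψ`, as a real number (see `scalarDensity_eq`). -/
def scalarDensity (z : Spinor) : ℝ := (star z ⬝ᵥ beta *ᵥ z).re

theorem scalarDensity_eq (z : Spinor) :
    (scalarDensity z : ℂ) = star z ⬝ᵥ beta *ᵥ z := by
  apply Complex.ext
  · simp [scalarDensity]
  · simp [beta, dotProduct, Matrix.mulVec, Fin.sum_univ_four]
    ring

/-! ### Self-coupling -/

/-- The self-coupling `G` is `C²`, there is `θ > 1` with `G'(s) s ≥ θ G(s)` for all `s`,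
`G(0) = G'(0) = 0`, and `G ≥ 0` with `G` positive at some positive point. -/
def AdmissibleCoupling (G : ℝ → ℝ) : Prop :=
  ContDiff ℝ 2 G ∧
  (∃ θ : ℝ, 1 < θ ∧ ∀ s, θ * G s ≤ deriv G s * s) ∧
  (G 0 = 0 ∧ deriv G 0 = 0) ∧
  ((∀ s, 0 ≤ G s) ∧ ∃ A : ℝ, 0 < A ∧ 0 < G A)

/-! ### Standing waves -/

/-- `χ₀ = (e^{-M|x|} / (4π|x|)) * f_φ` with `f_φ = η φ̄φ`. -/
def restMeson (M eta : ℝ) (φ : Space → Spinor) (x : Space) : ℝ :=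
  ∫ y, Real.exp (-M * ‖x - y‖) / (4 * Real.pi * ‖x - y‖) * (eta * scalarDensity (φ y))

/-- `φ ∈ H¹(ℝ³; ℂ⁴)` solves
`(ω + i α·∇ - m β + η χ₀ β + g(φ̄φ) β) φ = 0` almost everywhere, where `g = G'`. -/
def IsStandingWave (m M eta ω : ℝ) (G : ℝ → ℝ) (φ : Space → Spinor) : Prop :=
  MemH1 φ ∧
  ∀ᵐ x : Space,
    (ω : ℂ) • φ x + Complex.I • ∑ k, alpha k *ᵥ weakPartial k φ x
      - (m : ℂ) • (beta *ᵥ φ x)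
      + ((eta * restMeson M eta φ x : ℝ) : ℂ) • (beta *ᵥ φ x)
      + ((deriv G (scalarDensity (φ x)) : ℝ) : ℂ) • (beta *ᵥ φ x) = 0

/-- `ψ₀(t, x) = e^{-iωt} φ(x)`. -/
def restDirac (ω : ℝ) (φ : Space → Spinor) (t : ℝ) (x : Space) : Spinor :=
  Complex.exp (-Complex.I * ω * t) • φ x

/-! ### Moving waves -/

/-- The Lorentz factor `γ = (1 - |v|²)^{-1/2}`. -/
def lorentzFactor (v : Space) : ℝ := (Real.sqrt (1 - ‖v‖ ^ 2))⁻¹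

/-- The boost `Λ_v(t, x) = (γ(t + v·x), x + (γ-1) v (x·v)/|v|² + γ v t)`; for `v = 0` it is the
identity. -/
def boost (v : Space) (p : ℝ × Space) : ℝ × Space :=
  (lorentzFactor v * (p.1 + inner ℝ v p.2),
    p.2 + ((lorentzFactor v - 1) * (inner ℝ p.2 v / ‖v‖ ^ 2)) • v
      + (lorentzFactor v * p.1) • v)

/-- `Λ_{-v}` is the inverse of `Λ_v`. -/
theorem boost_boost_neg (v : Space) (hv : ‖v‖ < 1) (p : ℝ × Space) :
    boost v (boost (-v) p) = p := by
  obtain ⟨t, x⟩ := p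
  have h1 : 0 < 1 - ‖v‖ ^ 2 := by nlinarith [norm_nonneg v]
  have hg : lorentzFactor v ^ 2 * (1 - ‖v‖ ^ 2) = 1 := by
    rw [lorentzFactor, inv_pow, Real.sq_sqrt h1.le, inv_mul_cancel₀ h1.ne']
  have hgn : lorentzFactor (-v) = lorentzFactor v := by simp [lorentzFactor]
  have hvv : inner ℝ v v = ‖v‖ ^ 2 := real_inner_self_eq_norm_sq v
  have hc : inner ℝ x v = inner ℝ v x := real_inner_comm v x
  simp only [boost, hgn, norm_neg, inner_neg_left, inner_neg_right, inner_add_left,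
    inner_add_right, inner_smul_left, inner_smul_right, hvv, hc, conj_trivial]
  rcases eq_or_ne v 0 with rfl | hv0
  · simp [lorentzFactor]
  · have hn : ‖v‖ ^ 2 ≠ 0 := by positivity
    generalize lorentzFactor v = g at *
    generalize inner ℝ v x = a at *
    generalize ‖v‖ ^ 2 = n at *
    have hn' : n = (g ^ 2 - 1) / g ^ 2 := by
      have : g ≠ 0 := by rintro rfl; simp at hg
      field_simp; linarith
    refine Prod.ext ?_ ?_
    · field_simp
      linear_combination t * hg
    · simp only [smul_neg, ← neg_smul, add_assoc, ← add_smul]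
      rw [add_eq_left]
      convert zero_smul ℝ v using 2
      field_simp
      linear_combination a * hg

/-- The spinor boost `S_v = √((γ+1)/2) (I + (γ/(γ+1)) α·v)`. -/
def spinorBoost (v : Space) : Matrix (Fin 4) (Fin 4) ℂ :=
  ((Real.sqrt ((lorentzFactor v + 1) / 2) : ℝ) : ℂ) •
    (1 + ((lorentzFactor v / (lorentzFactor v + 1) : ℝ) : ℂ) •
      ∑ k, ((v k : ℝ) : ℂ) • alpha k)

/-- `ψ_v(t, x) = S_v ψ₀(Λ_v⁻¹(t, x))`, where `Λ_v⁻¹ = Λ_{-v}`. -/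
def movingDirac (ω : ℝ) (φ : Space → Spinor) (v : Space) (t : ℝ) (x : Space) : Spinor :=
  spinorBoost v *ᵥ restDirac ω φ (boost (-v) (t, x)).1 (boost (-v) (t, x)).2

/-- `χ_v(t, x) = χ₀(y)`, where `y = x + (γ-1) v (x·v)/|v|² - γ v t` is the spatial part of
`Λ_v⁻¹(t, x)`. -/
def movingMeson (χ₀ : Space → ℝ) (v : Space) (t : ℝ) (x : Space) : ℝ :=
  χ₀ (boost (-v) (t, x)).2

/-! ### Energy and momentum -/

/-- The energy density
`ψ*(-iα·∇ + mβ)ψ - G(ψ̄ψ) + ½(|∂_tχ|² + |∇χ|² + M²|χ|²) - η ψ̄ψ χ` at time `t`. -/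
def energyDensity (m M eta : ℝ) (G : ℝ → ℝ) (ψ : ℝ → Space → Spinor) (χ : ℝ → Space → ℝ)
    (t : ℝ) (x : Space) : ℂ :=
  star (ψ t x) ⬝ᵥ (-Complex.I • ∑ k, alpha k *ᵥ weakPartial k (ψ t) x
      + (m : ℂ) • (beta *ᵥ ψ t x))
    + ((- G (scalarDensity (ψ t x))
        + (1 / 2) * (weakTimeDeriv χ t x ^ 2 + ∑ k, weakPartial k (χ t) x ^ 2
            + M ^ 2 * χ t x ^ 2)
        - eta * scalarDensity (ψ t x) * χ t x : ℝ) : ℂ)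

/-- The energy `𝓔(ψ, χ)` at time `t`. -/
def energy (m M eta : ℝ) (G : ℝ → ℝ) (ψ : ℝ → Space → Spinor) (χ : ℝ → Space → ℝ)
    (t : ℝ) : ℂ :=
  ∫ x, energyDensity m M eta G ψ χ t x

/-- The `k`-th component `i ψ* ∂_kψ + ∂_tχ ∂_kχ` of minus the momentum density at time `t`. -/
def momentumDensity (ψ : ℝ → Space → Spinor) (χ : ℝ → Space → ℝ)
    (t : ℝ) (k : Fin 3) (x : Space) : ℂ :=
  Complex.I * (star (ψ t x) ⬝ᵥ weakPartial k (ψ t) x)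
    + ((weakTimeDeriv χ t x * weakPartial k (χ t) x : ℝ) : ℂ)

/-- The momentum `P(ψ, χ) = -∫ (i ψ*∇ψ + ∂_tχ ∇χ) dx` at time `t`. -/
def momentum (ψ : ℝ → Space → Spinor) (χ : ℝ → Space → ℝ) (t : ℝ) (k : Fin 3) : ℂ :=
  - ∫ x, momentumDensity ψ χ t k x

/-- At time `t` both fields are in `H¹` and `χ` has a weak time derivative in `L²`; in particular
all the derivatives in the energy and in the momentum exist. -/
def FieldsInH1 (ψ : ℝ → Space → Spinor) (χ : ℝ → Space → ℝ) (t : ℝ) : Prop :=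
  MemH1 (ψ t) ∧ MemH1 (χ t) ∧ ∃ u, HasWeakTimeDeriv χ t u ∧ MemLp u 2

/-! ### The conditions on the profile -/

/-- `∫ φ*∇φ dx = 0`. -/
def CondC1' (φ : Space → Spinor) : Prop :=
  ∀ k : Fin 3, ∫ x, star (φ x) ⬝ᵥ weakPartial k φ x = 0

/-- For each `j`, `∑_{k ≠ j} v_k ∫ φ* α_k ∂_jφ dx = 0`. -/
def CondC2' (v : Space) (φ : Space → Spinor) : Prop :=
  ∀ j : Fin 3, ∑ k ∈ Finset.univ.filter (fun k => k ≠ j),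
    ((v k : ℝ) : ℂ) * ∫ x, star (φ x) ⬝ᵥ (alpha k *ᵥ weakPartial j φ x) = 0

/-- For each `k`, `∑_{j ≠ k} v_j ∫ ∂_kχ₀ ∂_jχ₀ dx = 0`. -/
def CondC3' (v : Space) (χ₀ : Space → ℝ) : Prop :=
  ∀ k : Fin 3, ∑ j ∈ Finset.univ.filter (fun j => j ≠ k),
    v j * ∫ x, weakPartial k χ₀ x * weakPartial j χ₀ x = 0

end

end KGD

/-!
The momentum of the boosted wave is `γ v 𝓔₀` because the stress tensor of the standing wave has a
spatial mean that is known exactly.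

Write `s = φ̄φ`, `T_kj = Im ∫ φ* α_k ∂_jφ` and `X_kj = ∫ ∂_kχ₀ ∂_jχ₀`. The stress tensor of a standing
wave is integrable and divergence free, hence has mean zero, as testing its divergence with cut-off
coordinate functions shows (`integral_eq_zero_of_divergence_free`). This gives the virial identities
`T_kj + X_kj = δ_kj W` with `W = ∫ g(s) s - G(s) + ½ |∇χ₀|² + ½ M² χ₀²` (`IsProfile.virial`).
In the same way the current `φ* α_k φ` has mean zero (`IsProfile.integral_current`).

By the Dirac equation, `φ*(-iα·∇ + mβ)φ = ω |φ|² + (η χ₀ + g(s)) s`, so that the energy of the standing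
wave is `𝓔₀ = ω ∫ |φ|² + W` (`IsProfile.energy_rest`).

At a fixed time the moving wave is, up to the factor `S_v` and a plane-wave phase, the composition
of the standing wave with an affine map whose linear part `A` is symmetric, has determinant `γ` and satisfies `A v = γ v`; moreover
`S_v* S_v = γ (1 + α·v)` (`spinorBoost_sq`), and `∂_t χ_v = -γ (v·∇χ₀)` in the moving coordinates. A change
of variables turns the momentum into `ω γ v_j ∫ |φ|² + ∑_l A_lj ∑_k v_k (T_kl + X_kl)`, the remaining terms
vanishing because of `CondC1'`, because the current has mean zero and because `Re φ* α_k ∂_jφ` is a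
derivative. By the virial identities this is `γ v_j (ω ∫ |φ|² + W)` (`IsProfile.momentum_moving`).

The analytic part of the argument justifies the virial identities for fields that are merely in `H¹`.
Second derivatives of `φ` are avoided by null forms (`HasL2Gradient.null_form`); the coupling is
not assumed to have limited growth, and `g(s) s` and `g(s) ∂_j s` are integrable because the Dirac
equation expresses them by quadratic terms, which together with `0 ≤ G(s) ≤ g(s) s` suffices for the
chain rule (`HasL2Gradient.chain_rule_of_integrable`). The Sobolev embedding `H¹ ⊂ L⁶` gives `s ∈ L²`,
so that `χ₀` is a bounded `H¹` solution of the Klein–Gordon equation; it is treated by mollification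
(`WeakKleinGordon.virial`).
-/

namespace KGD

open Filter Topology ContinuousLinearMap
open scoped Convolution ENNReal NNReal

set_option linter.unusedSectionVars false

section

variable {F : Type} [NormedAddCommGroup F] [NormedSpace ℝ F]

/-! ### Convolution with an integrable kernel on `L²` -/

theorem locallyIntegrable_of_memLp_two {f : Space → F} (hf : MemLp f 2) : LocallyIntegrable f :=
  hf.locallyIntegrable (by norm_num)

theorem eLpNorm_two_sq (f : Space → F) : eLpNorm f 2 volume ^ 2 = ∫⁻ x, ‖f x‖ₑ ^ 2 := by
  have := eLpNorm_nnreal_pow_eq_lintegral (f := f) (μ := volume) (p := 2) (by norm_num)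
  simpa using this

theorem tendsto_eLpNorm_two_of_lintegral {u : ℕ → Space → F}
    (h : Tendsto (fun n => ∫⁻ x, ‖u n x‖ₑ ^ 2) atTop (𝓝 0)) :
    Tendsto (fun n => eLpNorm (u n) 2 volume) atTop (𝓝 0) := by
  have h1 : ∀ n, eLpNorm (u n) 2 volume = (∫⁻ x, ‖u n x‖ₑ ^ 2) ^ (1 / 2 : ℝ) := by
    intro n
    rw [← eLpNorm_two_sq, ← ENNReal.rpow_natCast, ← ENNReal.rpow_mul]; norm_num
  simp_rw [h1]
  simpa [Function.comp_def] using
    (ENNReal.continuous_rpow_const (y := (1 / 2 : ℝ))).continuousAt.tendsto.comp h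

/-- Cauchy–Schwarz for the measure with density `k`. -/
theorem lintegral_mul_sq_le {α : Type*} [MeasurableSpace α] {μ : Measure α} {k h : α → ℝ≥0∞}
    (hk : AEMeasurable k μ) (hh : AEMeasurable h μ) :
    (∫⁻ y, k y * h y ∂μ) ^ 2 ≤ (∫⁻ y, k y ∂μ) * ∫⁻ y, k y * h y ^ 2 ∂μ := by
  have h1 : ∀ y, k y * h y = (k y) ^ (1 / 2 : ℝ) * ((k y) ^ (1 / 2 : ℝ) * h y) := by
    intro y
    rw [← mul_assoc, ← ENNReal.rpow_add_of_nonneg _ _ (by norm_num) (by norm_num)]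
    norm_num
  have h2 := ENNReal.lintegral_mul_le_Lp_mul_Lq μ Real.HolderConjugate.two_two
    (hk.pow_const (1 / 2 : ℝ)) ((hk.pow_const (1 / 2 : ℝ)).mul hh)
  simp only [Pi.mul_apply] at h2
  simp_rw [h1]
  refine (pow_le_pow_left' h2 2).trans ?_
  rw [mul_pow, ← ENNReal.rpow_natCast, ← ENNReal.rpow_natCast, ← ENNReal.rpow_mul,
    ← ENNReal.rpow_mul]
  have h3 : ∀ y, (k y ^ (1 / 2 : ℝ)) ^ (2 : ℝ) = k y := by
    intro y
    rw [← ENNReal.rpow_mul]; norm_num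
  simp_rw [ENNReal.mul_rpow_of_nonneg _ _ (by norm_num : (0 : ℝ) ≤ 2), h3]
  norm_num

theorem aestronglyMeasurable_convolution {K : Space → ℝ} {f : Space → F}
    (hK : AEStronglyMeasurable K) (hf : AEStronglyMeasurable f) :
    AEStronglyMeasurable (K ⋆[lsmul ℝ ℝ, volume] f) := by
  have := (AEStronglyMeasurable.convolution_integrand (μ := volume) (ν := volume)
    (lsmul ℝ ℝ) hK hf).integral_prod_right'
  exact this

/-- Young's inequality `‖K ⋆ f‖₂ ≤ ‖K‖₁ ‖f‖₂`. -/
theorem eLpNorm_convolution_le {K : Space → ℝ} {f : Space → F}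
    (hK : AEStronglyMeasurable K) (hf : AEStronglyMeasurable f) :
    eLpNorm (K ⋆[lsmul ℝ ℝ, volume] f) 2 volume ≤ eLpNorm K 1 volume * eLpNorm f 2 volume := by
  rw [← ENNReal.pow_le_pow_left_iff (n := 2) (by norm_num), mul_pow, eLpNorm_two_sq,
    eLpNorm_two_sq, eLpNorm_one_eq_lintegral_enorm]
  have hmeas : AEMeasurable (fun p : Space × Space => ‖K p.2‖ₑ * ‖f (p.1 - p.2)‖ₑ ^ 2)
      (volume.prod volume) := by
    refine (hK.comp_snd.enorm).mul ?_
    exact ((hf.comp_quasiMeasurePreserving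
      (quasiMeasurePreserving_sub_of_right_invariant volume volume)).enorm).pow_const 2
  -- Cauchy–Schwarz for the measure `|K(t)| dt`, then Tonelli and translation invariance
  calc ∫⁻ x, ‖(K ⋆[lsmul ℝ ℝ, volume] f) x‖ₑ ^ 2
      ≤ ∫⁻ x, (∫⁻ t, ‖K t‖ₑ) * ∫⁻ t, ‖K t‖ₑ * ‖f (x - t)‖ₑ ^ 2 := by
        refine lintegral_mono fun x => ?_
        refine (pow_le_pow_left' (enorm_integral_le_lintegral_enorm _) 2).trans ?_
        simp only [lsmul_apply, enorm_smul]
        exact lintegral_mul_sq_le hK.enorm (hf.comp_quasiMeasurePreserving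
          (quasiMeasurePreserving_sub_left volume x)).enorm
    _ = (∫⁻ t, ‖K t‖ₑ) * ∫⁻ t, ∫⁻ x, ‖K t‖ₑ * ‖f (x - t)‖ₑ ^ 2 := by
        rw [lintegral_const_mul'', lintegral_lintegral_swap hmeas]
        exact hmeas.lintegral_prod_right'
    _ = (∫⁻ t, ‖K t‖ₑ) * ∫⁻ t, ‖K t‖ₑ * ∫⁻ x, ‖f x‖ₑ ^ 2 := by
        congr 1
        refine lintegral_congr fun t => ?_
        rw [lintegral_const_mul'']
        · rw [lintegral_sub_right_eq_self (fun x => ‖f x‖ₑ ^ 2) t]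
        · exact ((hf.comp_quasiMeasurePreserving
            (measurePreserving_sub_right volume t).quasiMeasurePreserving).enorm).pow_const 2
    _ = _ := by
        rw [lintegral_mul_const'' _ hK.enorm, sq, mul_assoc]

theorem memLp_convolution {K : Space → ℝ} {f : Space → F} (hK : Integrable K) (hf : MemLp f 2) :
    MemLp (K ⋆[lsmul ℝ ℝ, volume] f) 2 :=
  ⟨aestronglyMeasurable_convolution hK.1 hf.1,
    (eLpNorm_convolution_le hK.1 hf.1).trans_lt
      (ENNReal.mul_lt_top (memLp_one_iff_integrable.2 hK).2 hf.2)⟩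

/-! ### Mollification -/

/-- A sequence of bump functions shrinking to the origin. -/
noncomputable def mollBump (n : ℕ) : ContDiffBump (0 : Space) where
  rIn := 1 / (n + 1)
  rOut := 2 / (n + 1)
  rIn_pos := by positivity
  rIn_lt_rOut := by gcongr; norm_num

/-- The mollifier: a smooth nonnegative kernel of integral one supported near the origin. -/
noncomputable def mollKernel (n : ℕ) : Space → ℝ := (mollBump n).normed volume

/-- The mollification of `f`. -/
noncomputable def moll (n : ℕ) (f : Space → F) : Space → F :=
  mollKernel n ⋆[lsmul ℝ ℝ, volume] f

theorem mollKernel_contDiff (n : ℕ) : ContDiff ℝ ((⊤ : ℕ∞) : WithTop ℕ∞) (mollKernel n) :=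
  (mollBump n).contDiff_normed

theorem mollKernel_compact (n : ℕ) : HasCompactSupport (mollKernel n) :=
  (mollBump n).hasCompactSupport_normed

theorem mollKernel_integrable (n : ℕ) : Integrable (mollKernel n) :=
  (mollBump n).integrable_normed

theorem mollKernel_nonneg (n : ℕ) (x : Space) : 0 ≤ mollKernel n x :=
  (mollBump n).nonneg_normed x

theorem eLpNorm_mollKernel (n : ℕ) : eLpNorm (mollKernel n) 1 volume = 1 := by
  rw [eLpNorm_one_eq_lintegral_enorm]
  have : ∫⁻ x, ‖mollKernel n x‖ₑ = ∫⁻ x, ENNReal.ofReal (mollKernel n x) :=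
    lintegral_congr fun x => Real.enorm_of_nonneg (mollKernel_nonneg n x)
  rw [this, ← ofReal_integral_eq_lintegral_ofReal (mollKernel_integrable n)
    (Eventually.of_forall (mollKernel_nonneg n))]
  simp [mollKernel, (mollBump n).integral_normed]

theorem mollBump_rOut_tendsto : Tendsto (fun n => (mollBump n).rOut) atTop (𝓝 0) := by
  have := (tendsto_one_div_add_atTop_nhds_zero_nat (𝕜 := ℝ)).const_mul 2
  simpa [mollBump, div_eq_mul_inv] using this

theorem moll_contDiff (n : ℕ) {f : Space → F} (hf : LocallyIntegrable f) :
    ContDiff ℝ ((⊤ : ℕ∞) : WithTop ℕ∞) (moll n f) :=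
  (mollKernel_compact n).contDiff_convolution_left _ (mollKernel_contDiff n) hf

theorem eLpNorm_moll_le (n : ℕ) {f : Space → F} (hf : AEStronglyMeasurable f) :
    eLpNorm (moll n f) 2 volume ≤ eLpNorm f 2 volume := by
  simpa [eLpNorm_mollKernel, moll] using
    eLpNorm_convolution_le (mollKernel_integrable n).1 hf

theorem memLp_moll (n : ℕ) {f : Space → F} (hf : MemLp f 2) : MemLp (moll n f) 2 :=
  memLp_convolution (mollKernel_integrable n) hf

theorem moll_sub (n : ℕ) {f g : Space → F} (hf : LocallyIntegrable f) (hg : LocallyIntegrable g) :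
    moll n (f - g) = moll n f - moll n g := by
  have hc := (mollKernel_contDiff n).continuous
  have h1 := (mollKernel_compact n).convolutionExists_left (lsmul ℝ ℝ) hc hf
  have h2 := (mollKernel_compact n).convolutionExists_left (lsmul ℝ ℝ) hc hg
  ext x
  simp only [moll, convolution_def, Pi.sub_apply, lsmul_apply, smul_sub]
  exact integral_sub (h1 x) (h2 x)

theorem moll_ae_tendsto [CompleteSpace F] {f : Space → F} (hf : LocallyIntegrable f) :
    ∀ᵐ x, Tendsto (fun n => moll n f x) atTop (𝓝 (f x)) :=
  ContDiffBump.ae_convolution_tendsto_right_of_locallyIntegrable mollBump_rOut_tendsto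
    (K := 2) (Eventually.of_forall fun n => by simp [mollBump, div_eq_mul_inv]) hf

theorem norm_moll_le (n : ℕ) {f : Space → F} {C : ℝ} (hC : ∀ x, ‖f x‖ ≤ C) (x : Space) :
    ‖moll n f x‖ ≤ C := by
  calc ‖moll n f x‖ ≤ ∫ t, mollKernel n t * C := by
        refine norm_integral_le_of_norm_le ((mollKernel_integrable n).mul_const C)
          (Eventually.of_forall fun t => ?_)
        simp only [lsmul_apply, norm_smul, Real.norm_of_nonneg (mollKernel_nonneg n t)]
        exact mul_le_mul_of_nonneg_left (hC _) (mollKernel_nonneg n t)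
    _ = C := by
        rw [integral_mul_const, mollKernel, (mollBump n).integral_normed, one_mul]

/-- For continuous `g` with compact support the mollifications converge pointwise, are uniformly
bounded and live in a fixed ball, so that dominated convergence applies. -/
theorem moll_tendsto_of_continuous [CompleteSpace F] {g : Space → F} (hg : Continuous g)
    (hc : HasCompactSupport g) :
    Tendsto (fun n => eLpNorm (moll n g - g) 2 volume) atTop (𝓝 0) := by
  obtain ⟨C, hC⟩ := hg.bounded_above_of_compact_support hc
  obtain ⟨R, hR⟩ := hc.isCompact.isBounded.subset_closedBall (0 : Space)
  have hloc : LocallyIntegrable g := hg.locallyIntegrable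
  have hsupp : ∀ n x, R + 2 < ‖x‖ → moll n g x - g x = 0 := by
    intro n x hx
    have hz : ∀ y, R < ‖y‖ → g y = 0 := fun y hy => by
      by_contra h
      have := hR (subset_tsupport _ h)
      simp at this; linarith
    rw [hz x (by linarith), sub_zero]
    refine integral_eq_zero_of_ae (Eventually.of_forall fun t => ?_)
    by_cases ht : t ∈ Function.support (mollKernel n)
    · rw [mollKernel, (mollBump n).support_normed_eq] at ht
      have h2 : (mollBump n).rOut ≤ 2 := by
        have : (0 : ℝ) ≤ n := n.cast_nonneg
        simp only [mollBump]; rw [div_le_iff₀ (by positivity)]; linarith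
      have ht' : ‖t‖ < 2 := by simpa using (Metric.mem_ball.1 ht).trans_le h2
      have := norm_sub_norm_le x t
      simp [hz (x - t) (by linarith)]
    · simp [Function.notMem_support.1 ht]
  have hmeas : ∀ n, AEStronglyMeasurable (moll n g - g) := fun n =>
    ((moll_contDiff n hloc).continuous.sub hg).aestronglyMeasurable
  refine tendsto_eLpNorm_two_of_lintegral ?_
  have key := tendsto_lintegral_of_dominated_convergence' (μ := volume)
    (F := fun n x => ‖(moll n g - g) x‖ₑ ^ 2) (f := fun _ => 0)
    ((Metric.closedBall (0 : Space) (R + 2)).indicator fun _ => ENNReal.ofReal (C + C) ^ 2)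
    (fun n => (hmeas n).enorm.pow_const 2) ?_ ?_ ?_
  · simpa using key
  · intro n
    refine Eventually.of_forall fun x => ?_
    by_cases hx : x ∈ Metric.closedBall (0 : Space) (R + 2)
    · simp only [Set.indicator_of_mem hx, Pi.sub_apply]
      refine pow_le_pow_left' ?_ 2
      rw [← ofReal_norm]
      exact ENNReal.ofReal_le_ofReal ((norm_sub_le _ _).trans
        (add_le_add (norm_moll_le n hC x) (hC x)))
    · rw [Metric.mem_closedBall, dist_zero_right, not_le] at hx
      simp [hsupp n x hx]
  · rw [lintegral_indicator measurableSet_closedBall, setLIntegral_const]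
    exact (ENNReal.mul_lt_top (by simp) measure_closedBall_lt_top).ne
  · refine Eventually.of_forall fun x => ?_
    have h := ContDiffBump.convolution_tendsto_right_of_continuous (μ := volume)
      mollBump_rOut_tendsto hg x
    have h' : Tendsto (fun n => (moll n g - g) x) atTop (𝓝 0) := by
      simpa [moll, mollKernel] using h.sub_const (g x)
    simpa [Function.comp_def] using
      (ENNReal.continuous_pow 2).continuousAt.tendsto.comp h'.enorm

/-- Approximation by continuous functions with compact support; mollification is a contraction on
`L²`. -/
theorem moll_tendsto [CompleteSpace F] {f : Space → F} (hf : MemLp f 2) :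
    Tendsto (fun n => eLpNorm (moll n f - f) 2 volume) atTop (𝓝 0) := by
  rw [ENNReal.tendsto_nhds_zero]
  intro ε hε
  have hε3 : ε / 3 ≠ 0 := by simpa using hε.ne'
  obtain ⟨g, hgc, hfg, hgcont, hgm⟩ := hf.exists_hasCompactSupport_eLpNorm_sub_le (by norm_num) hε3
  filter_upwards [(ENNReal.tendsto_nhds_zero.1 (moll_tendsto_of_continuous hgcont hgc)) (ε / 3)
    (pos_iff_ne_zero.2 hε3)] with n hn
  have hfl := locallyIntegrable_of_memLp_two hf
  have hgl := locallyIntegrable_of_memLp_two hgm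
  have e1 : moll n f - f = moll n (f - g) + (moll n g - g) + (g - f) := by
    rw [moll_sub n hfl hgl]; abel
  have m1 := memLp_moll n (hf.sub hgm)
  have m2 := (memLp_moll n hgm).sub hgm
  rw [e1]
  refine (eLpNorm_add_le (m1.add m2).1 (hgm.sub hf).1 (by norm_num)).trans ?_
  refine (add_le_add_left (eLpNorm_add_le m1.1 m2.1 (by norm_num)) _).trans ?_
  rw [eLpNorm_sub_comm g f]
  calc _ ≤ ε / 3 + ε / 3 + ε / 3 :=
        add_le_add (add_le_add ((eLpNorm_moll_le n (hf.sub hgm).1).trans hfg) hn) hfg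
    _ = ε := ENNReal.add_thirds ε

/-! ### Derivatives of mollifications -/

/-- The classical partial derivative in the direction `x_k` of a vector-valued function. -/
noncomputable def pd (k : Fin 3) (f : Space → F) (x : Space) : F :=
  fderiv ℝ f x (EuclideanSpace.single k 1)

theorem isTest_mollKernel (n : ℕ) (x : Space) : IsTest fun t => mollKernel n (x - t) :=
  ⟨(mollKernel_contDiff n).comp (contDiff_const.sub contDiff_id),
    (mollKernel_compact n).comp_homeomorph (Homeomorph.subLeft x)⟩

theorem moll_apply (n : ℕ) (f : Space → F) (x : Space) :
    moll n f x = ∫ t, mollKernel n (x - t) • f t := by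
  rw [moll, convolution_lsmul_swap]

theorem pd_moll_apply (n : ℕ) (k : Fin 3) {f : Space → F} (hf : LocallyIntegrable f) (x : Space) :
    pd k (moll n f) x = - ∫ t, partialDeriv k (fun t => mollKernel n (x - t)) t • f t := by
  have h1 : ContDiff ℝ 1 (mollKernel n) := (mollKernel_contDiff n).of_le (by exact_mod_cast le_top)
  have h2 := (mollKernel_compact n).hasFDerivAt_convolution_left (lsmul ℝ ℝ) h1 hf x
  have h3 : HasCompactSupport (fderiv ℝ (mollKernel n)) := (mollKernel_compact n).fderiv ℝ
  have h4 : Continuous (fderiv ℝ (mollKernel n)) := h1.continuous_fderiv one_ne_zero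
  have h5 := h3.convolutionExists_left ((lsmul ℝ ℝ (E := F)).precompL Space) h4 hf x
  rw [pd, moll, h2.fderiv, convolution_def, ContinuousLinearMap.integral_apply h5]
  simp only [precompL_apply, lsmul_apply]
  have hd : ∀ t, partialDeriv k (fun t => mollKernel n (x - t)) t
      = - fderiv ℝ (mollKernel n) (x - t) (EuclideanSpace.single k 1) := by
    intro t
    have := ((h1.differentiable one_ne_zero (x - t)).hasFDerivAt).comp t
      ((hasFDerivAt_id t).const_sub x)
    rw [partialDeriv, HasFDerivAt.fderiv (f := fun t => mollKernel n (x - t)) this]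
    simp
  simp only [hd, neg_smul, integral_neg, neg_neg]
  rw [← integral_sub_left_eq_self (fun t => fderiv ℝ (mollKernel n) t (EuclideanSpace.single k 1) •
      f (x - t)) volume x]
  simp

/-- Mollification commutes with weak derivatives. -/
theorem pd_moll (n : ℕ) (k : Fin 3) {f g : Space → F} (h : HasWeakPartial k f g) :
    pd k (moll n f) = moll n g := by
  ext x
  rw [pd_moll_apply n k h.1, h.2.2 _ (isTest_mollKernel n x), neg_neg, moll_apply]

/-! ### Test functions and weak derivatives -/

theorem IsTest.contDiff_one {ζ : Space → ℝ} (h : IsTest ζ) : ContDiff ℝ 1 ζ :=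
  h.1.of_le (by exact_mod_cast le_top)

theorem IsTest.partialDeriv_contDiff {ζ : Space → ℝ} (h : IsTest ζ) (k : Fin 3) :
    ContDiff ℝ ((⊤ : ℕ∞) : WithTop ℕ∞) (partialDeriv k ζ) :=
  (h.1.fderiv_right (m := ((⊤ : ℕ∞) : WithTop ℕ∞)) le_rfl).clm_apply contDiff_const

theorem IsTest.partialDeriv {ζ : Space → ℝ} (h : IsTest ζ) (k : Fin 3) :
    IsTest (partialDeriv k ζ) :=
  ⟨h.partialDeriv_contDiff k, h.2.fderiv_apply (𝕜 := ℝ) _⟩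

theorem IsTest.bounded {ζ : Space → ℝ} (h : IsTest ζ) : ∃ C, ∀ x, ‖ζ x‖ ≤ C :=
  h.1.continuous.bounded_above_of_compact_support h.2

theorem IsTest.integrable_smul {ζ : Space → ℝ} (h : IsTest ζ) {f : Space → F}
    (hf : LocallyIntegrable f) : Integrable fun x => ζ x • f x :=
  hf.integrable_smul_left_of_hasCompactSupport h.1.continuous h.2

theorem IsTest.mul_smooth {ζ a : Space → ℝ} (h : IsTest ζ)
    (ha : ContDiff ℝ ((⊤ : ℕ∞) : WithTop ℕ∞) a) : IsTest fun x => ζ x * a x :=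
  ⟨h.1.mul ha, h.2.mul_right⟩

theorem partialDeriv_mul {a b : Space → ℝ} {x : Space} (ha : DifferentiableAt ℝ a x)
    (hb : DifferentiableAt ℝ b x) (k : Fin 3) :
    partialDeriv k (fun x => a x * b x) x = partialDeriv k a x * b x + a x * partialDeriv k b x := by
  simp only [partialDeriv]
  rw [HasFDerivAt.fderiv (f := fun x => a x * b x) (ha.hasFDerivAt.mul hb.hasFDerivAt)]
  simp; ring

theorem continuous_pd {u : Space → F} (hu : ContDiff ℝ 1 u) (k : Fin 3) : Continuous (pd k u) :=
  (hu.continuous_fderiv one_ne_zero).clm_apply continuous_const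

/-- Integration by parts against a test function. -/
theorem integral_partialDeriv_smul [CompleteSpace F] {ζ : Space → ℝ} (hζ : IsTest ζ)
    {u : Space → F} (hu : ContDiff ℝ 1 u) (k : Fin 3) :
    ∫ x, partialDeriv k ζ x • u x = - ∫ x, ζ x • pd k u x := by
  have h := integral_smul_fderiv_eq_neg_fderiv_smul_of_integrable (μ := volume) (f := ζ) (g := u)
    (v := EuclideanSpace.single k 1) ((hζ.partialDeriv k).integrable_smul
      hu.continuous.locallyIntegrable)
    (hζ.integrable_smul (continuous_pd hu k).locallyIntegrable)
    (hζ.integrable_smul hu.continuous.locallyIntegrable)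
    (fun x _ => hζ.contDiff_one.differentiable one_ne_zero x)
    (fun x _ => hu.differentiable one_ne_zero x)
  rw [eq_neg_iff_add_eq_zero, add_comm, ← eq_neg_iff_add_eq_zero]
  exact h

theorem HasWeakPartial.ae_unique [CompleteSpace F] {k : Fin 3} {f g₁ g₂ : Space → F}
    (h₁ : HasWeakPartial k f g₁) (h₂ : HasWeakPartial k f g₂) : g₁ =ᵐ[volume] g₂ :=
  ae_eq_of_integral_contDiff_smul_eq h₁.2.1 h₂.2.1 fun η hη hc => by
    rw [← neg_inj, ← h₁.2.2 η ⟨hη, hc⟩, ← h₂.2.2 η ⟨hη, hc⟩]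

theorem HasWeakPartial.weakPartial {k : Fin 3} {f g : Space → F} (h : HasWeakPartial k f g) :
    HasWeakPartial k f (weakPartial k f) := by
  have hex : ∃ g, HasWeakPartial k f g := ⟨g, h⟩
  rw [KGD.weakPartial, dif_pos hex]
  exact hex.choose_spec

theorem HasWeakPartial.weakPartial_ae [CompleteSpace F] {k : Fin 3} {f g : Space → F}
    (h : HasWeakPartial k f g) : KGD.weakPartial k f =ᵐ[volume] g :=
  h.weakPartial.ae_unique h

theorem HasWeakTimeDeriv.weakTimeDeriv_ae {χ : ℝ → Space → ℝ} {t : ℝ} {u : Space → ℝ}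
    (h : HasWeakTimeDeriv χ t u) : weakTimeDeriv χ t =ᵐ[volume] u := by
  have hex : ∃ u, HasWeakTimeDeriv χ t u := ⟨u, h⟩
  have h' : HasWeakTimeDeriv χ t (weakTimeDeriv χ t) := by
    rw [weakTimeDeriv, dif_pos hex]
    exact hex.choose_spec
  exact ae_eq_of_integral_contDiff_smul_eq h'.2.1 h.2.1 fun η hη hc =>
    (h'.2.2 η ⟨hη, hc⟩).unique (h.2.2 η ⟨hη, hc⟩)

theorem locallyIntegrable_clm_comp {H : Type} [NormedAddCommGroup H] [NormedSpace ℝ H]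
    (T : F →L[ℝ] H) {f : Space → F} (hf : LocallyIntegrable f) :
    LocallyIntegrable fun x => T (f x) := fun x => by
  obtain ⟨s, hs, hi⟩ := hf x
  exact ⟨s, hs, T.integrable_comp hi⟩

theorem HasWeakPartial.clm_comp [CompleteSpace F] {H : Type} [NormedAddCommGroup H]
    [NormedSpace ℝ H] [CompleteSpace H] {k : Fin 3}
    {f g : Space → F} (h : HasWeakPartial k f g) (T : F →L[ℝ] H) :
    HasWeakPartial k (fun x => T (f x)) (fun x => T (g x)) := by
  refine ⟨locallyIntegrable_clm_comp T h.1, locallyIntegrable_clm_comp T h.2.1, fun η hη => ?_⟩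
  simp_rw [← map_smul]
  rw [T.integral_comp_comm ((hη.partialDeriv k).integrable_smul h.1),
    T.integral_comp_comm (hη.integrable_smul h.2.1), h.2.2 η hη, map_neg]

theorem HasWeakPartial.add {k : Fin 3} {f₁ g₁ f₂ g₂ : Space → F}
    (h₁ : HasWeakPartial k f₁ g₁) (h₂ : HasWeakPartial k f₂ g₂) :
    HasWeakPartial k (f₁ + f₂) (g₁ + g₂) := by
  refine ⟨h₁.1.add h₂.1, h₁.2.1.add h₂.2.1, fun η hη => ?_⟩
  simp only [Pi.add_apply, smul_add]
  rw [integral_add ((hη.partialDeriv k).integrable_smul h₁.1)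
    ((hη.partialDeriv k).integrable_smul h₂.1),
    integral_add (hη.integrable_smul h₁.2.1) (hη.integrable_smul h₂.2.1),
    h₁.2.2 η hη, h₂.2.2 η hη, neg_add]

theorem locallyIntegrable_smul_continuous {a : Space → ℝ} (ha : Continuous a) {f : Space → F}
    (hf : LocallyIntegrable f) : LocallyIntegrable fun x => a x • f x := by
  rw [← locallyIntegrableOn_univ] at hf ⊢
  exact hf.continuousOn_smul isOpen_univ.isLocallyClosed ha.continuousOn

/-- Leibniz rule for the product with a smooth real function. -/
theorem HasWeakPartial.smul_smooth {k : Fin 3} {f g : Space → F} (h : HasWeakPartial k f g)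
    {a : Space → ℝ} (ha : ContDiff ℝ ((⊤ : ℕ∞) : WithTop ℕ∞) a) :
    HasWeakPartial k (fun x => a x • f x) (fun x => pd k a x • f x + a x • g x) := by
  have ha1 : ContDiff ℝ 1 a := ha.of_le (by exact_mod_cast le_top)
  have l1 := locallyIntegrable_smul_continuous (continuous_pd ha1 k) h.1
  have l2 := locallyIntegrable_smul_continuous ha1.continuous h.2.1
  have l3 := locallyIntegrable_smul_continuous ha1.continuous h.1
  refine ⟨l3, l1.add l2, fun η hη => ?_⟩
  have h1 := h.2.2 _ (hη.mul_smooth ha)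
  have h2 : ∀ x, KGD.partialDeriv k (fun x => η x * a x) x • f x
      = partialDeriv k η x • a x • f x + η x • pd k a x • f x := by
    intro x
    rw [partialDeriv_mul (hη.contDiff_one.differentiable one_ne_zero x)
      (ha1.differentiable one_ne_zero x), add_smul, mul_smul, mul_smul]
    rfl
  simp_rw [h2] at h1
  rw [integral_add ((hη.partialDeriv k).integrable_smul l3) (hη.integrable_smul l1)] at h1
  simp only [smul_add]
  rw [integral_add (hη.integrable_smul l1) (hη.integrable_smul l2), neg_add_rev]
  simp only [mul_smul] at h1
  rw [← h1]
  abel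

/-! ### Functions with square-integrable gradient -/

/-- `f` belongs to `H¹` and its weak partial derivatives are represented by the `f' k`. -/
def HasL2Gradient (f : Space → F) (f' : Fin 3 → Space → F) : Prop :=
  MemLp f 2 ∧ ∀ k, HasWeakPartial k f (f' k) ∧ MemLp (f' k) 2

theorem MemH1.hasL2Gradient [CompleteSpace F] {f : Space → F} (h : MemH1 f) :
    HasL2Gradient f (fun k => weakPartial k f) := by
  refine ⟨h.1, fun k => ?_⟩
  obtain ⟨g, hg, hg2⟩ := h.2 k
  exact ⟨hg.weakPartial, hg2.ae_eq hg.weakPartial_ae.symm⟩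

theorem HasL2Gradient.memH1 {f : Space → F} {f' : Fin 3 → Space → F} (h : HasL2Gradient f f') :
    MemH1 f :=
  ⟨h.1, fun k => ⟨f' k, (h.2 k)⟩⟩

theorem HasL2Gradient.moll_contDiff {f : Space → F} {f' : Fin 3 → Space → F}
    (h : HasL2Gradient f f') (n : ℕ) : ContDiff ℝ 1 (moll n f) :=
  (KGD.moll_contDiff n (locallyIntegrable_of_memLp_two h.1)).of_le (by exact_mod_cast le_top)

section Bilinear

variable {E₁ E₂ H : Type} [NormedAddCommGroup E₁] [NormedSpace ℝ E₁] [CompleteSpace E₁]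
  [NormedAddCommGroup E₂] [NormedSpace ℝ E₂] [CompleteSpace E₂]
  [NormedAddCommGroup H] [NormedSpace ℝ H] [CompleteSpace H]

theorem integrable_bilin (B : E₁ →L[ℝ] E₂ →L[ℝ] H) {f : Space → E₁} {g : Space → E₂}
    (hf : MemLp f 2) (hg : MemLp g 2) : Integrable fun x => B (f x) (g x) :=
  memLp_one_iff_integrable.1 (B.memLp_of_bilin 1 hf hg)

theorem tendsto_bilin_L1 (B : E₁ →L[ℝ] E₂ →L[ℝ] H) {fn : ℕ → Space → E₁} {gn : ℕ → Space → E₂}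
    {f : Space → E₁} {g : Space → E₂} (hfn : ∀ n, MemLp (fn n) 2) (hgn : ∀ n, MemLp (gn n) 2)
    (hf : MemLp f 2) (hg : MemLp g 2)
    (h1 : Tendsto (fun n => eLpNorm (fn n - f) 2 volume) atTop (𝓝 0))
    (h2 : Tendsto (fun n => eLpNorm (gn n - g) 2 volume) atTop (𝓝 0)) :
    Tendsto (fun n => eLpNorm ((fun x => B (fn n x) (gn n x)) - fun x => B (f x) (g x)) 1 volume)
      atTop (𝓝 0) := by
  rw [← Lp.tendsto_Lp_iff_tendsto_eLpNorm'' _ hfn _ hf] at h1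
  rw [← Lp.tendsto_Lp_iff_tendsto_eLpNorm'' _ hgn _ hg] at h2
  have hmn := fun n => B.memLp_of_bilin 1 (hfn n) (hgn n)
  rw [← Lp.tendsto_Lp_iff_tendsto_eLpNorm'' _ hmn _ (B.memLp_of_bilin 1 hf hg)]
  have hc : Continuous fun p : Lp E₁ 2 (volume : Measure Space) × Lp E₂ 2 (volume : Measure Space) =>
      B.holderL volume 2 2 1 p.1 p.2 :=
    ((B.holderL volume 2 2 1).continuous.comp continuous_fst).clm_apply continuous_snd
  have key := (hc.tendsto (hf.toLp f, hg.toLp g)).comp (h1.prodMk_nhds h2)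
  have e : ∀ {u : Space → E₁} {w : Space → E₂} (hu : MemLp u 2) (hw : MemLp w 2),
      B.holderL volume 2 2 1 (hu.toLp u) (hw.toLp w)
        = (B.memLp_of_bilin 1 hu hw).toLp (fun x => B (u x) (w x)) := by
    intro u w hu hw
    refine Lp.ext ?_
    filter_upwards [B.coeFn_holder (r := 1) (hu.toLp u) (hw.toLp w), hu.coeFn_toLp, hw.coeFn_toLp,
      (B.memLp_of_bilin 1 hu hw).coeFn_toLp] with x h1 h2 h3 h4
    rw [h4, ← h2, ← h3, ← h1]
    rfl
  simp only [Function.comp_def, e] at key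
  exact key

theorem tendsto_moll_bilin_L1 (B : E₁ →L[ℝ] E₂ →L[ℝ] H) {f : Space → E₁} {g : Space → E₂}
    (hf : MemLp f 2) (hg : MemLp g 2) :
    Tendsto (fun n => eLpNorm ((fun x => B (moll n f x) (moll n g x)) - fun x => B (f x) (g x)) 1
      volume) atTop (𝓝 0) :=
  tendsto_bilin_L1 B (fun n => memLp_moll n hf) (fun n => memLp_moll n hg) hf hg
    (moll_tendsto hf) (moll_tendsto hg)

/-- If `uₙ → u` in `L¹` and the uniformly bounded `cₙ` converge to `c` almost everywhere, then
`∫ cₙ uₙ → ∫ c u`. -/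
theorem tendsto_integral_smul {un : ℕ → Space → H} {u : Space → H} {cn : ℕ → Space → ℝ}
    {c : Space → ℝ} {C : ℝ} (hun : ∀ n, Integrable (un n)) (hu : Integrable u)
    (h : Tendsto (fun n => eLpNorm (un n - u) 1 volume) atTop (𝓝 0))
    (hcn : ∀ n, AEStronglyMeasurable (cn n)) (hb : ∀ n, ∀ᵐ x, ‖cn n x‖ ≤ C)
    (hlim : ∀ᵐ x, Tendsto (fun n => cn n x) atTop (𝓝 (c x))) :
    Tendsto (fun n => ∫ x, cn n x • un n x) atTop (𝓝 (∫ x, c x • u x)) := by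
  have i1 : ∀ n, Integrable fun x => cn n x • (un n - u) x := fun n =>
    ((hun n).sub hu).bdd_smul C (hcn n) (hb n)
  have i2 : ∀ n, Integrable fun x => cn n x • u x := fun n => hu.bdd_smul C (hcn n) (hb n)
  have e : ∀ n, ∫ x, cn n x • un n x
      = (∫ x, cn n x • (un n - u) x) + ∫ x, cn n x • u x := by
    intro n
    rw [← integral_add (i1 n) (i2 n)]
    simp [smul_sub]
  simp_rw [e]
  rw [show (∫ x, c x • u x) = 0 + ∫ x, c x • u x by simp]
  -- the first term is small in `L¹`, the second converges by domination
  refine Tendsto.add ?_ ?_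
  · have hz : Tendsto (fun n => C * (eLpNorm (un n - u) 1 volume).toReal) atTop (𝓝 0) := by
      simpa using ((ENNReal.tendsto_toReal (by simp)).comp h).const_mul C
    refine squeeze_zero_norm (fun n => ?_) hz
    have : (eLpNorm (un n - u) 1 volume).toReal = ∫ x, ‖(un n - u) x‖ := by
      rw [eLpNorm_one_eq_lintegral_enorm, integral_norm_eq_lintegral_enorm ((hun n).sub hu).1]
    rw [this, ← integral_const_mul]
    refine norm_integral_le_of_norm_le (((hun n).sub hu).norm.const_mul C) ?_
    filter_upwards [hb n] with x hx
    rw [norm_smul]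
    exact mul_le_mul_of_nonneg_right hx (norm_nonneg _)
  · refine tendsto_integral_of_dominated_convergence (fun x => C * ‖u x‖) (fun n => (i2 n).1)
      (hu.norm.const_mul C) (fun n => ?_) ?_
    · filter_upwards [hb n] with x hx
      rw [norm_smul]
      exact mul_le_mul_of_nonneg_right hx (norm_nonneg _)
    · filter_upwards [hlim] with x hx using hx.smul_const _

theorem tendsto_integral_test_smul {ζ : Space → ℝ} (hζ : IsTest ζ) {un : ℕ → Space → H}
    {u : Space → H} (hun : ∀ n, Integrable (un n)) (hu : Integrable u)
    (h : Tendsto (fun n => eLpNorm (un n - u) 1 volume) atTop (𝓝 0)) :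
    Tendsto (fun n => ∫ x, ζ x • un n x) atTop (𝓝 (∫ x, ζ x • u x)) := by
  obtain ⟨C, hC⟩ := hζ.bounded
  exact tendsto_integral_smul hun hu h (fun _ => hζ.1.continuous.aestronglyMeasurable)
    (fun _ => Eventually.of_forall hC) (Eventually.of_forall fun _ => tendsto_const_nhds)

theorem contDiff_bilin (B : E₁ →L[ℝ] E₂ →L[ℝ] H) {f : Space → E₁} {g : Space → E₂}
    {n : WithTop ℕ∞} (hf : ContDiff ℝ n f) (hg : ContDiff ℝ n g) :
    ContDiff ℝ n fun x => B (f x) (g x) :=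
  (B.contDiff.comp hf).clm_apply hg

theorem pd_bilin (B : E₁ →L[ℝ] E₂ →L[ℝ] H) {f : Space → E₁} {g : Space → E₂}
    (hf : ContDiff ℝ 1 f) (hg : ContDiff ℝ 1 g) (k : Fin 3) (x : Space) :
    pd k (fun x => B (f x) (g x)) x = B (pd k f x) (g x) + B (f x) (pd k g x) := by
  have := B.hasFDerivAt_of_bilinear (hf.differentiable one_ne_zero x).hasFDerivAt
    (hg.differentiable one_ne_zero x).hasFDerivAt
  rw [pd, this.fderiv]
  simp [pd, add_comm]

/-- Leibniz rule for a bilinear expression in two `H¹` functions. -/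
theorem HasL2Gradient.bilin (B : E₁ →L[ℝ] E₂ →L[ℝ] H) {f : Space → E₁} {g : Space → E₂}
    {f' : Fin 3 → Space → E₁} {g' : Fin 3 → Space → E₂}
    (hf : HasL2Gradient f f') (hg : HasL2Gradient g g') (k : Fin 3) :
    HasWeakPartial k (fun x => B (f x) (g x))
      (fun x => B (f' k x) (g x) + B (f x) (g' k x)) := by
  have j0 := integrable_bilin B hf.1 hg.1
  have j1 := integrable_bilin B (hf.2 k).2 hg.1
  have j2 := integrable_bilin B hf.1 (hg.2 k).2
  -- the identity holds for the mollifications and passes to the limit in `L¹`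
  refine ⟨j0.locallyIntegrable, (j1.add j2).locallyIntegrable, fun ζ hζ => ?_⟩
  have i0 := fun n => integrable_bilin B (memLp_moll n hf.1) (memLp_moll n hg.1)
  have i1 := fun n => integrable_bilin B (memLp_moll n (hf.2 k).2) (memLp_moll n hg.1)
  have i2 := fun n => integrable_bilin B (memLp_moll n hf.1) (memLp_moll n (hg.2 k).2)
  have t0 := tendsto_integral_test_smul (hζ.partialDeriv k) i0 j0
    (tendsto_moll_bilin_L1 B hf.1 hg.1)
  have t1 := tendsto_integral_test_smul hζ i1 j1
    (tendsto_moll_bilin_L1 B (hf.2 k).2 hg.1)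
  have t2 := tendsto_integral_test_smul hζ i2 j2
    (tendsto_moll_bilin_L1 B hf.1 (hg.2 k).2)
  refine tendsto_nhds_unique t0 ?_
  simp only [smul_add]
  rw [integral_add (hζ.integrable_smul j1.locallyIntegrable)
    (hζ.integrable_smul j2.locallyIntegrable)]
  refine (t1.add t2).neg.congr fun n => ?_
  have h := integral_partialDeriv_smul hζ
    (contDiff_bilin B (hf.moll_contDiff n) (hg.moll_contDiff n)) k
  rw [h, ← integral_add (hζ.integrable_smul (i1 n).locallyIntegrable)
    (hζ.integrable_smul (i2 n).locallyIntegrable)]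
  congr 1
  refine integral_congr_ae (Eventually.of_forall fun x => ?_)
  simp only [← smul_add]
  rw [pd_bilin B (hf.moll_contDiff n) (hg.moll_contDiff n), pd_moll n k (hf.2 k).1,
    pd_moll n k (hg.2 k).1]

end Bilinear

/-! ### Null forms and compositions -/

section Bilinear

variable {E₁ E₂ H : Type} [NormedAddCommGroup E₁] [NormedSpace ℝ E₁] [CompleteSpace E₁]
  [NormedAddCommGroup E₂] [NormedSpace ℝ E₂] [CompleteSpace E₂]
  [NormedAddCommGroup H] [NormedSpace ℝ H] [CompleteSpace H]

theorem contDiff_pd {u : Space → F} (hu : ContDiff ℝ ((⊤ : ℕ∞) : WithTop ℕ∞) u) (k : Fin 3) :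
    ContDiff ℝ ((⊤ : ℕ∞) : WithTop ℕ∞) (pd k u) :=
  (hu.fderiv_right (m := ((⊤ : ℕ∞) : WithTop ℕ∞)) le_rfl).clm_apply contDiff_const

theorem pd_comm {u : Space → F} (hu : ContDiff ℝ ((⊤ : ℕ∞) : WithTop ℕ∞) u) (j k : Fin 3)
    (x : Space) : pd j (pd k u) x = pd k (pd j u) x := by
  have hd : DifferentiableAt ℝ (fderiv ℝ u) x :=
    (hu.fderiv_right (m := ((⊤ : ℕ∞) : WithTop ℕ∞)) le_rfl).differentiable (by simp) x
  have e : ∀ i l : Fin 3, pd i (pd l u) x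
      = fderiv ℝ (fderiv ℝ u) x (EuclideanSpace.single i 1) (EuclideanSpace.single l 1) := by
    intro i l
    have := (hd.hasFDerivAt.clm_apply (hasFDerivAt_const (EuclideanSpace.single l (1 : ℝ)) x)).fderiv
    rw [pd, show pd l u = fun y => fderiv ℝ u y (EuclideanSpace.single l 1) from rfl, this]
    simp
  have hs : IsSymmSndFDerivAt ℝ u x :=
    hu.contDiffAt.isSymmSndFDerivAt (by
      rw [minSmoothness_of_isRCLikeNormedField]; exact WithTop.coe_le_coe.2 (le_top : (2 : ℕ∞) ≤ ⊤))
  rw [e, e, hs.eq]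

/-- The antisymmetrised products `B(∂_j f, ∂_k g) - B(∂_k f, ∂_j g)` are divergences. This is what
replaces second derivatives of the Dirac field in the derivation of the virial identities. -/
theorem HasL2Gradient.null_form (B : E₁ →L[ℝ] E₂ →L[ℝ] H) {f : Space → E₁} {g : Space → E₂}
    {f' : Fin 3 → Space → E₁} {g' : Fin 3 → Space → E₂}
    (hf : HasL2Gradient f f') (hg : HasL2Gradient g g') (j k : Fin 3) {ζ : Space → ℝ}
    (hζ : IsTest ζ) :
    (∫ x, partialDeriv j ζ x • B (f x) (g' k x)) - ∫ x, partialDeriv k ζ x • B (f x) (g' j x)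
      = - ((∫ x, ζ x • B (f' j x) (g' k x)) - ∫ x, ζ x • B (f' k x) (g' j x)) := by
  have t : ∀ {ξ : Space → ℝ} {u : Space → E₁} {w : Space → E₂}, IsTest ξ → MemLp u 2 → MemLp w 2 →
      Tendsto (fun n => ∫ x, ξ x • B (moll n u x) (moll n w x)) atTop
        (𝓝 (∫ x, ξ x • B (u x) (w x))) := fun hξ hu hw =>
    tendsto_integral_test_smul hξ (fun n => integrable_bilin B (memLp_moll n hu) (memLp_moll n hw))
      (integrable_bilin B hu hw) (tendsto_moll_bilin_L1 B hu hw)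
  refine tendsto_nhds_unique ((t (hζ.partialDeriv j) hf.1 (hg.2 k).2).sub
    (t (hζ.partialDeriv k) hf.1 (hg.2 j).2)) ?_
  refine (((t hζ (hf.2 j).2 (hg.2 k).2).sub (t hζ (hf.2 k).2 (hg.2 j).2)).neg).congr fun n => ?_
  have sf := KGD.moll_contDiff n (locallyIntegrable_of_memLp_two hf.1)
  have sg := KGD.moll_contDiff n (locallyIntegrable_of_memLp_two hg.1)
  have sf1 := hf.moll_contDiff n
  have sg1 : ∀ i, ContDiff ℝ 1 (pd i (moll n g)) := fun i =>
    (contDiff_pd sg i).of_le (by exact_mod_cast le_top)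
  simp only [← fun i => pd_moll n i (hg.2 i).1, ← fun i => pd_moll n i (hf.2 i).1]
  rw [integral_partialDeriv_smul hζ (contDiff_bilin B sf1 (sg1 k)) j,
    integral_partialDeriv_smul hζ (contDiff_bilin B sf1 (sg1 j)) k]
  have c1 : ∀ i l, LocallyIntegrable fun x => B (pd i (moll n f) x) (pd l (moll n g) x) :=
    fun i l => (contDiff_bilin B (contDiff_pd sf i) (contDiff_pd sg l)).continuous.locallyIntegrable
  have c2 : ∀ i l, LocallyIntegrable fun x => B (moll n f x) (pd i (pd l (moll n g)) x) :=
    fun i l => (contDiff_bilin B sf (contDiff_pd (contDiff_pd sg l) i)).continuous.locallyIntegrable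
  simp_rw [pd_bilin B sf1 (sg1 _), smul_add]
  rw [integral_add (hζ.integrable_smul (c1 j k)) (hζ.integrable_smul (c2 j k)),
    integral_add (hζ.integrable_smul (c1 k j)) (hζ.integrable_smul (c2 k j))]
  -- the terms with two derivatives on `g` cancel by symmetry
  simp_rw [pd_comm sg j k]
  abel

/-- Chain rule for `Γ(B(f, f))`, where `Γ` is `C¹` with bounded derivative. -/
theorem HasL2Gradient.chain_rule (B : F →L[ℝ] F →L[ℝ] ℝ) [CompleteSpace F] {f : Space → F}
    {f' : Fin 3 → Space → F} (hf : HasL2Gradient f f') {Γ : ℝ → ℝ} (hΓ : ContDiff ℝ 1 Γ)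
    (h0 : Γ 0 = 0) {C : ℝ} (hC : ∀ s, ‖deriv Γ s‖ ≤ C) (j : Fin 3) {ζ : Space → ℝ}
    (hζ : IsTest ζ) :
    ∫ x, partialDeriv j ζ x * Γ (B (f x) (f x))
      = - ∫ x, ζ x * (deriv Γ (B (f x) (f x)) * (B (f' j x) (f x) + B (f x) (f' j x))) := by
  -- `Γ` is Lipschitz, so that everything passes to the limit from the mollifications of `f`
  have hlip : ∀ a b, ‖Γ a - Γ b‖ ≤ C * ‖a - b‖ := fun a b =>
    Convex.norm_image_sub_le_of_norm_deriv_le (fun x _ => hΓ.differentiable one_ne_zero x)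
      (fun x _ => hC x) convex_univ (Set.mem_univ _) (Set.mem_univ _)
  have hdc : Continuous (deriv Γ) := hΓ.continuous_deriv le_rfl
  have hloc := locallyIntegrable_of_memLp_two hf.1
  have hΓi : ∀ {u : Space → ℝ}, Integrable u → Integrable fun x => Γ (u x) := by
    intro u hu
    refine (hu.norm.const_mul C).mono' (hΓ.continuous.comp_aestronglyMeasurable hu.1)
      (Eventually.of_forall fun x => ?_)
    simpa [h0] using hlip (u x) 0
  have i0 := integrable_bilin B hf.1 hf.1
  have i1 := (integrable_bilin B (hf.2 j).2 hf.1).add (integrable_bilin B hf.1 (hf.2 j).2)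
  have n0 := fun n => integrable_bilin B (memLp_moll n hf.1) (memLp_moll n hf.1)
  have n1 := fun n => (integrable_bilin B (memLp_moll n (hf.2 j).2) (memLp_moll n hf.1)).add
    (integrable_bilin B (memLp_moll n hf.1) (memLp_moll n (hf.2 j).2))
  have T0 := tendsto_moll_bilin_L1 B hf.1 hf.1
  have T1 : Tendsto (fun n => eLpNorm (((fun x => B (moll n (f' j) x) (moll n f x))
      + fun x => B (moll n f x) (moll n (f' j) x))
      - ((fun x => B (f' j x) (f x)) + fun x => B (f x) (f' j x))) 1 volume) atTop (𝓝 0) := by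
    have a1 := tendsto_moll_bilin_L1 B (hf.2 j).2 hf.1
    have a2 := tendsto_moll_bilin_L1 B hf.1 (hf.2 j).2
    have a3 := a1.add a2
    rw [add_zero] at a3
    refine tendsto_of_tendsto_of_tendsto_of_le_of_le tendsto_const_nhds a3 (fun _ => zero_le)
      fun n => ?_
    simp only [add_sub_add_comm]
    exact eLpNorm_add_le ((integrable_bilin B (memLp_moll n (hf.2 j).2) (memLp_moll n hf.1)).sub
        (integrable_bilin B (hf.2 j).2 hf.1)).1
      ((integrable_bilin B (memLp_moll n hf.1) (memLp_moll n (hf.2 j).2)).sub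
        (integrable_bilin B hf.1 (hf.2 j).2)).1 le_rfl
  have TΓ : Tendsto (fun n => eLpNorm ((fun x => Γ (B (moll n f x) (moll n f x)))
      - fun x => Γ (B (f x) (f x))) 1 volume) atTop (𝓝 0) := by
    have hz : Tendsto (fun n => ENNReal.ofReal C * eLpNorm ((fun x => B (moll n f x) (moll n f x))
        - fun x => B (f x) (f x)) 1 volume) atTop (𝓝 0) := by
      simpa using ENNReal.Tendsto.const_mul T0 (Or.inr ENNReal.ofReal_ne_top)
    refine tendsto_of_tendsto_of_tendsto_of_le_of_le tendsto_const_nhds hz (fun _ => zero_le)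
      fun n => ?_
    exact eLpNorm_le_mul_eLpNorm_of_ae_le_mul (Eventually.of_forall fun x => hlip _ _) 1
  have L0 := tendsto_integral_test_smul (hζ.partialDeriv j) (fun n => hΓi (n0 n)) (hΓi i0) TΓ
  obtain ⟨D, hD⟩ := hζ.bounded
  have L1 := tendsto_integral_smul (cn := fun n x => ζ x * deriv Γ (B (moll n f x) (moll n f x)))
    (c := fun x => ζ x * deriv Γ (B (f x) (f x))) (C := D * C) n1 i1 T1
    (fun n => hζ.1.continuous.aestronglyMeasurable.mul
      (hdc.comp_aestronglyMeasurable (n0 n).1))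
    (fun n => Eventually.of_forall fun x => by
      rw [norm_mul]
      exact mul_le_mul (hD x) (hC _) (norm_nonneg _) ((norm_nonneg _).trans (hD x)))
    (by
      filter_upwards [moll_ae_tendsto hloc] with x hx
      have hb : Tendsto (fun n => B (moll n f x) (moll n f x)) atTop (𝓝 (B (f x) (f x))) :=
        (B.continuous₂.tendsto (f x, f x)).comp (hx.prodMk_nhds hx)
      exact ((hdc.tendsto _).comp hb).const_mul _)
  simp only [smul_eq_mul, Pi.add_apply, mul_assoc] at L0 L1
  refine tendsto_nhds_unique L0 (L1.neg.congr fun n => ?_)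
  have sf := hf.moll_contDiff n
  have h := integral_partialDeriv_smul hζ (hΓ.comp (contDiff_bilin B sf sf)) j
  simp only [smul_eq_mul, Function.comp_def] at h
  rw [h]
  congr 1
  refine integral_congr_ae (Eventually.of_forall fun x => ?_)
  have hd := ((hΓ.differentiable one_ne_zero (B (moll n f x) (moll n f x))).hasDerivAt).comp_hasFDerivAt x
    ((contDiff_bilin B sf sf).differentiable one_ne_zero x).hasFDerivAt
  have e : pd j (fun x => Γ (B (moll n f x) (moll n f x))) x
      = deriv Γ (B (moll n f x) (moll n f x)) * pd j (fun x => B (moll n f x) (moll n f x)) x := by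
    rw [pd, HasFDerivAt.fderiv (f := fun x => Γ (B (moll n f x) (moll n f x))) hd]
    rfl
  simp only [e, pd_bilin B sf sf, pd_moll n j (hf.2 j).1]

end Bilinear

/-! ### Integrals of divergences -/

/-- A fixed cut-off function equal to one near the origin. -/
noncomputable def cutoff : ContDiffBump (0 : Space) := ⟨1, 2, one_pos, one_lt_two⟩

theorem isTest_cutoff : IsTest cutoff := ⟨cutoff.contDiff, cutoff.hasCompactSupport⟩

theorem cutoff_zero : cutoff 0 = 1 :=
  cutoff.one_of_mem_closedBall (by simp [cutoff])

theorem IsTest.rescale {w : Space → ℝ} (hw : IsTest w) (n : ℕ) :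
    IsTest fun x => w (((n : ℝ) + 1)⁻¹ • x) := by
  have hn : ((n : ℝ) + 1)⁻¹ ≠ 0 := by positivity
  exact ⟨hw.1.comp (contDiff_const_smul _), hw.2.comp_homeomorph (Homeomorph.smulOfNeZero _ hn)⟩

theorem partialDeriv_rescale {w : Space → ℝ} (hw : IsTest w) (n : ℕ) (k : Fin 3) (x : Space) :
    partialDeriv k (fun x => w (((n : ℝ) + 1)⁻¹ • x)) x
      = ((n : ℝ) + 1)⁻¹ * partialDeriv k w (((n : ℝ) + 1)⁻¹ • x) := by
  have h := ((hw.contDiff_one.differentiable one_ne_zero _).hasFDerivAt).comp x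
    ((hasFDerivAt_id (𝕜 := ℝ) x).const_smul ((n : ℝ) + 1)⁻¹)
  simp only [partialDeriv]
  rw [HasFDerivAt.fderiv (f := fun x => w (((n : ℝ) + 1)⁻¹ • x)) h]
  simp

theorem tendsto_rescale {w : Space → ℝ} (hw : Continuous w) (x : Space) :
    Tendsto (fun n : ℕ => w (((n : ℝ) + 1)⁻¹ • x)) atTop (𝓝 (w 0)) := by
  have h : Tendsto (fun n : ℕ => ((n : ℝ) + 1)⁻¹ • x) atTop (𝓝 0) := by
    simpa [one_div] using (tendsto_one_div_add_atTop_nhds_zero_nat (𝕜 := ℝ)).smul_const x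
  exact (hw.tendsto 0).comp h

theorem tendsto_integral_rescale [CompleteSpace F] {w : Space → ℝ} (hw : IsTest w) {u : Space → F}
    (hu : Integrable u) :
    Tendsto (fun n : ℕ => ∫ x, w (((n : ℝ) + 1)⁻¹ • x) • u x) atTop (𝓝 (w 0 • ∫ x, u x)) := by
  obtain ⟨C, hC⟩ := hw.bounded
  rw [← integral_smul]
  exact tendsto_integral_smul (c := fun _ => w 0) (fun _ => hu) hu (by simp)
    (fun n => (hw.rescale n).1.continuous.aestronglyMeasurable)
    (fun n => Eventually.of_forall fun x => hC _)
    (Eventually.of_forall fun x => tendsto_rescale hw.1.continuous x)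

/-- An integrable derivative of an integrable function has integral zero. -/
theorem HasWeakPartial.integral_eq_zero [CompleteSpace F] {k : Fin 3} {f g : Space → F}
    (h : HasWeakPartial k f g) (hf : Integrable f) (hg : Integrable g) : ∫ x, g x = 0 := by
  have h1 := (tendsto_integral_rescale isTest_cutoff hg).neg
  rw [cutoff_zero, one_smul] at h1
  have h2 := (tendsto_integral_rescale (isTest_cutoff.partialDeriv k) hf)
  have h3 := (tendsto_one_div_add_atTop_nhds_zero_nat (𝕜 := ℝ)).smul h2
  rw [zero_smul] at h3
  rw [← neg_eq_zero]
  refine tendsto_nhds_unique h1 (h3.congr fun n => ?_)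
  rw [← h.2.2 _ (isTest_cutoff.rescale n), ← integral_smul]
  simp_rw [partialDeriv_rescale isTest_cutoff, mul_smul, one_div]

/-- An integrable field with vanishing distributional divergence has mean zero: test the divergence
with a cut-off coordinate function. -/
theorem integral_eq_zero_of_divergence_free {Θ : Fin 3 → Space → ℝ} (hΘ : ∀ k, Integrable (Θ k))
    (h : ∀ ζ, IsTest ζ → ∑ k, ∫ x, partialDeriv k ζ x * Θ k x = 0) (j : Fin 3) :
    ∫ x, Θ j x = 0 := by
  have hcoord : ContDiff ℝ ((⊤ : ℕ∞) : WithTop ℕ∞) fun x : Space => x j :=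
    (EuclideanSpace.proj (𝕜 := ℝ) j).contDiff
  -- `w` agrees with the coordinate `x_j` near the origin, so that `n` times the gradient of `w(x / n)`
  -- tends to the unit vector `e_j`
  have hw : IsTest fun x => cutoff x * x j := isTest_cutoff.mul_smooth hcoord
  have hw0 : ∀ k, partialDeriv k (fun x => cutoff x * x j) 0 = if k = j then 1 else 0 := by
    intro k
    rw [partialDeriv_mul (isTest_cutoff.contDiff_one.differentiable one_ne_zero 0)
      (hcoord.differentiable (by simp) 0), cutoff_zero]
    have : partialDeriv k (fun x : Space => x j) 0 = if k = j then 1 else 0 := by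
      rw [partialDeriv, HasFDerivAt.fderiv (f := fun x : Space => x j)
        (EuclideanSpace.proj (𝕜 := ℝ) j).hasFDerivAt]
      simp [eq_comm]
    simp [this]
  have h1 := tendsto_finsetSum Finset.univ fun k _ =>
    tendsto_integral_rescale (hw.partialDeriv k) (hΘ k)
  simp only [hw0, smul_eq_mul, ite_mul, one_mul, zero_mul, Finset.sum_ite_eq', Finset.mem_univ,
    if_true] at h1
  refine tendsto_nhds_unique h1 (tendsto_const_nhds.congr fun n => ?_)
  have hn : (n : ℝ) + 1 ≠ 0 := by positivity
  have h2 := h _ (hw.rescale n)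
  simp only [partialDeriv_rescale hw, mul_assoc, integral_const_mul] at h2
  rw [← Finset.mul_sum, mul_eq_zero, inv_eq_zero] at h2
  exact (h2.resolve_left hn).symm

/-! ### The Sobolev embedding of `H¹` in `L⁶` -/

theorem clm_apply_eq_sum (T : Space →L[ℝ] F) (x : Space) :
    T x = ∑ k, x k • T (EuclideanSpace.single k 1) := by
  have hx : x = ∑ k, x k • EuclideanSpace.single k (1 : ℝ) := by
    ext i; simp [Finset.sum_apply, Pi.single_apply]
  conv_lhs => rw [hx, map_sum]
  simp only [map_smul]

theorem opNorm_le_sum (T : Space →L[ℝ] F) :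
    ‖T‖ ≤ ∑ k, ‖T (EuclideanSpace.single k 1)‖ := by
  refine T.opNorm_le_bound (Finset.sum_nonneg fun _ _ => norm_nonneg _) fun x => ?_
  rw [clm_apply_eq_sum]
  refine (norm_sum_le _ _).trans ?_
  rw [Finset.sum_mul]
  refine Finset.sum_le_sum fun k _ => ?_
  rw [norm_smul, mul_comm]
  exact mul_le_mul_of_nonneg_left (PiLp.norm_apply_le x k) (norm_nonneg _)

/-- The Gagliardo–Nirenberg–Sobolev inequality in three dimensions. -/
theorem eLpNorm_six_le [FiniteDimensional ℝ F] {u : Space → F} (hu : ContDiff ℝ 1 u)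
    (hc : HasCompactSupport u) :
    eLpNorm u 6 volume
      ≤ SNormLESNormFDerivOfEqConst F (volume : Measure Space) 2 * eLpNorm (fderiv ℝ u) 2 volume := by
  have hfin : Module.finrank ℝ Space = 3 := by simp
  have h : (((6 : ℝ≥0) : ℝ))⁻¹ = ((2 : ℝ≥0) : ℝ)⁻¹ - (Module.finrank ℝ Space : ℝ)⁻¹ := by
    rw [hfin]; norm_num
  exact eLpNorm_le_eLpNorm_fderiv_of_eq (volume : Measure Space) hu hc (p := 2) (p' := 6)
    one_le_two (by rw [hfin]; norm_num) h

/-- The Sobolev inequality is applied to the truncated mollifications of `f`, whose gradients are bounded in `L²`; Fatou's lemma carries the bound over to `f`. -/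
theorem HasL2Gradient.memLp_six [FiniteDimensional ℝ F] {f : Space → F} {f' : Fin 3 → Space → F}
    (hf : HasL2Gradient f f') : MemLp f 6 := by
  have : CompleteSpace F := FiniteDimensional.complete ℝ F
  have hloc := locallyIntegrable_of_memLp_two hf.1
  obtain ⟨u, hudef⟩ : ∃ u : ℕ → Space → F,
      u = fun (n : ℕ) x => cutoff (((n : ℝ) + 1)⁻¹ • x) • moll n f x := ⟨_, rfl⟩
  have hu : ∀ n, ContDiff ℝ 1 (u n) := fun n => hudef ▸
    (isTest_cutoff.rescale n).contDiff_one.smul (hf.moll_contDiff n)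
  have huc : ∀ n, HasCompactSupport (u n) := fun n => hudef ▸
    (isTest_cutoff.rescale n).2.smul_right
  choose D hD using fun k => (isTest_cutoff.partialDeriv k).bounded
  obtain ⟨C, hCdef⟩ : ∃ C : ℝ≥0, C = (∑ k, ‖D k‖).toNNReal := ⟨_, rfl⟩
  obtain ⟨A, hAdef⟩ : ∃ A : ℝ≥0∞, A = C * eLpNorm f 2 volume + ∑ k, eLpNorm (f' k) 2 volume :=
    ⟨_, rfl⟩
  have hA : A < ∞ := by
    rw [hAdef]
    refine ENNReal.add_lt_top.2 ⟨ENNReal.mul_lt_top (by simp) hf.1.2, ?_⟩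
    exact ENNReal.sum_lt_top.2 fun k _ => (hf.2 k).2.2
  have hgrad : ∀ n, eLpNorm (fderiv ℝ (u n)) 2 volume ≤ A := by
    intro n
    have hpt : ∀ x, ‖fderiv ℝ (u n) x‖ ≤
        ‖((fun x => (C : ℝ) • ‖moll n f x‖) + ∑ k, fun x => ‖moll n (f' k) x‖) x‖ := by
      intro x
      rw [Real.norm_of_nonneg (by
        simp only [Pi.add_apply, Finset.sum_apply]; positivity)]
      refine (opNorm_le_sum _).trans ?_
      have hk : ∀ k, ‖fderiv ℝ (u n) x (EuclideanSpace.single k 1)‖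
          ≤ ‖D k‖ * ‖moll n f x‖ + ‖moll n (f' k) x‖ := by
        intro k
        have hd := ((isTest_cutoff.rescale n).contDiff_one.differentiable one_ne_zero
          x).hasFDerivAt.smul ((hf.moll_contDiff n).differentiable one_ne_zero x).hasFDerivAt
        rw [hudef, HasFDerivAt.fderiv (f := fun x => cutoff (((n : ℝ) + 1)⁻¹ • x) • moll n f x) hd]
        have e1 := partialDeriv_rescale isTest_cutoff n k x
        have e2 := congrFun (pd_moll n k (hf.2 k).1) x
        simp only [partialDeriv, pd] at e1 e2
        simp only [add_apply, smul_apply,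
          ContinuousLinearMap.smulRight_apply, e1, e2]
        rw [add_comm]
        refine (norm_add_le _ _).trans (add_le_add ?_ ?_)
        · rw [norm_smul]
          refine mul_le_mul_of_nonneg_right ?_ (norm_nonneg _)
          rw [norm_mul]
          refine (mul_le_of_le_one_left (norm_nonneg _) ?_).trans
            ((hD k _).trans (le_abs_self _))
          rw [Real.norm_of_nonneg (by positivity)]
          exact inv_le_one_of_one_le₀ (by have : (0 : ℝ) ≤ n := n.cast_nonneg; linarith)
        · rw [norm_smul]
          refine mul_le_of_le_one_left (norm_nonneg _) ?_
          rw [Real.norm_of_nonneg cutoff.nonneg]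
          exact cutoff.le_one
      refine (Finset.sum_le_sum fun k _ => hk k).trans ?_
      rw [Finset.sum_add_distrib, ← Finset.sum_mul]
      simp only [Pi.add_apply, Finset.sum_apply, smul_eq_mul, hCdef]
      rw [Real.coe_toNNReal _ (by positivity)]
    have mk : ∀ k, AEStronglyMeasurable (fun x => ‖moll n (f' k) x‖) volume := fun k =>
      (memLp_moll n (hf.2 k).2).1.norm
    rw [hAdef]
    have m1 : AEStronglyMeasurable (fun x => (C : ℝ) • ‖moll n f x‖) volume :=
      (memLp_moll n hf.1).1.norm.const_smul (C : ℝ)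
    have m2 : AEStronglyMeasurable (∑ k, fun x => ‖moll n (f' k) x‖) volume :=
      Finset.aestronglyMeasurable_sum _ fun k _ => mk k
    have s1 := eLpNorm_add_le m1 m2 (p := 2) one_le_two
    have s2 := eLpNorm_sum_le (s := Finset.univ) (fun k _ => mk k) (p := 2) one_le_two
    refine ((eLpNorm_mono hpt).trans s1).trans (add_le_add ?_ (s2.trans ?_))
    · rw [show (fun x => (C : ℝ) • ‖moll n f x‖) = (C : ℝ) • fun x => ‖moll n f x‖ from rfl,
        eLpNorm_const_smul, eLpNorm_norm]
      refine mul_le_mul' (by simp) (eLpNorm_moll_le n hf.1.1)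
    · refine Finset.sum_le_sum fun k _ => ?_
      rw [eLpNorm_norm]
      exact eLpNorm_moll_le n (hf.2 k).2.1
  have hsix : ∀ n, eLpNorm (u n) 6 volume
      ≤ SNormLESNormFDerivOfEqConst F (volume : Measure Space) 2 * A := by
    intro n
    exact (eLpNorm_six_le (hu n) (huc n)).trans (mul_le_mul_of_nonneg_left (hgrad n) zero_le)
  refine ⟨hf.1.1, ?_⟩
  have hlim : ∀ᵐ x, Tendsto (fun n => u n x) atTop (𝓝 (f x)) := by
    filter_upwards [moll_ae_tendsto hloc] with x hx
    have := (tendsto_rescale cutoff.continuous x).smul hx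
    rw [cutoff_zero, one_smul] at this
    rwa [hudef]
  refine (Lp.eLpNorm_lim_le_liminf_eLpNorm
    (fun n => (hu n).continuous.aestronglyMeasurable) f hlim).trans_lt ?_
  refine (liminf_le_of_frequently_le' (Frequently.of_forall hsix)).trans_lt ?_
  exact ENNReal.mul_lt_top (by simp) hA

/-! ### The Yukawa kernel -/

/-- The radial profile `e^{-Mr} / (4πr)` of the Yukawa kernel. -/
noncomputable def yukawaProfile (M r : ℝ) : ℝ := Real.exp (-M * r) / (4 * Real.pi * r)

/-- The derivative of the radial profile of the Yukawa kernel. -/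
noncomputable def yukawaProfileDeriv (M r : ℝ) : ℝ :=
  -((M * r + 1) * Real.exp (-M * r) / (4 * Real.pi * r ^ 2))

/-- The Yukawa kernel, the fundamental solution of `-Δ + M²`. -/
noncomputable def yukawa (M : ℝ) (x : Space) : ℝ := yukawaProfile M ‖x‖

/-- The partial derivatives of the Yukawa kernel away from the origin. -/
noncomputable def yukawaGrad (M : ℝ) (k : Fin 3) (x : Space) : ℝ :=
  yukawaProfileDeriv M ‖x‖ * (x k / ‖x‖)

theorem measurable_yukawaProfileDeriv (M : ℝ) : Measurable (yukawaProfileDeriv M) := by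
  unfold yukawaProfileDeriv; fun_prop

theorem measurable_yukawaGrad (M : ℝ) (k : Fin 3) : Measurable (yukawaGrad M k) := by
  have : Measurable fun x : Space => x k := (EuclideanSpace.proj (𝕜 := ℝ) k).continuous.measurable
  exact ((measurable_yukawaProfileDeriv M).comp measurable_norm).mul (this.div measurable_norm)

theorem hasDerivAt_yukawaProfile (M : ℝ) {r : ℝ} (hr : r ≠ 0) :
    HasDerivAt (yukawaProfile M) (yukawaProfileDeriv M r) r := by
  have h1 : HasDerivAt (fun r : ℝ => Real.exp (-M * r)) (Real.exp (-M * r) * (-M * 1)) r :=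
    ((hasDerivAt_id r).const_mul (-M)).exp
  have h2 : HasDerivAt (fun r : ℝ => 4 * Real.pi * r) (4 * Real.pi * 1) r :=
    (hasDerivAt_id r).const_mul _
  have h := h1.div h2 (by positivity)
  refine h.congr_deriv ?_
  rw [yukawaProfileDeriv]
  field_simp
  ring

theorem integrableOn_pow_mul_exp {M : ℝ} (hM : 0 < M) (n : ℕ) :
    IntegrableOn (fun r : ℝ => r ^ n * Real.exp (-M * r)) (Set.Ioi 0) := by
  have h := integrableOn_rpow_mul_exp_neg_mul_rpow (p := 1) (s := n) (b := M)
    (by have : (0 : ℝ) ≤ n := n.cast_nonneg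
        linarith) one_pos hM
  simpa using h

theorem integrable_radial {f : ℝ → ℝ} (h : IntegrableOn (fun r => r ^ 2 * f r) (Set.Ioi 0)) :
    Integrable fun x : Space => f ‖x‖ := by
  rw [integrable_fun_norm_addHaar]
  simpa using h

theorem integrable_yukawa {M : ℝ} (hM : 0 < M) : Integrable (yukawa M) := by
  refine integrable_radial ?_
  refine IntegrableOn.congr_fun ((integrableOn_pow_mul_exp hM 1).const_mul (1 / (4 * Real.pi)))
    (fun r hr => ?_) measurableSet_Ioi
  have : r ≠ 0 := ne_of_gt hr
  simp only [yukawaProfile]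
  field_simp

theorem integrable_yukawa_sq {M : ℝ} (hM : 0 < M) : Integrable fun x => yukawa M x ^ 2 := by
  refine integrable_radial (f := fun r => yukawaProfile M r ^ 2) ?_
  refine IntegrableOn.congr_fun ((integrableOn_pow_mul_exp (M := 2 * M) (by positivity) 0).const_mul
    (1 / (4 * Real.pi) ^ 2)) (fun r hr => ?_) measurableSet_Ioi
  have : r ≠ 0 := ne_of_gt hr
  have he : Real.exp (-(2 * M) * r) = Real.exp (-M * r) ^ 2 := by
    rw [← Real.exp_nat_mul]; congr 1; push_cast; ring
  simp only [yukawaProfile, he]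
  field_simp

theorem integrable_yukawaProfileDeriv {M : ℝ} (hM : 0 < M) :
    Integrable fun x : Space => yukawaProfileDeriv M ‖x‖ := by
  refine integrable_radial ?_
  refine IntegrableOn.congr_fun ((((integrableOn_pow_mul_exp hM 1).const_mul M).add
    (integrableOn_pow_mul_exp hM 0)).const_mul (-(1 / (4 * Real.pi))))
    (fun r hr => ?_) measurableSet_Ioi
  have : r ≠ 0 := ne_of_gt hr
  simp only [yukawaProfileDeriv, Pi.add_apply]
  field_simp

theorem abs_coord_div_norm_le (x : Space) (k : Fin 3) : |x k / ‖x‖| ≤ 1 := by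
  rw [abs_div, abs_norm]
  exact div_le_one_of_le₀ (PiLp.norm_apply_le x k) (norm_nonneg _)

theorem integrable_yukawaGrad {M : ℝ} (hM : 0 < M) (k : Fin 3) : Integrable (yukawaGrad M k) := by
  refine (integrable_yukawaProfileDeriv hM).mono (measurable_yukawaGrad M k).aestronglyMeasurable
    (Eventually.of_forall fun x => ?_)
  rw [yukawaGrad, norm_mul]
  exact mul_le_of_le_one_right (norm_nonneg _) (abs_coord_div_norm_le x k)

/-- The norm regularised at the origin. -/
noncomputable def regNorm (n : ℕ) (x : Space) : ℝ := √(‖x‖ ^ 2 + 1 / ((n : ℝ) + 1))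

theorem regNorm_pos (n : ℕ) (x : Space) : 0 < regNorm n x := by
  unfold regNorm; positivity

theorem norm_le_regNorm (n : ℕ) (x : Space) : ‖x‖ ≤ regNorm n x :=
  Real.le_sqrt_of_sq_le (by have : 0 < 1 / ((n : ℝ) + 1) := by positivity
                            linarith)

theorem regNorm_tendsto (x : Space) : Tendsto (fun n => regNorm n x) atTop (𝓝 ‖x‖) := by
  have h := (tendsto_one_div_add_atTop_nhds_zero_nat (𝕜 := ℝ)).const_add (‖x‖ ^ 2)
  have h2 := (Real.continuous_sqrt.tendsto _).comp h
  simpa [regNorm, Function.comp_def, Real.sqrt_sq] using h2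

theorem contDiff_regNorm (n : ℕ) : ContDiff ℝ 1 (regNorm n) :=
  ((contDiff_norm_sq ℝ).add contDiff_const).sqrt fun x => by positivity

theorem partialDeriv_regNorm (n : ℕ) (k : Fin 3) (x : Space) :
    fderiv ℝ (regNorm n) x (EuclideanSpace.single k 1) = x k / regNorm n x := by
  have h1 : HasFDerivAt (fun x : Space => ‖x‖ ^ 2 + 1 / ((n : ℝ) + 1))
      (2 • (innerSL ℝ x)) x := (hasStrictFDerivAt_norm_sq x).hasFDerivAt.add_const _
  have h2 := h1.sqrt (by positivity)
  rw [HasFDerivAt.fderiv (f := regNorm n) h2]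
  simp [regNorm, EuclideanSpace.inner_single_right]
  field_simp

theorem abs_yukawaProfile_anti {M a b : ℝ} (hM : 0 < M) (ha : 0 < a) (hab : a ≤ b) :
    |yukawaProfile M b| ≤ |yukawaProfile M a| := by
  have hb := ha.trans_le hab
  simp only [yukawaProfile]
  rw [abs_of_pos (by positivity), abs_of_pos (by positivity)]
  have : Real.exp (-M * b) ≤ Real.exp (-M * a) := Real.exp_le_exp.2 (by nlinarith)
  gcongr

theorem abs_yukawaProfileDeriv_anti {M a b : ℝ} (hM : 0 < M) (ha : 0 < a) (hab : a ≤ b) :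
    |yukawaProfileDeriv M b| ≤ |yukawaProfileDeriv M a| := by
  have hb := ha.trans_le hab
  have e : ∀ r : ℝ, 0 < r → |yukawaProfileDeriv M r|
      = (M / r + 1 / r ^ 2) * (Real.exp (-M * r) / (4 * Real.pi)) := by
    intro r hr
    rw [yukawaProfileDeriv, abs_neg, abs_of_pos (by positivity)]
    field_simp
  rw [e a ha, e b hb]
  have : Real.exp (-M * b) ≤ Real.exp (-M * a) := Real.exp_le_exp.2 (by nlinarith)
  gcongr

theorem contDiff_yukawaProfile (M : ℝ) {r : ℝ} (hr : r ≠ 0) : ContDiffAt ℝ 1 (yukawaProfile M) r := by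
  unfold yukawaProfile
  exact ContDiffAt.div (by fun_prop) (by fun_prop) (by positivity)

theorem ae_ne_zero : ∀ᵐ x : Space, x ≠ 0 := by
  simp [ae_iff]

/-- The kernel is the limit of its regularisations `yukawaProfile M (regNorm n x)`, which together
with their gradients are dominated because the profiles decrease. -/
theorem hasWeakPartial_yukawa {M : ℝ} (hM : 0 < M) (k : Fin 3) :
    HasWeakPartial k (yukawa M) (yukawaGrad M k) := by
  refine ⟨(integrable_yukawa hM).locallyIntegrable, (integrable_yukawaGrad hM k).locallyIntegrable,
    fun ζ hζ => ?_⟩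
  have hc : ∀ n, ContDiff ℝ 1 fun x => yukawaProfile M (regNorm n x) := fun n =>
    contDiff_iff_contDiffAt.2 fun x =>
      (contDiff_yukawaProfile M (regNorm_pos n x).ne').comp x (contDiff_regNorm n).contDiffAt
  have hpd : ∀ n x, pd k (fun x => yukawaProfile M (regNorm n x)) x
      = yukawaProfileDeriv M (regNorm n x) * (x k / regNorm n x) := by
    intro n x
    have h := (hasDerivAt_yukawaProfile M (regNorm_pos n x).ne').comp_hasFDerivAt x
      ((contDiff_regNorm n).differentiable one_ne_zero x).hasFDerivAt
    rw [pd, HasFDerivAt.fderiv (f := fun x => yukawaProfile M (regNorm n x)) h]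
    simp [partialDeriv_regNorm]
  have t1 : Tendsto (fun n => ∫ x, partialDeriv k ζ x • yukawaProfile M (regNorm n x)) atTop
      (𝓝 (∫ x, partialDeriv k ζ x • yukawa M x)) := by
    refine tendsto_integral_of_dominated_convergence (fun x => ‖partialDeriv k ζ x • yukawa M x‖)
      (fun n => ((hζ.partialDeriv k).1.continuous.smul (hc n).continuous).aestronglyMeasurable)
      ((hζ.partialDeriv k).integrable_smul (integrable_yukawa hM).locallyIntegrable).norm
      (fun n => ?_) ?_
    · filter_upwards [ae_ne_zero] with x hx
      rw [norm_smul, norm_smul]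
      exact mul_le_mul_of_nonneg_left
        (abs_yukawaProfile_anti hM (norm_pos_iff.2 hx) (norm_le_regNorm n x)) (norm_nonneg _)
    · filter_upwards [ae_ne_zero] with x hx
      exact (((hasDerivAt_yukawaProfile M (norm_ne_zero_iff.2 hx)).continuousAt.tendsto).comp
        (regNorm_tendsto x)).const_smul _
  have t2 : Tendsto (fun n => ∫ x, ζ x • (yukawaProfileDeriv M (regNorm n x) *
      (x k / regNorm n x))) atTop (𝓝 (∫ x, ζ x • yukawaGrad M k x)) := by
    refine tendsto_integral_of_dominated_convergence
      (fun x => ‖ζ x • yukawaProfileDeriv M ‖x‖‖) (fun n => ?_)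
      (hζ.integrable_smul (integrable_yukawaProfileDeriv hM).locallyIntegrable).norm
      (fun n => ?_) ?_
    · simp_rw [← hpd]
      exact (hζ.1.continuous.smul (continuous_pd (hc n) k)).aestronglyMeasurable
    · filter_upwards [ae_ne_zero] with x hx
      rw [norm_smul, norm_smul, norm_mul]
      refine mul_le_mul_of_nonneg_left ?_ (norm_nonneg _)
      refine (mul_le_of_le_one_right (norm_nonneg _) ?_).trans
        (abs_yukawaProfileDeriv_anti hM (norm_pos_iff.2 hx) (norm_le_regNorm n x))
      rw [Real.norm_eq_abs, abs_div, abs_of_pos (regNorm_pos n x)]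
      exact div_le_one_of_le₀ ((PiLp.norm_apply_le x k).trans (norm_le_regNorm n x))
        (regNorm_pos n x).le
    · filter_upwards [ae_ne_zero] with x hx
      have hx' := norm_ne_zero_iff.2 hx
      have hcd : ContinuousAt (yukawaProfileDeriv M) ‖x‖ := by
        unfold yukawaProfileDeriv
        exact (ContinuousAt.div (by fun_prop) (by fun_prop) (by positivity)).neg
      exact ((hcd.tendsto.comp (regNorm_tendsto x)).mul
        (tendsto_const_nhds.div (regNorm_tendsto x) hx')).const_smul _
  refine tendsto_nhds_unique t1 (t2.neg.congr fun n => ?_)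
  rw [integral_partialDeriv_smul hζ (hc n)]
  simp_rw [hpd]

/-- Integration in polar coordinates. -/
theorem integral_polar {h : Space → ℝ} (hh : Integrable h) :
    ∫ x, h x = ∫ ω : Metric.sphere (0 : Space) 1, ∫ r in Set.Ioi (0 : ℝ), r ^ 2 * h (r • (ω : Space))
      ∂volume ∂(volume : Measure Space).toSphere := by
  have mp := (volume : Measure Space).measurePreserving_homeomorphUnitSphereProd
  have me := (homeomorphUnitSphereProd Space).measurableEmbedding
  let h' : Metric.sphere (0 : Space) 1 × Set.Ioi (0 : ℝ) → ℝ := fun p => h ((p.2 : ℝ) • (p.1 : Space))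
  have e0 : ∀ x : ({(0)}ᶜ : Set Space), h' (homeomorphUnitSphereProd Space x) = h x := by
    intro x
    have hx : ‖(x : Space)‖ ≠ 0 := norm_ne_zero_iff.2 x.2
    simp [h', smul_smul, hx]
  have hi : Integrable h' ((volume : Measure Space).toSphere.prod
      (.volumeIoiPow (Module.finrank ℝ Space - 1))) := by
    rw [← mp.integrable_comp_emb me]
    simp only [Function.comp_def, e0]
    have : IntegrableOn h ({(0)}ᶜ : Set Space) := hh.integrableOn
    rwa [integrableOn_iff_comap_subtypeVal (by measurability)] at this
  calc ∫ x, h x = ∫ x : ({(0)}ᶜ : Set Space), h x ∂(volume.comap Subtype.val) := by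
        rw [integral_subtype_comap (measurableSet_singleton _).compl h,
          restrict_compl_singleton]
    _ = ∫ p, h' p ∂((volume : Measure Space).toSphere.prod
          (.volumeIoiPow (Module.finrank ℝ Space - 1))) := by
        rw [← mp.integral_comp me]
        simp_rw [e0]
    _ = _ := by
        rw [integral_prod _ hi]
        refine integral_congr_ae (Eventually.of_forall fun ω => ?_)
        simp only [Measure.volumeIoiPow, ENNReal.ofReal, h']
        rw [integral_withDensity_eq_integral_smul
          ((measurable_subtype_coe.pow_const _).real_toNNReal),
          integral_subtype_comap measurableSet_Ioi
            fun a => Real.toNNReal (a ^ (Module.finrank ℝ Space - 1)) • h (a • (ω : Space)),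
          setIntegral_congr_fun measurableSet_Ioi fun x hx => ?_]
        rw [NNReal.smul_def, Real.coe_toNNReal _ (pow_nonneg (le_of_lt hx) _)]
        simp

theorem toSphere_space_univ :
    (volume : Measure Space).toSphere.real Set.univ = 4 * Real.pi := by
  have h : (ENNReal.ofReal (Real.pi * 4 / 3)).toReal = Real.pi * 4 / 3 :=
    ENNReal.toReal_ofReal (by positivity)
  rw [Measure.toSphere_real_apply_univ, Measure.real, EuclideanSpace.volume_ball_fin_three,
    ENNReal.ofReal_one, one_pow, one_mul, h, finrank_euclideanSpace_fin]
  push_cast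
  ring

/-- The Yukawa kernel is the fundamental solution of `-Δ + M²`. In polar coordinates the integrand
is the radial derivative of `-(Mr + 1) e^{-Mr} ζ(rω) / 4π`. -/
theorem integral_yukawa_fundamental {M : ℝ} (hM : 0 < M) {ζ : Space → ℝ} (hζ : IsTest ζ) :
    (∑ k, ∫ x, partialDeriv k ζ x * yukawaGrad M k x) + M ^ 2 * ∫ x, ζ x * yukawa M x = ζ 0 := by
  have i1 : ∀ k, Integrable fun x => partialDeriv k ζ x * yukawaGrad M k x := fun k =>
    (hζ.partialDeriv k).integrable_smul (integrable_yukawaGrad hM k).locallyIntegrable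
  have i2 : Integrable fun x => ζ x * yukawa M x :=
    hζ.integrable_smul (integrable_yukawa hM).locallyIntegrable
  have hi : Integrable fun x => ∑ k, partialDeriv k ζ x * yukawaGrad M k x
      + M ^ 2 * (ζ x * yukawa M x) := (integrable_finsetSum _ fun k _ => i1 k).add (i2.const_mul _)
  rw [← integral_finsetSum _ fun k _ => i1 k, ← integral_const_mul,
    ← integral_add (integrable_finsetSum _ fun k _ => i1 k) (i2.const_mul _),
    integral_polar hi]
  let q : ℝ → ℝ := fun r => -((M * r + 1) * Real.exp (-M * r) / (4 * Real.pi))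
  have hq : ∀ r, HasDerivAt q (M ^ 2 * r * Real.exp (-M * r) / (4 * Real.pi)) r := by
    intro r
    have h1 : HasDerivAt (fun r : ℝ => Real.exp (-M * r)) (Real.exp (-M * r) * (-M * 1)) r :=
      ((hasDerivAt_id r).const_mul (-M)).exp
    have h2 : HasDerivAt (fun r : ℝ => M * r + 1) (M * 1) r :=
      ((hasDerivAt_id r).const_mul _).add_const _
    exact ((h2.mul h1).div_const (4 * Real.pi)).neg.congr_deriv (by ring)
  have hqc : ContDiff ℝ 1 q := by unfold q; fun_prop
  have key : ∀ ω : Metric.sphere (0 : Space) 1, ∫ r in Set.Ioi (0 : ℝ), r ^ 2 *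
      (∑ k, partialDeriv k ζ (r • (ω : Space)) * yukawaGrad M k (r • (ω : Space))
        + M ^ 2 * (ζ (r • (ω : Space)) * yukawa M (r • (ω : Space)))) = ζ 0 / (4 * Real.pi) := by
    intro ω
    have hω : ‖(ω : Space)‖ = 1 := by simp
    have hl : ContDiff ℝ 1 fun r : ℝ => r • (ω : Space) := contDiff_id.smul contDiff_const
    have hcd : ContDiff ℝ 1 fun r : ℝ => q r * ζ (r • (ω : Space)) :=
      hqc.mul (hζ.contDiff_one.comp hl)
    have hcs : HasCompactSupport fun r : ℝ => q r * ζ (r • (ω : Space)) := by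
      refine HasCompactSupport.mul_left ?_
      have hiso : Isometry fun r : ℝ => r • (ω : Space) := by
        refine Isometry.of_dist_eq fun a b => ?_
        rw [dist_eq_norm, ← sub_smul, norm_smul, hω, mul_one, dist_eq_norm]
      exact hζ.2.comp_isClosedEmbedding hiso.isClosedEmbedding
    have h0 := HasCompactSupport.integral_Ioi_deriv_eq hcd hcs 0
    rw [show ζ 0 / (4 * Real.pi) = - (q 0 * ζ ((0 : ℝ) • (ω : Space))) by
      simp [q]; ring, ← h0]
    refine setIntegral_congr_fun measurableSet_Ioi fun r hr => ?_
    have hr0 : 0 < r := hr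
    have hζd := ((hζ.contDiff_one.differentiable one_ne_zero (r • (ω : Space))).hasFDerivAt
      ).comp_hasDerivAt r ((hasDerivAt_id r).smul_const (ω : Space))
    have hd := (hq r).mul hζd
    rw [HasDerivAt.deriv (f := fun r : ℝ => q r * ζ (r • (ω : Space))) hd]
    simp only [id, one_smul, clm_apply_eq_sum _ (ω : Space), smul_eq_mul, yukawaGrad, yukawa,
      norm_smul, hω, Real.norm_of_nonneg hr0.le, mul_one, PiLp.smul_apply, yukawaProfile,
      yukawaProfileDeriv, q, Function.comp_def, partialDeriv, Fin.sum_univ_three]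
    field_simp
    ring
  simp only [key, integral_const, toSphere_space_univ, smul_eq_mul]
  field_simp

/-! ### The Yukawa potential of an integrable and square-integrable source -/

/-- The potential `K ⋆ f` of a source `f`, where `K` is a scalar kernel. -/
noncomputable def potential (K f : Space → ℝ) : Space → ℝ := K ⋆[lsmul ℝ ℝ, volume] f

theorem potential_apply (K f : Space → ℝ) (x : Space) :
    potential K f x = ∫ t, K (x - t) * f t := by
  rw [potential, convolution_lsmul_swap]; rfl

/-- Testing a potential amounts to testing the translates of its kernel (Fubini). -/
theorem integral_mul_potential {K f ζ : Space → ℝ} (hK : Integrable K) (hf : Integrable f)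
    (hζ : IsTest ζ) :
    ∫ x, ζ x * potential K f x = ∫ t, (∫ x, ζ (x + t) * K x) * f t := by
  obtain ⟨C, hC⟩ := hζ.bounded
  have hi : Integrable (fun p : Space × Space => ζ p.1 * (K (p.1 - p.2) * f p.2))
      (volume.prod volume) := by
    have h := Integrable.convolution_integrand (mul ℝ ℝ).flip hf hK (μ := volume) (ν := volume)
    exact h.bdd_mul (c := C) (hζ.1.continuous.comp continuous_fst).aestronglyMeasurable
      (Eventually.of_forall fun p => hC p.1)
  simp_rw [potential_apply, ← integral_const_mul]
  rw [integral_integral_swap hi]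
  refine integral_congr_ae (Eventually.of_forall fun t => ?_)
  simp only
  rw [← integral_mul_const, ← integral_add_right_eq_self _ t]
  simp [mul_assoc]

theorem IsTest.translate {ζ : Space → ℝ} (hζ : IsTest ζ) (t : Space) :
    IsTest fun x => ζ (x + t) :=
  ⟨hζ.1.comp (contDiff_id.add contDiff_const), hζ.2.comp_homeomorph (Homeomorph.addRight t)⟩

theorem partialDeriv_translate (ζ : Space → ℝ) (t x : Space) (k : Fin 3) :
    partialDeriv k (fun x => ζ (x + t)) x = partialDeriv k ζ (x + t) := by
  simp only [partialDeriv, fderiv_comp_add_right]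

theorem hasWeakPartial_potential {K K' f : Space → ℝ} {k : Fin 3} (hK : Integrable K)
    (hK' : Integrable K') (h : HasWeakPartial k K K') (hf : Integrable f) :
    HasWeakPartial k (potential K f) (potential K' f) := by
  refine ⟨(hK.integrable_convolution _ hf).locallyIntegrable,
    (hK'.integrable_convolution _ hf).locallyIntegrable, fun ζ hζ => ?_⟩
  simp only [smul_eq_mul]
  rw [integral_mul_potential hK hf (hζ.partialDeriv k), integral_mul_potential hK' hf hζ,
    ← integral_neg]
  refine integral_congr_ae (Eventually.of_forall fun t => ?_)
  have := h.2.2 _ (hζ.translate t)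
  simp only [partialDeriv_translate, smul_eq_mul] at this
  simp only [this, neg_mul]

/-- The weak form of the stationary Klein–Gordon equation `(-Δ + M²) χ = f`, where `χ'` is the
gradient of `χ`. -/
def WeakKleinGordon (M : ℝ) (χ : Space → ℝ) (χ' : Fin 3 → Space → ℝ) (f : Space → ℝ) : Prop :=
  ∀ ζ, IsTest ζ →
    (∑ k, ∫ x, partialDeriv k ζ x * χ' k x) + M ^ 2 * ∫ x, ζ x * χ x = ∫ x, ζ x * f x

/-- Superposition of the fundamental solutions centred at the points of the source. -/
theorem weakKleinGordon_yukawa {M : ℝ} (hM : 0 < M) {f : Space → ℝ} (hf : Integrable f) :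
    WeakKleinGordon M (potential (yukawa M) f) (fun k => potential (yukawaGrad M k) f) f := by
  intro ζ hζ
  have bd : ∀ {ξ K : Space → ℝ}, IsTest ξ → Integrable K →
      Integrable fun t => (∫ x, ξ (x + t) * K x) * f t := by
    intro ξ K hξ hK
    obtain ⟨C, hC⟩ := hξ.bounded
    have hm : AEStronglyMeasurable (fun p : Space × Space => ξ (p.2 + p.1) * K p.2)
        (volume.prod volume) :=
      (hξ.1.continuous.comp (continuous_snd.add continuous_fst)).aestronglyMeasurable.mul
        hK.1.comp_snd
    refine hf.bdd_mul (c := ∫ x, C * ‖K x‖) hm.integral_prod_right' (Eventually.of_forall fun t => ?_)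
    refine norm_integral_le_of_norm_le (hK.norm.const_mul C) (Eventually.of_forall fun x => ?_)
    rw [norm_mul]
    exact mul_le_mul_of_nonneg_right (hC _) (norm_nonneg _)
  simp_rw [fun k => integral_mul_potential (integrable_yukawaGrad hM k) hf (hζ.partialDeriv k)]
  rw [integral_mul_potential (integrable_yukawa hM) hf hζ, ← integral_finsetSum _ fun k _ =>
    bd (hζ.partialDeriv k) (integrable_yukawaGrad hM k), ← integral_const_mul,
    ← integral_add (integrable_finsetSum _ fun k _ => bd (hζ.partialDeriv k)
      (integrable_yukawaGrad hM k)) ((bd hζ (integrable_yukawa hM)).const_mul _)]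
  refine integral_congr_ae (Eventually.of_forall fun t => ?_)
  have h := integral_yukawa_fundamental hM (hζ.translate t)
  simp only [partialDeriv_translate, zero_add] at h
  simp only [← h, add_mul, Finset.sum_mul, mul_assoc]

theorem hasL2Gradient_yukawa {M : ℝ} (hM : 0 < M) {f : Space → ℝ} (hf : Integrable f)
    (hf2 : MemLp f 2) :
    HasL2Gradient (potential (yukawa M) f) (fun k => potential (yukawaGrad M k) f) :=
  ⟨memLp_convolution (integrable_yukawa hM) hf2, fun k =>
    ⟨hasWeakPartial_potential (integrable_yukawa hM) (integrable_yukawaGrad hM k)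
      (hasWeakPartial_yukawa hM k) hf, memLp_convolution (integrable_yukawaGrad hM k) hf2⟩⟩

/-- The Yukawa kernel is square integrable in three dimensions, so that the potential of a
square-integrable source is bounded. -/
theorem potential_yukawa_bounded {M : ℝ} (hM : 0 < M) {f : Space → ℝ} (hf2 : MemLp f 2) :
    ∃ C, ∀ x, ‖potential (yukawa M) f x‖ ≤ C := by
  refine ⟨(∫ t, yukawa M t ^ 2) + ∫ t, f t ^ 2, fun x => ?_⟩
  have i1 : Integrable fun t => yukawa M (x - t) ^ 2 := (integrable_yukawa_sq hM).comp_sub_left x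
  have i2 : Integrable fun t => f t ^ 2 := hf2.integrable_sq
  rw [potential_apply, ← integral_sub_left_eq_self (fun t => yukawa M t ^ 2) volume x,
    ← integral_add i1 i2]
  refine norm_integral_le_of_norm_le (i1.add i2) (Eventually.of_forall fun t => ?_)
  rw [Real.norm_eq_abs, abs_mul]
  nlinarith [sq_nonneg (|yukawa M (x - t)| - |f t|), sq_abs (yukawa M (x - t)), sq_abs (f t),
    abs_nonneg (yukawa M (x - t)), abs_nonneg (f t),
    mul_nonneg (abs_nonneg (yukawa M (x - t))) (abs_nonneg (f t))]

/-! ### The virial identity of the Klein–Gordon field -/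

/-- A mollified weak solution of the Klein–Gordon equation is a classical solution with the
mollified source. -/
theorem WeakKleinGordon.moll {M : ℝ} {χ : Space → ℝ} {χ' : Fin 3 → Space → ℝ} {f : Space → ℝ}
    (h : WeakKleinGordon M χ χ' f) (hχ : HasL2Gradient χ χ') (n : ℕ) (x : Space) :
    KGD.moll n f x = M ^ 2 * KGD.moll n χ x - ∑ k, pd k (KGD.moll n (χ' k)) x := by
  have h1 := h _ (isTest_mollKernel n x)
  simp_rw [fun k => pd_moll_apply n k (locallyIntegrable_of_memLp_two (hχ.2 k).2) x, moll_apply,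
    smul_eq_mul, Finset.sum_neg_distrib]
  rw [← h1]
  ring

/-- The virial identity for smooth functions: `∂_j u (M² u - Δu)` is a divergence. -/
theorem integral_mul_kleinGordon {u : Space → ℝ} (hu : ContDiff ℝ ((⊤ : ℕ∞) : WithTop ℕ∞) u)
    (M : ℝ) (j : Fin 3) {ζ : Space → ℝ} (hζ : IsTest ζ) :
    ∫ x, ζ x * (pd j u x * (M ^ 2 * u x - ∑ k, pd k (pd k u) x))
      = (∑ k, ∫ x, partialDeriv k ζ x * (pd j u x * pd k u x))
        - (1 / 2) * (∑ k, ∫ x, partialDeriv j ζ x * (pd k u x * pd k u x))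
        - (1 / 2) * M ^ 2 * ∫ x, partialDeriv j ζ x * (u x * u x) := by
  have one_le : (1 : WithTop ℕ∞) ≤ ((⊤ : ℕ∞) : WithTop ℕ∞) := by exact_mod_cast le_top
  have c1 := fun k => contDiff_pd hu k
  have c2 := fun k l => contDiff_pd (c1 k) l
  have hmul : ∀ {a b : Space → ℝ}, ContDiff ℝ 1 a → ContDiff ℝ 1 b → ∀ k x,
      pd k (fun x => a x * b x) x = pd k a x * b x + a x * pd k b x := fun ha hb k x =>
    pd_bilin (mul ℝ ℝ) ha hb k x
  have u1 := hu.of_le one_le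
  have d1 := fun k => (c1 k).of_le one_le
  have I : ∀ {a b : Space → ℝ}, Continuous a → Continuous b →
      Integrable fun x => ζ x * (a x * b x) := fun ha hb =>
    hζ.integrable_smul (ha.mul hb).locallyIntegrable
  have A : ∫ x, partialDeriv j ζ x * (u x * u x) = -(2 * ∫ x, ζ x * (pd j u x * u x)) := by
    have := integral_partialDeriv_smul hζ (u1.mul u1) j
    simp only [smul_eq_mul] at this
    rw [this, ← integral_const_mul]
    congr 2; ext x
    rw [hmul u1 u1]; ring
  have B : ∀ k, ∫ x, partialDeriv j ζ x * (pd k u x * pd k u x)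
      = -(2 * ∫ x, ζ x * (pd j (pd k u) x * pd k u x)) := by
    intro k
    have := integral_partialDeriv_smul hζ ((d1 k).mul (d1 k)) j
    simp only [smul_eq_mul] at this
    rw [this, ← integral_const_mul]
    congr 2; ext x
    rw [hmul (d1 k) (d1 k)]; ring
  have C : ∀ k, ∫ x, partialDeriv k ζ x * (pd j u x * pd k u x)
      = -((∫ x, ζ x * (pd j (pd k u) x * pd k u x)) + ∫ x, ζ x * (pd j u x * pd k (pd k u) x)) := by
    intro k
    have := integral_partialDeriv_smul hζ ((d1 j).mul (d1 k)) k
    simp only [smul_eq_mul] at this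
    rw [this, ← integral_add (I (c2 k j).continuous (c1 k).continuous)
      (I (c1 j).continuous (c2 k k).continuous)]
    congr 2; ext x
    rw [hmul (d1 j) (d1 k), pd_comm hu k j]; ring
  have L : ∫ x, ζ x * (pd j u x * (M ^ 2 * u x - ∑ k, pd k (pd k u) x))
      = M ^ 2 * (∫ x, ζ x * (pd j u x * u x)) - ∑ k, ∫ x, ζ x * (pd j u x * pd k (pd k u) x) := by
    rw [← integral_const_mul, ← integral_finsetSum _ fun k _ =>
      I (c1 j).continuous (c2 k k).continuous, ← integral_sub
      ((I (c1 j).continuous hu.continuous).const_mul _)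
      (integrable_finsetSum _ fun k _ => I (c1 j).continuous (c2 k k).continuous)]
    congr 1; ext x
    rw [← Finset.mul_sum, ← Finset.mul_sum]; ring
  rw [L, A]
  simp only [B, C, Finset.sum_neg_distrib, Finset.sum_add_distrib, ← Finset.mul_sum]
  ring

/-- The virial identity in `H¹`, obtained by mollification. -/
theorem WeakKleinGordon.virial {M : ℝ} {χ : Space → ℝ} {χ' : Fin 3 → Space → ℝ} {f : Space → ℝ}
    (h : WeakKleinGordon M χ χ' f) (hχ : HasL2Gradient χ χ') (hf : MemLp f 2) (j : Fin 3)
    {ζ : Space → ℝ} (hζ : IsTest ζ) :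
    ∫ x, ζ x * (χ' j x * f x)
      = (∑ k, ∫ x, partialDeriv k ζ x * (χ' j x * χ' k x))
        - (1 / 2) * (∑ k, ∫ x, partialDeriv j ζ x * (χ' k x * χ' k x))
        - (1 / 2) * M ^ 2 * ∫ x, partialDeriv j ζ x * (χ x * χ x) := by
  have t : ∀ {ξ u w : Space → ℝ}, IsTest ξ → MemLp u 2 → MemLp w 2 →
      Tendsto (fun n => ∫ x, ξ x * (KGD.moll n u x * KGD.moll n w x)) atTop
        (𝓝 (∫ x, ξ x * (u x * w x))) := fun hξ hu hw =>
    tendsto_integral_test_smul hξ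
      (fun n => integrable_bilin (mul ℝ ℝ) (memLp_moll n hu) (memLp_moll n hw))
      (integrable_bilin (mul ℝ ℝ) hu hw) (tendsto_moll_bilin_L1 (mul ℝ ℝ) hu hw)
  refine tendsto_nhds_unique (t hζ (hχ.2 j).2 hf) ((((tendsto_finsetSum _ fun k _ =>
    t (hζ.partialDeriv k) (hχ.2 j).2 (hχ.2 k).2).sub ((tendsto_finsetSum _ fun k _ =>
    t (hζ.partialDeriv j) (hχ.2 k).2 (hχ.2 k).2).const_mul (1 / 2))).sub
    ((t (hζ.partialDeriv j) hχ.1 hχ.1).const_mul (1 / 2 * M ^ 2))).congr fun n => ?_)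
  have hn := integral_mul_kleinGordon (moll_contDiff n (locallyIntegrable_of_memLp_two hχ.1)) M j hζ
  simp only [h.moll hχ n, fun k => pd_moll n k (hχ.2 k).1] at hn ⊢
  exact hn.symm

/-! ### Affine changes of variables -/

theorem integral_comp_affine [CompleteSpace F] (A : Space ≃L[ℝ] Space) (c : Space)
    (h : Space → F) :
    ∫ x, h (A x + c) = |(LinearMap.det (A : Space →ₗ[ℝ] Space))⁻¹| • ∫ y, h y := by
  have hd : LinearMap.det (A : Space →ₗ[ℝ] Space) ≠ 0 :=
    (LinearEquiv.isUnit_det' A.toLinearEquiv).ne_zero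
  have hm := Measure.map_linearMap_addHaar_eq_smul_addHaar (volume : Measure Space) hd
  have e : ∫ x, h (A x + c) = ∫ y, h (y + c) ∂(Measure.map A volume) :=
    (A.toHomeomorph.measurableEmbedding.integral_map (fun y => h (y + c))).symm
  have hm' : Measure.map A volume
      = ENNReal.ofReal |(LinearMap.det (A : Space →ₗ[ℝ] Space))⁻¹| • (volume : Measure Space) := hm
  rw [e, hm', integral_smul_measure, ENNReal.toReal_ofReal (abs_nonneg _),
    integral_add_right_eq_self]

theorem map_affine (A : Space ≃L[ℝ] Space) (c : Space) :
    Measure.map (fun x => A x + c) (volume : Measure Space)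
      = ENNReal.ofReal |(LinearMap.det (A : Space →ₗ[ℝ] Space))⁻¹| • (volume : Measure Space) := by
  have hd : LinearMap.det (A : Space →ₗ[ℝ] Space) ≠ 0 :=
    (LinearEquiv.isUnit_det' A.toLinearEquiv).ne_zero
  have hm := Measure.map_linearMap_addHaar_eq_smul_addHaar (volume : Measure Space) hd
  have hm' : Measure.map A volume
      = ENNReal.ofReal |(LinearMap.det (A : Space →ₗ[ℝ] Space))⁻¹| • (volume : Measure Space) := hm
  have e : (fun x => A x + c) = (fun y => y + c) ∘ A := rfl
  rw [e, ← Measure.map_map (measurable_add_const c) A.continuous.measurable, hm',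
    Measure.map_smul, map_add_right_eq_self]

theorem memLp_comp_affine (A : Space ≃L[ℝ] Space) (c : Space) {h : Space → F} {p : ℝ≥0∞}
    (hh : MemLp h p) : MemLp (fun x => h (A x + c)) p := by
  have : MemLp h p (Measure.map (fun x => A x + c) volume) := by
    rw [map_affine]
    exact hh.smul_measure ENNReal.ofReal_ne_top
  exact this.comp_of_map (A.continuous.add continuous_const).aemeasurable

theorem integrable_comp_affine (A : Space ≃L[ℝ] Space) (c : Space) {h : Space → F}
    (hh : Integrable h) : Integrable fun x => h (A x + c) := by
  rw [← memLp_one_iff_integrable] at hh ⊢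
  exact memLp_comp_affine A c hh

theorem locallyIntegrable_comp_affine (A : Space ≃L[ℝ] Space) (c : Space) {h : Space → F}
    (hh : LocallyIntegrable h) : LocallyIntegrable fun x => h (A x + c) := by
  let Φ : Space ≃ₜ Space := A.toHomeomorph.trans (Homeomorph.addRight c)
  rw [locallyIntegrable_iff]
  intro K hK
  have h1 := hh.integrableOn_isCompact (hK.image Φ.continuous)
  have h2 : Integrable (Set.indicator (Φ '' K) h) :=
    (integrable_indicator_iff (hK.image Φ.continuous).measurableSet).2 h1
  have h3 := integrable_comp_affine A c h2
  rw [← integrable_indicator_iff hK.measurableSet]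
  refine h3.congr (Eventually.of_forall fun x => ?_)
  have hx : A x + c ∈ Φ '' K ↔ x ∈ K :=
    ⟨fun ⟨y, hy, e⟩ => Φ.injective e ▸ hy, fun hx => ⟨x, hx, rfl⟩⟩
  by_cases hxK : x ∈ K
  · simp [Set.indicator, hxK, hx]
  · simp [Set.indicator, hxK, hx]

/-- Chain rule for an affine change of variables. -/
theorem HasWeakPartial.comp_affine [CompleteSpace F] (A : Space ≃L[ℝ] Space) (c : Space)
    {f : Space → F} {f' : Fin 3 → Space → F} (h : ∀ k, HasWeakPartial k f (f' k)) (j : Fin 3) :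
    HasWeakPartial j (fun x => f (A x + c))
      (fun x => ∑ l, A (EuclideanSpace.single j 1) l • f' l (A x + c)) := by
  have li : ∀ l, LocallyIntegrable (fun x => A (EuclideanSpace.single j 1) l • f' l (A x + c)) :=
    fun l => (locallyIntegrable_comp_affine A c (h l).2.1).smul _
  refine ⟨locallyIntegrable_comp_affine A c (h 0).1,
    locallyIntegrable_finsetSum _ fun l _ => li l, fun ζ hζ => ?_⟩
  -- the test function in the new variable `y = A x + c`
  let ξ : Space → ℝ := fun y => ζ (A.symm (y - c))
  have hξ : IsTest ξ :=
    ⟨hζ.1.comp (A.symm.contDiff.comp (contDiff_id.sub contDiff_const)),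
      hζ.2.comp_homeomorph ((Homeomorph.subRight c).trans A.symm.toHomeomorph)⟩
  have hξx : ∀ x, ξ (A x + c) = ζ x := fun x => by simp [ξ]
  have hd : ∀ x, partialDeriv j ζ x
      = ∑ l, A (EuclideanSpace.single j 1) l * partialDeriv l ξ (A x + c) := by
    intro x
    have e : ζ = fun x => ξ (A x + c) := funext fun x => (hξx x).symm
    have h1 := ((hξ.contDiff_one.differentiable one_ne_zero (A x + c)).hasFDerivAt).comp x
      (A.hasFDerivAt.add_const c)
    conv_lhs => rw [e, partialDeriv, HasFDerivAt.fderiv (f := fun x => ξ (A x + c)) h1]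
    simp only [partialDeriv, comp_apply, ContinuousLinearEquiv.coe_coe]
    rw [clm_apply_eq_sum _ (A (EuclideanSpace.single j 1))]
    simp
  have i1 : ∀ l, Integrable fun y => A (EuclideanSpace.single j 1) l • partialDeriv l ξ y • f y :=
    fun l => ((hξ.partialDeriv l).integrable_smul (h 0).1).smul _
  have i2 : ∀ l, Integrable fun y => A (EuclideanSpace.single j 1) l • ξ y • f' l y :=
    fun l => (hξ.integrable_smul (h l).2.1).smul _
  calc ∫ x, partialDeriv j ζ x • f (A x + c)
      = ∫ x, (fun y => ∑ l, A (EuclideanSpace.single j 1) l • partialDeriv l ξ y • f y) (A x + c) := by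
        refine integral_congr_ae (Eventually.of_forall fun x => ?_)
        simp only [hd, Finset.sum_smul, mul_smul]
    _ = - ∫ x, (fun y => ∑ l, A (EuclideanSpace.single j 1) l • ξ y • f' l y) (A x + c) := by
        rw [integral_comp_affine A c
          (fun y => ∑ l, A (EuclideanSpace.single j 1) l • partialDeriv l ξ y • f y),
          integral_comp_affine A c
          (fun y => ∑ l, A (EuclideanSpace.single j 1) l • ξ y • f' l y), ← smul_neg,
          integral_finsetSum _ fun l _ => i1 l,
          integral_finsetSum _ fun l _ => i2 l,
          ← Finset.sum_neg_distrib]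
        congr 1
        refine Finset.sum_congr rfl fun l _ => ?_
        rw [integral_smul, integral_smul, (h l).2.2 ξ hξ, smul_neg]
    _ = _ := by
        congr 1
        refine integral_congr_ae (Eventually.of_forall fun x => ?_)
        simp only [hξx, Finset.smul_sum]
        exact Finset.sum_congr rfl fun l _ => smul_comm _ _ _

theorem HasL2Gradient.comp_affine [CompleteSpace F] (A : Space ≃L[ℝ] Space) (c : Space)
    {f : Space → F} {f' : Fin 3 → Space → F} (h : HasL2Gradient f f') :
    HasL2Gradient (fun x => f (A x + c))
      (fun j x => ∑ l, A (EuclideanSpace.single j 1) l • f' l (A x + c)) :=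
  ⟨memLp_comp_affine A c h.1, fun j =>
    ⟨HasWeakPartial.comp_affine A c (fun k => (h.2 k).1) j,
      memLp_finsetSum _ fun l _ => (memLp_comp_affine A c (h.2 l).2).const_smul _⟩⟩

/-! ### Products and compositions beyond `L² × L²` -/

/-- Leibniz rule for the product of a bounded `H¹` function with a function in `L¹ ∩ L²` whose
derivative is merely integrable. -/
theorem HasL2Gradient.integral_mul_of_bounded {χ : Space → ℝ} {χ' : Fin 3 → Space → ℝ}
    (hχ : HasL2Gradient χ χ') {C : ℝ} (hC : ∀ x, ‖χ x‖ ≤ C) {j : Fin 3} {F F' : Space → ℝ}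
    (h : HasWeakPartial j F F') (hF : Integrable F) (hF2 : MemLp F 2) (hF' : Integrable F')
    {ζ : Space → ℝ} (hζ : IsTest ζ) :
    ∫ x, ζ x * (χ x * F' x)
      = - (∫ x, partialDeriv j ζ x * (χ x * F x)) - ∫ x, ζ x * (χ' j x * F x) := by
  have hloc := locallyIntegrable_of_memLp_two hχ.1
  have lim : ∀ {ξ u : Space → ℝ}, IsTest ξ → Integrable u →
      Tendsto (fun n => ∫ x, ξ x * (moll n χ x * u x)) atTop (𝓝 (∫ x, ξ x * (χ x * u x))) := by
    intro ξ u hξ hu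
    obtain ⟨D, hD⟩ := hξ.bounded
    have := tendsto_integral_smul (un := fun _ => u) (u := u) (cn := fun n x => ξ x * moll n χ x)
      (c := fun x => ξ x * χ x) (C := D * C) (fun _ => hu) hu (by simp)
      (fun n => (hξ.1.continuous.mul (KGD.moll_contDiff n hloc).continuous).aestronglyMeasurable)
      (fun n => Eventually.of_forall fun x => by
        rw [norm_mul]
        exact mul_le_mul (hD x) (norm_moll_le n hC x) (norm_nonneg _)
          ((norm_nonneg _).trans (hD x)))
      (by filter_upwards [moll_ae_tendsto hloc] with x hx using hx.const_mul _)
    simpa only [smul_eq_mul, mul_assoc] using this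
  have lim2 : Tendsto (fun n => ∫ x, ζ x * (moll n (χ' j) x * F x)) atTop
      (𝓝 (∫ x, ζ x * (χ' j x * F x))) :=
    tendsto_integral_test_smul hζ
      (fun n => integrable_bilin (mul ℝ ℝ) (memLp_moll n (hχ.2 j).2) hF2)
      (integrable_bilin (mul ℝ ℝ) (hχ.2 j).2 hF2)
      (tendsto_bilin_L1 (mul ℝ ℝ) (fun n => memLp_moll n (hχ.2 j).2) (fun _ => hF2)
        (hχ.2 j).2 hF2 (moll_tendsto (hχ.2 j).2) (by simp))
  refine tendsto_nhds_unique (lim hζ hF') (((lim (hζ.partialDeriv j) hF).neg.sub lim2).congr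
    fun n => ?_)
  -- test the derivative of `F` with `ζ χₙ`, where `χₙ` is the mollification of `χ`
  have hsm := KGD.moll_contDiff n hloc
  have h1 := h.2.2 _ (hζ.mul_smooth hsm)
  have e : ∀ x, partialDeriv j (fun x => ζ x * moll n χ x) x
      = partialDeriv j ζ x * moll n χ x + ζ x * moll n (χ' j) x := by
    intro x
    rw [partialDeriv_mul (hζ.contDiff_one.differentiable one_ne_zero x)
      (hsm.differentiable (by simp) x), ← pd_moll n j (hχ.2 j).1]
    rfl
  have i1 : Integrable fun x => partialDeriv j ζ x * (moll n χ x * F x) := by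
    have := ((hζ.partialDeriv j).mul_smooth hsm).integrable_smul hF.locallyIntegrable
    simpa only [smul_eq_mul, mul_assoc] using this
  have i2 : Integrable fun x => ζ x * (moll n (χ' j) x * F x) :=
    hζ.integrable_smul
      (integrable_bilin (mul ℝ ℝ) (memLp_moll n (hχ.2 j).2) hF2).locallyIntegrable
  simp only [e, smul_eq_mul, add_mul, mul_assoc] at h1
  rw [integral_add i1 i2] at h1
  linarith

/-- A continuous cut-off in the range of a real function. -/
noncomputable def rangeCutoff (n : ℕ) (r : ℝ) : ℝ := max 0 (min 1 (n + 1 - |r|))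

theorem rangeCutoff_nonneg (n : ℕ) (r : ℝ) : 0 ≤ rangeCutoff n r := le_max_left _ _

theorem rangeCutoff_le_one (n : ℕ) (r : ℝ) : rangeCutoff n r ≤ 1 :=
  max_le zero_le_one (min_le_left _ _)

theorem rangeCutoff_eq_one {n : ℕ} {r : ℝ} (h : |r| ≤ n) : rangeCutoff n r = 1 := by
  rw [rangeCutoff, min_eq_left (by linarith), max_eq_right zero_le_one]

theorem continuous_rangeCutoff (n : ℕ) : Continuous (rangeCutoff n) := by
  unfold rangeCutoff; fun_prop

theorem hasCompactSupport_rangeCutoff (n : ℕ) : HasCompactSupport (rangeCutoff n) := by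
  refine HasCompactSupport.of_support_subset_isCompact
    (isCompact_Icc (a := -((n : ℝ) + 1)) (b := n + 1)) fun r hr => ?_
  rw [Set.mem_Icc, ← abs_le]
  by_contra hcon
  refine hr ?_
  rw [rangeCutoff, max_eq_left]
  exact (min_le_right _ _).trans (by linarith [not_le.1 hcon])

/-- Chain rule for `G(B(f, f))` when `G'` is unbounded. The monotonicity expressed by
`0 ≤ G(s) ≤ G'(s) s` makes `G` a majorant of the primitives of the truncations of `G'`. -/
theorem HasL2Gradient.chain_rule_of_integrable {F : Type} [NormedAddCommGroup F] [NormedSpace ℝ F]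
    [CompleteSpace F] (B : F →L[ℝ] F →L[ℝ] ℝ) {f : Space → F} {f' : Fin 3 → Space → F}
    (hf : HasL2Gradient f f') {G : ℝ → ℝ} (hG : ContDiff ℝ 1 G) (h0 : G 0 = 0)
    (hnn : ∀ s, 0 ≤ G s) (hle : ∀ s, G s ≤ deriv G s * s) (j : Fin 3)
    (hGi : Integrable fun x => G (B (f x) (f x)))
    (hgi : Integrable fun x => deriv G (B (f x) (f x)) * (B (f' j x) (f x) + B (f x) (f' j x)))
    {ζ : Space → ℝ} (hζ : IsTest ζ) :
    ∫ x, partialDeriv j ζ x * G (B (f x) (f x))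
      = - ∫ x, ζ x * (deriv G (B (f x) (f x)) * (B (f' j x) (f x) + B (f x) (f' j x))) := by
  have hgc : Continuous (deriv G) := hG.continuous_deriv le_rfl
  have hgp : ∀ r, 0 ≤ r → 0 ≤ deriv G r := by
    intro r hr
    rcases hr.eq_or_lt with rfl | hr
    · -- `0` is a minimum of `G`
      have : IsLocalMin G 0 := Eventually.of_forall fun x => by rw [h0]; exact hnn x
      exact this.deriv_eq_zero.ge
    · exact nonneg_of_mul_nonneg_left ((hnn r).trans (hle r)) hr
  have hgn : ∀ r, r ≤ 0 → deriv G r ≤ 0 := by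
    intro r hr
    rcases hr.eq_or_lt with rfl | hr
    · have : IsLocalMin G 0 := Eventually.of_forall fun x => by rw [h0]; exact hnn x
      exact this.deriv_eq_zero.le
    · nlinarith [hnn r, hle r]
  -- `Γ n` is the primitive of the truncation `g n` of `G'`; as `G' r` has the sign of `r`, it is
  -- dominated by `G`
  let g : ℕ → ℝ → ℝ := fun n r => rangeCutoff n r * deriv G r
  have hgnc : ∀ n, Continuous (g n) := fun n => (continuous_rangeCutoff n).mul hgc
  let Γ : ℕ → ℝ → ℝ := fun n s => ∫ r in (0 : ℝ)..s, g n r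
  have hΓd : ∀ n s, HasDerivAt (Γ n) (g n s) s := fun n s =>
    ((hgnc n).integral_hasStrictDerivAt 0 s).hasDerivAt
  have hΓderiv : ∀ n, deriv (Γ n) = g n := fun n => funext fun s => (hΓd n s).deriv
  have hΓc : ∀ n, ContDiff ℝ 1 (Γ n) := fun n => by
    rw [contDiff_one_iff_deriv, hΓderiv]
    exact ⟨fun s => (hΓd n s).differentiableAt, hgnc n⟩
  have hGint : ∀ s, G s = ∫ r in (0 : ℝ)..s, deriv G r := by
    intro s
    rw [intervalIntegral.integral_deriv_eq_sub (fun x _ => hG.differentiable one_ne_zero x)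
      (hgc.intervalIntegrable _ _), h0, sub_zero]
  have hΓbound : ∀ n s, ‖Γ n s‖ ≤ ‖G s‖ := by
    intro n s
    rw [Real.norm_of_nonneg (hnn s), hGint s]
    have hi1 : ∀ a b, IntervalIntegrable (g n) volume a b := (hgnc n).intervalIntegrable
    have hi2 : ∀ a b, IntervalIntegrable (deriv G) volume a b := hgc.intervalIntegrable
    rcases le_total 0 s with hs | hs
    · rw [Real.norm_of_nonneg (intervalIntegral.integral_nonneg hs fun r hr =>
        mul_nonneg (rangeCutoff_nonneg n r) (hgp r hr.1))]
      exact intervalIntegral.integral_mono_on hs (hi1 _ _) (hi2 _ _) fun r hr =>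
        mul_le_of_le_one_left (hgp r hr.1) (rangeCutoff_le_one n r)
    · have e : Γ n s = ∫ r in s..0, - g n r := by
        rw [intervalIntegral.integral_neg]; exact intervalIntegral.integral_symm _ _
      have hpos : ∀ r ∈ Set.Icc s 0, 0 ≤ - g n r := fun r hr => neg_nonneg.2
        (mul_nonpos_of_nonneg_of_nonpos (rangeCutoff_nonneg n r) (hgn r hr.2))
      rw [e, Real.norm_of_nonneg (intervalIntegral.integral_nonneg hs hpos),
        intervalIntegral.integral_symm s 0, ← intervalIntegral.integral_neg]
      refine intervalIntegral.integral_mono_on hs (hi1 _ _).neg (hi2 _ _).neg fun r hr => ?_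
      have h1 := hgn r hr.2
      have h2 := rangeCutoff_le_one n r
      simp only [g]
      nlinarith
  have hΓlim : ∀ s, Tendsto (fun n => Γ n s) atTop (𝓝 (G s)) := by
    intro s
    refine tendsto_const_nhds.congr' ?_
    filter_upwards [eventually_ge_atTop ⌈|s|⌉₊] with n hn
    rw [hGint s]
    refine intervalIntegral.integral_congr fun r hr => ?_
    have : |r| ≤ n := by
      have h1 : |r| ≤ |s| := by
        rcases le_total 0 s with hs | hs
        · rw [Set.uIcc_of_le hs] at hr
          rw [abs_of_nonneg hr.1, abs_of_nonneg hs]; exact hr.2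
        · rw [Set.uIcc_of_ge hs] at hr
          rw [abs_of_nonpos hr.2, abs_of_nonpos hs]; linarith [hr.1]
      exact h1.trans ((Nat.le_ceil _).trans (by exact_mod_cast hn))
    simp only [g, rangeCutoff_eq_one this, one_mul]
  have hgnlim : ∀ s, Tendsto (fun n => g n s) atTop (𝓝 (deriv G s)) := by
    intro s
    refine tendsto_const_nhds.congr' ?_
    filter_upwards [eventually_ge_atTop ⌈|s|⌉₊] with n hn
    simp only [g, rangeCutoff_eq_one ((Nat.le_ceil _).trans (by exact_mod_cast hn)), one_mul]
  have i0 := integrable_bilin B hf.1 hf.1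
  have i1 := (integrable_bilin B (hf.2 j).2 hf.1).add (integrable_bilin B hf.1 (hf.2 j).2)
  have t1 : Tendsto (fun n => ∫ x, partialDeriv j ζ x * Γ n (B (f x) (f x))) atTop
      (𝓝 (∫ x, partialDeriv j ζ x * G (B (f x) (f x)))) := by
    refine tendsto_integral_of_dominated_convergence
      (fun x => ‖partialDeriv j ζ x * G (B (f x) (f x))‖) (fun n =>
        (hζ.partialDeriv j).1.continuous.aestronglyMeasurable.mul
          ((hΓc n).continuous.comp_aestronglyMeasurable i0.1))
      ((hζ.partialDeriv j).integrable_smul hGi.locallyIntegrable).norm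
      (fun n => Eventually.of_forall fun x => ?_)
      (Eventually.of_forall fun x => (hΓlim _).const_mul _)
    rw [norm_mul, norm_mul]
    exact mul_le_mul_of_nonneg_left (hΓbound n _) (norm_nonneg _)
  have t2 : Tendsto (fun n => ∫ x, ζ x * (g n (B (f x) (f x)) *
      (B (f' j x) (f x) + B (f x) (f' j x)))) atTop
      (𝓝 (∫ x, ζ x * (deriv G (B (f x) (f x)) * (B (f' j x) (f x) + B (f x) (f' j x))))) := by
    refine tendsto_integral_of_dominated_convergence
      (fun x => ‖ζ x * (deriv G (B (f x) (f x)) * (B (f' j x) (f x) + B (f x) (f' j x)))‖)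
      (fun n => hζ.1.continuous.aestronglyMeasurable.mul
        (((hgnc n).comp_aestronglyMeasurable i0.1).mul i1.1))
      (hζ.integrable_smul hgi.locallyIntegrable).norm
      (fun n => Eventually.of_forall fun x => ?_)
      (Eventually.of_forall fun x => ((hgnlim _).mul_const _).const_mul _)
    simp only [g, norm_mul]
    refine mul_le_mul_of_nonneg_left (mul_le_mul_of_nonneg_right ?_ (norm_nonneg _)) (norm_nonneg _)
    rw [Real.norm_of_nonneg (rangeCutoff_nonneg n _)]
    exact mul_le_of_le_one_left (norm_nonneg _) (rangeCutoff_le_one n _)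
  refine tendsto_nhds_unique t1 (t2.neg.congr fun n => ?_)
  obtain ⟨C, hC⟩ := (hgnc n).bounded_above_of_compact_support
    ((hasCompactSupport_rangeCutoff n).mul_right)
  have := hf.chain_rule B (hΓc n) (by simp [Γ]) (C := C) (fun s => by rw [hΓderiv]; exact hC s) j hζ
  rw [this, hΓderiv]

/-! ### Sesquilinear forms of spinors -/

/-- The sesquilinear form `u* A w` as a real bilinear map. -/
noncomputable def sesq (A : Matrix (Fin 4) (Fin 4) ℂ) : Spinor →L[ℝ] Spinor →L[ℝ] ℂ :=
  LinearMap.toContinuousBilinearMap (LinearMap.mk₂ ℝ (fun u w => star u ⬝ᵥ A *ᵥ w)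
    (fun u₁ u₂ w => by rw [star_add, add_dotProduct])
    (fun c u w => by rw [star_smul, smul_dotProduct]; rfl)
    (fun u w₁ w₂ => by rw [Matrix.mulVec_add, dotProduct_add])
    (fun c u w => by rw [Matrix.mulVec_smul, dotProduct_smul]))

theorem sesq_apply (A : Matrix (Fin 4) (Fin 4) ℂ) (u w : Spinor) :
    sesq A u w = star u ⬝ᵥ A *ᵥ w := rfl

/-- The real part of `u* A w`. -/
noncomputable def reForm (A : Matrix (Fin 4) (Fin 4) ℂ) : Spinor →L[ℝ] Spinor →L[ℝ] ℝ :=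
  (compL ℝ Spinor ℂ ℝ Complex.reCLM) ∘L sesq A

/-- The imaginary part of `u* A w`. -/
noncomputable def imForm (A : Matrix (Fin 4) (Fin 4) ℂ) : Spinor →L[ℝ] Spinor →L[ℝ] ℝ :=
  (compL ℝ Spinor ℂ ℝ Complex.imCLM) ∘L sesq A

theorem reForm_apply (A : Matrix (Fin 4) (Fin 4) ℂ) (u w : Spinor) :
    reForm A u w = (sesq A u w).re := rfl

theorem imForm_apply (A : Matrix (Fin 4) (Fin 4) ℂ) (u w : Spinor) :
    imForm A u w = (sesq A u w).im := rfl

theorem sesq_eq (A : Matrix (Fin 4) (Fin 4) ℂ) (u w : Spinor) :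
    sesq A u w = reForm A u w + imForm A u w * Complex.I := by
  rw [reForm_apply, imForm_apply, Complex.re_add_im]

theorem sesq_conj {A : Matrix (Fin 4) (Fin 4) ℂ} (hA : A.IsHermitian) (u w : Spinor) :
    sesq A w u = star (sesq A u w) := by
  rw [sesq_apply, sesq_apply, Matrix.star_dotProduct u, star_star, Matrix.star_mulVec, hA.eq,
    Matrix.dotProduct_mulVec]

theorem reForm_symm {A : Matrix (Fin 4) (Fin 4) ℂ} (hA : A.IsHermitian) (u w : Spinor) :
    reForm A w u = reForm A u w := by
  rw [reForm_apply, reForm_apply, sesq_conj hA]; rfl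

theorem imForm_antisymm {A : Matrix (Fin 4) (Fin 4) ℂ} (hA : A.IsHermitian) (u w : Spinor) :
    imForm A w u = - imForm A u w := by
  rw [imForm_apply, imForm_apply, sesq_conj hA]; rfl

theorem imForm_self {A : Matrix (Fin 4) (Fin 4) ℂ} (hA : A.IsHermitian) (u : Spinor) :
    imForm A u u = 0 := by
  linarith [imForm_antisymm hA u u]

theorem beta_isHermitian : beta.IsHermitian := by
  ext i j; fin_cases i <;> fin_cases j <;> simp [beta]

theorem alpha_isHermitian (k : Fin 3) : (alpha k).IsHermitian := by
  ext i j; fin_cases k <;> fin_cases i <;> fin_cases j <;> simp [alpha]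

theorem scalarDensity_eq_reForm (z : Spinor) : scalarDensity z = reForm beta z z := rfl

/-! ### Stress tensor and virial identities of the standing wave -/

/-- The properties of a standing wave `(φ, χ)` and of its gradients `(φ', χ')` from which the virial
identities follow: finite energy, and the field equations. The coupling enters only through `0 ≤ G(s) ≤ G'(s) s`. -/
structure IsProfile (m M eta ω : ℝ) (G : ℝ → ℝ) (φ : Space → Spinor) (φ' : Fin 3 → Space → Spinor)
    (χ : Space → ℝ) (χ' : Fin 3 → Space → ℝ) : Prop where
  grad : HasL2Gradient φ φ'
  density : MemLp (fun x => scalarDensity (φ x)) 2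
  mesonGrad : HasL2Gradient χ χ'
  mesonBounded : ∃ C, ∀ x, ‖χ x‖ ≤ C
  kleinGordon : WeakKleinGordon M χ χ' (fun x => eta * scalarDensity (φ x))
  dirac : ∀ᵐ x : Space,
    (ω : ℂ) • φ x + Complex.I • ∑ k, alpha k *ᵥ φ' k x - (m : ℂ) • (beta *ᵥ φ x)
      + ((eta * χ x : ℝ) : ℂ) • (beta *ᵥ φ x)
      + ((deriv G (scalarDensity (φ x)) : ℝ) : ℂ) • (beta *ᵥ φ x) = 0
  contDiff : ContDiff ℝ 1 G
  zero : G 0 = 0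
  nonneg : ∀ s, 0 ≤ G s
  le_deriv : ∀ s, G s ≤ deriv G s * s

namespace IsProfile

variable {m M eta ω : ℝ} {G : ℝ → ℝ} {φ : Space → Spinor} {φ' : Fin 3 → Space → Spinor}
  {χ : Space → ℝ} {χ' : Fin 3 → Space → ℝ}

/-- The Dirac equation paired with an arbitrary spinor field. -/
theorem pairing (h : IsProfile m M eta ω G φ φ' χ χ') : ∀ᵐ x, ∀ u : Spinor,
    ω * sesq 1 u (φ x) + Complex.I * ∑ k, sesq (alpha k) u (φ' k x)
      + ((-m + eta * χ x + deriv G (scalarDensity (φ x)) : ℝ) : ℂ) * sesq beta u (φ x) = 0 := by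
  filter_upwards [h.dirac] with x hx u
  have := congrArg (fun z => star u ⬝ᵥ z) hx
  simp only [dotProduct_add, dotProduct_sub, dotProduct_smul, dotProduct_sum, dotProduct_zero,
    smul_eq_mul] at this
  simp only [sesq_apply, Matrix.one_mulVec]
  push_cast at this ⊢
  linear_combination this

theorem pairing_re (h : IsProfile m M eta ω G φ φ' χ χ') : ∀ᵐ x, ∀ u : Spinor,
    ω * reForm 1 u (φ x) - ∑ k, imForm (alpha k) u (φ' k x)
      + (-m + eta * χ x + deriv G (scalarDensity (φ x))) * reForm beta u (φ x) = 0 := by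
  filter_upwards [h.pairing] with x hx u
  have := congrArg Complex.re (hx u)
  simpa only [Complex.add_re, Complex.re_ofReal_mul, Complex.I_mul_re, Complex.im_sum,
    Complex.zero_re, ← reForm_apply, ← imForm_apply, ← sub_eq_add_neg] using this

theorem pairing_im (h : IsProfile m M eta ω G φ φ' χ χ') : ∀ᵐ x, ∀ u : Spinor,
    ω * imForm 1 u (φ x) + ∑ k, reForm (alpha k) u (φ' k x)
      + (-m + eta * χ x + deriv G (scalarDensity (φ x))) * imForm beta u (φ x) = 0 := by
  filter_upwards [h.pairing] with x hx u
  have := congrArg Complex.im (hx u)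
  simpa only [Complex.add_im, Complex.im_ofReal_mul, Complex.I_mul_im, Complex.re_sum,
    Complex.zero_im, ← reForm_apply, ← imForm_apply] using this

theorem integrable_im (h : IsProfile m M eta ω G φ φ' χ χ') (A : Matrix (Fin 4) (Fin 4) ℂ)
    (j : Fin 3) : Integrable fun x => imForm A (φ x) (φ' j x) :=
  integrable_bilin _ h.grad.1 (h.grad.2 j).2

theorem integrable_re_left (h : IsProfile m M eta ω G φ φ' χ χ') (A : Matrix (Fin 4) (Fin 4) ℂ)
    (j : Fin 3) : Integrable fun x => reForm A (φ' j x) (φ x) :=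
  integrable_bilin _ (h.grad.2 j).2 h.grad.1

theorem integrable_re_self (h : IsProfile m M eta ω G φ φ' χ χ') (A : Matrix (Fin 4) (Fin 4) ℂ) :
    Integrable fun x => reForm A (φ x) (φ x) :=
  integrable_bilin _ h.grad.1 h.grad.1

theorem integrable_im_grad (h : IsProfile m M eta ω G φ φ' χ χ') (A : Matrix (Fin 4) (Fin 4) ℂ)
    (j k : Fin 3) : Integrable fun x => imForm A (φ' j x) (φ' k x) :=
  integrable_bilin _ (h.grad.2 j).2 (h.grad.2 k).2

theorem integrable_meson_mul (h : IsProfile m M eta ω G φ φ' χ χ') {u : Space → ℝ}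
    (hu : Integrable u) : Integrable fun x => χ x * u x := by
  obtain ⟨C, hC⟩ := h.mesonBounded
  exact hu.bdd_mul (c := C) h.mesonGrad.1.1 (Eventually.of_forall hC)

theorem integrable_meson_grad (h : IsProfile m M eta ω G φ φ' χ χ') (j k : Fin 3) :
    Integrable fun x => χ' j x * χ' k x :=
  integrable_bilin (mul ℝ ℝ) (h.mesonGrad.2 j).2 (h.mesonGrad.2 k).2

theorem integrable_meson_sq (h : IsProfile m M eta ω G φ φ' χ χ') :
    Integrable fun x => χ x * χ x :=
  integrable_bilin (mul ℝ ℝ) h.mesonGrad.1 h.mesonGrad.1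

theorem density_integrable (h : IsProfile m M eta ω G φ φ' χ χ') :
    Integrable fun x => scalarDensity (φ x) := h.integrable_re_self beta

theorem coupling_eq (h : IsProfile m M eta ω G φ φ' χ χ') : ∀ᵐ x,
    deriv G (scalarDensity (φ x)) * scalarDensity (φ x)
      = ∑ k, imForm (alpha k) (φ x) (φ' k x) - ω * reForm 1 (φ x) (φ x)
        + m * scalarDensity (φ x) - eta * (χ x * scalarDensity (φ x)) := by
  filter_upwards [h.pairing_re] with x hx
  have := hx (φ x)
  rw [← scalarDensity_eq_reForm] at this
  linear_combination this

/-- The nonlinearity is integrable because the Dirac equation expresses it by quadratic terms. -/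
theorem integrable_coupling (h : IsProfile m M eta ω G φ φ' χ χ') :
    Integrable fun x => deriv G (scalarDensity (φ x)) * scalarDensity (φ x) := by
  have hi : Integrable fun x => ∑ k, imForm (alpha k) (φ x) (φ' k x) - ω * reForm 1 (φ x) (φ x)
      + m * scalarDensity (φ x) - eta * (χ x * scalarDensity (φ x)) :=
    (((integrable_finsetSum _ fun k _ => h.integrable_im (alpha k) k).sub
      ((h.integrable_re_self 1).const_mul ω)).add (h.density_integrable.const_mul m)).sub
      ((h.integrable_meson_mul h.density_integrable).const_mul eta)
  exact hi.congr (by filter_upwards [h.coupling_eq] with x hx using hx.symm)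

theorem integrable_G (h : IsProfile m M eta ω G φ φ' χ χ') :
    Integrable fun x => G (scalarDensity (φ x)) :=
  h.integrable_coupling.mono' (h.contDiff.continuous.comp_aestronglyMeasurable
    h.density_integrable.1) (Eventually.of_forall fun x => by
      rw [Real.norm_of_nonneg (h.nonneg _)]
      exact h.le_deriv _)

theorem coupling_grad_eq (h : IsProfile m M eta ω G φ φ' χ χ') (j : Fin 3) : ∀ᵐ x,
    deriv G (scalarDensity (φ x)) * reForm beta (φ' j x) (φ x)
      = ∑ k, imForm (alpha k) (φ' j x) (φ' k x) - ω * reForm 1 (φ' j x) (φ x)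
        + m * reForm beta (φ' j x) (φ x) - eta * (χ x * reForm beta (φ' j x) (φ x)) := by
  filter_upwards [h.pairing_re] with x hx
  linear_combination hx (φ' j x)

theorem integrable_coupling_grad (h : IsProfile m M eta ω G φ φ' χ χ') (j : Fin 3) :
    Integrable fun x => deriv G (scalarDensity (φ x)) * reForm beta (φ' j x) (φ x) := by
  have hi : Integrable fun x => ∑ k, imForm (alpha k) (φ' j x) (φ' k x)
      - ω * reForm 1 (φ' j x) (φ x)
      + m * reForm beta (φ' j x) (φ x) - eta * (χ x * reForm beta (φ' j x) (φ x)) :=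
    (((integrable_finsetSum _ fun k _ => h.integrable_im_grad (alpha k) j k).sub
      ((h.integrable_re_left 1 j).const_mul ω)).add ((h.integrable_re_left beta j).const_mul m)).sub
      ((h.integrable_meson_mul (h.integrable_re_left beta j)).const_mul eta)
  exact hi.congr (by filter_upwards [h.coupling_grad_eq j] with x hx using hx.symm)

/-- The derivative of a Hermitian density. -/
theorem hasWeakPartial_reForm (h : IsProfile m M eta ω G φ φ' χ χ')
    {A : Matrix (Fin 4) (Fin 4) ℂ} (hA : A.IsHermitian) (j : Fin 3) :
    HasWeakPartial j (fun x => reForm A (φ x) (φ x)) (fun x => 2 * reForm A (φ' j x) (φ x)) := by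
  have := h.grad.bilin (reForm A) h.grad j
  have e : ∀ x, reForm A (φ' j x) (φ x) + reForm A (φ x) (φ' j x)
      = 2 * reForm A (φ' j x) (φ x) := fun x => by rw [reForm_symm hA (φ' j x)]; ring
  simpa only [e] using this

theorem integral_reForm_grad (h : IsProfile m M eta ω G φ φ' χ χ')
    {A : Matrix (Fin 4) (Fin 4) ℂ} (hA : A.IsHermitian) (j : Fin 3) :
    ∫ x, reForm A (φ x) (φ' j x) = 0 := by
  have h1 := (h.hasWeakPartial_reForm hA j).integral_eq_zero (h.integrable_re_self A)
    ((h.integrable_re_left A j).const_mul 2)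
  rw [integral_const_mul] at h1
  simp_rw [reForm_symm hA (φ' j _)]
  linarith

/-- The current `φ* α φ` of a standing wave is divergence free, so that its mean vanishes. -/
theorem integral_current (h : IsProfile m M eta ω G φ φ' χ χ') (k : Fin 3) :
    ∫ x, reForm (alpha k) (φ x) (φ x) = 0 := by
  refine integral_eq_zero_of_divergence_free (fun k => h.integrable_re_self (alpha k))
    (fun ζ hζ => ?_) k
  have h1 : ∀ k, ∫ x, partialDeriv k ζ x * reForm (alpha k) (φ x) (φ x)
      = - ∫ x, ζ x * (2 * reForm (alpha k) (φ' k x) (φ x)) := fun k =>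
    (h.hasWeakPartial_reForm (alpha_isHermitian k) k).2.2 ζ hζ
  simp_rw [h1]
  have hi : ∀ k, Integrable fun x => ζ x * (2 * reForm (alpha k) (φ' k x) (φ x)) := fun k =>
    hζ.integrable_smul ((h.integrable_re_left (alpha k) k).const_mul 2).locallyIntegrable
  rw [Finset.sum_neg_distrib, ← integral_finsetSum _ fun k _ => hi k, neg_eq_zero]
  refine integral_eq_zero_of_ae ?_
  filter_upwards [h.pairing_im] with x hx
  have := hx (φ x)
  rw [imForm_self Matrix.isHermitian_one, imForm_self beta_isHermitian] at this
  simp only [mul_zero, zero_add, add_zero] at this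
  simp only [← Finset.mul_sum, Pi.zero_apply]
  simp_rw [fun k => reForm_symm (alpha_isHermitian k) (φ x) (φ' k x), this, mul_zero]

/-- Minus the Lagrangian density evaluated on the standing wave. -/
noncomputable def virialDensity (M : ℝ) (G : ℝ → ℝ) (φ : Space → Spinor) (χ : Space → ℝ)
    (χ' : Fin 3 → Space → ℝ) (x : Space) : ℝ :=
  deriv G (scalarDensity (φ x)) * scalarDensity (φ x) - G (scalarDensity (φ x))
    + ((1 / 2) * ∑ k, χ' k x * χ' k x + (1 / 2) * M ^ 2 * (χ x * χ x))

theorem integrable_virialDensity (h : IsProfile m M eta ω G φ φ' χ χ') :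
    Integrable (virialDensity M G φ χ χ') :=
  (h.integrable_coupling.sub h.integrable_G).add
    (((integrable_finsetSum _ fun k _ => h.integrable_meson_grad k k).const_mul _).add
      (h.integrable_meson_sq.const_mul _))

/-- The stress tensor of the standing wave. -/
noncomputable def stress (M : ℝ) (G : ℝ → ℝ) (φ : Space → Spinor) (φ' : Fin 3 → Space → Spinor)
    (χ : Space → ℝ) (χ' : Fin 3 → Space → ℝ) (k j : Fin 3) (x : Space) : ℝ :=
  (if k = j then virialDensity M G φ χ χ' x else 0)
    - (imForm (alpha k) (φ x) (φ' j x) + χ' k x * χ' j x)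

theorem integrable_stress (h : IsProfile m M eta ω G φ φ' χ χ') (k j : Fin 3) :
    Integrable (stress M G φ φ' χ χ' k j) := by
  refine Integrable.sub ?_ ((h.integrable_im (alpha k) j).add (h.integrable_meson_grad k j))
  by_cases hkj : k = j
  · simpa [hkj] using h.integrable_virialDensity
  · simp [hkj]

end IsProfile

section TestIntegrals

theorem _root_.MeasureTheory.Integrable.fun_sub {f g : Space → ℝ} (hf : Integrable f)
    (hg : Integrable g) : Integrable fun x => f x - g x := hf.sub hg

variable {ζ f g : Space → ℝ}

theorem IsTest.integral_add (hζ : IsTest ζ) (hf : Integrable f) (hg : Integrable g) :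
    ∫ x, ζ x * (f x + g x) = (∫ x, ζ x * f x) + ∫ x, ζ x * g x := by
  simp only [mul_add]
  exact MeasureTheory.integral_add (hζ.integrable_smul hf.locallyIntegrable)
    (hζ.integrable_smul hg.locallyIntegrable)

theorem IsTest.integral_sub (hζ : IsTest ζ) (hf : Integrable f) (hg : Integrable g) :
    ∫ x, ζ x * (f x - g x) = (∫ x, ζ x * f x) - ∫ x, ζ x * g x := by
  simp only [mul_sub]
  exact MeasureTheory.integral_sub (hζ.integrable_smul hf.locallyIntegrable)
    (hζ.integrable_smul hg.locallyIntegrable)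

theorem integral_mul_const_mul (ζ f : Space → ℝ) (c : ℝ) :
    ∫ x, ζ x * (c * f x) = c * ∫ x, ζ x * f x := by
  rw [← integral_const_mul]; congr 1; ext x; ring

theorem IsTest.integral_sum (hζ : IsTest ζ) {f : Fin 3 → Space → ℝ} (hf : ∀ k, Integrable (f k)) :
    ∫ x, ζ x * ∑ k, f k x = ∑ k, ∫ x, ζ x * f k x := by
  simp only [Finset.mul_sum]
  exact integral_finsetSum _ fun k _ => hζ.integrable_smul (hf k).locallyIntegrable

end TestIntegrals

namespace IsProfile

variable {m M eta ω : ℝ} {G : ℝ → ℝ} {φ : Space → Spinor} {φ' : Fin 3 → Space → Spinor}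
  {χ : Space → ℝ} {χ' : Fin 3 → Space → ℝ}

/-- The Dirac equation tested with `ζ ∂_j φ`. -/
theorem integral_coupling_grad (h : IsProfile m M eta ω G φ φ' χ χ') (j : Fin 3) {ζ : Space → ℝ}
    (hζ : IsTest ζ) :
    ∫ x, ζ x * (deriv G (scalarDensity (φ x)) * reForm beta (φ' j x) (φ x))
      = (∑ k, ∫ x, ζ x * imForm (alpha k) (φ' j x) (φ' k x))
        - ω * (∫ x, ζ x * reForm 1 (φ' j x) (φ x)) + m * (∫ x, ζ x * reForm beta (φ' j x) (φ x))
        - eta * ∫ x, ζ x * (χ x * reForm beta (φ' j x) (φ x)) := by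
  have i1 := fun k => h.integrable_im_grad (alpha k) j k
  have i2 := (h.integrable_re_left 1 j).const_mul ω
  have i3 := (h.integrable_re_left beta j).const_mul m
  have i4 := (h.integrable_meson_mul (h.integrable_re_left beta j)).const_mul eta
  have is := integrable_finsetSum Finset.univ fun k _ => i1 k
  rw [← integral_mul_const_mul, ← integral_mul_const_mul, ← integral_mul_const_mul,
    ← hζ.integral_sum i1, ← hζ.integral_sub is i2, ← hζ.integral_add (is.fun_sub i2) i3,
    ← hζ.integral_sub ((is.fun_sub i2).fun_add i3) i4]
  refine integral_congr_ae ?_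
  filter_upwards [h.coupling_grad_eq j] with x hx
  simp only [hx]

theorem integral_test_virialDensity (h : IsProfile m M eta ω G φ φ' χ χ') {ζ : Space → ℝ}
    (hζ : IsTest ζ) :
    ∫ x, ζ x * virialDensity M G φ χ χ' x
      = (∑ k, ∫ x, ζ x * imForm (alpha k) (φ x) (φ' k x))
        - ω * (∫ x, ζ x * reForm 1 (φ x) (φ x)) + m * (∫ x, ζ x * scalarDensity (φ x))
        - eta * (∫ x, ζ x * (χ x * scalarDensity (φ x))) - (∫ x, ζ x * G (scalarDensity (φ x)))
        + ((1 / 2) * (∑ k, ∫ x, ζ x * (χ' k x * χ' k x))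
          + (1 / 2) * M ^ 2 * ∫ x, ζ x * (χ x * χ x)) := by
  have i1 := fun k => h.integrable_im (alpha k) k
  have i2 := (h.integrable_re_self 1).const_mul ω
  have i3 := h.density_integrable.const_mul m
  have i4 := (h.integrable_meson_mul h.density_integrable).const_mul eta
  have is := integrable_finsetSum Finset.univ fun k _ => i1 k
  have j1 := fun k => h.integrable_meson_grad k k
  have js := (integrable_finsetSum Finset.univ fun k _ => j1 k).const_mul (1 / 2)
  have j2 := h.integrable_meson_sq.const_mul (1 / 2 * M ^ 2)
  rw [← hζ.integral_sum j1]
  simp only [← integral_mul_const_mul]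
  rw [← hζ.integral_sum i1, ← hζ.integral_sub is i2, ← hζ.integral_add (is.fun_sub i2) i3,
    ← hζ.integral_sub ((is.fun_sub i2).fun_add i3) i4,
    ← hζ.integral_sub (((is.fun_sub i2).fun_add i3).fun_sub i4) h.integrable_G,
    ← hζ.integral_add js j2,
    ← hζ.integral_add ((((is.fun_sub i2).fun_add i3).fun_sub i4).fun_sub h.integrable_G) (js.fun_add j2)]
  refine integral_congr_ae ?_
  filter_upwards [h.coupling_eq] with x hx
  simp only [virialDensity, hx]

/-- The stress tensor of a standing wave is divergence free. -/
theorem stress_divergence_free (h : IsProfile m M eta ω G φ φ' χ χ') (j : Fin 3) {ζ : Space → ℝ}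
    (hζ : IsTest ζ) :
    ∑ k, ∫ x, partialDeriv k ζ x * stress M G φ φ' χ χ' k j x = 0 := by
  have hζj := hζ.partialDeriv j
  have hdiag : ∀ k, Integrable fun x => if k = j then virialDensity M G φ χ χ' x else 0 := by
    intro k
    by_cases hkj : k = j
    · simpa [hkj] using h.integrable_virialDensity
    · simp [hkj]
  have hsplit : ∀ k, ∫ x, partialDeriv k ζ x * stress M G φ φ' χ χ' k j x
      = (if k = j then ∫ x, partialDeriv k ζ x * virialDensity M G φ χ χ' x else 0)
        - ((∫ x, partialDeriv k ζ x * imForm (alpha k) (φ x) (φ' j x))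
          + ∫ x, partialDeriv k ζ x * (χ' j x * χ' k x)) := by
    intro k
    simp only [stress]
    rw [(hζ.partialDeriv k).integral_sub (hdiag k)
      ((h.integrable_im (alpha k) j).fun_add (h.integrable_meson_grad k j)),
      (hζ.partialDeriv k).integral_add (h.integrable_im (alpha k) j) (h.integrable_meson_grad k j)]
    congr 1
    · split_ifs <;> simp
    · simp only [mul_comm (χ' j _)]
  simp only [hsplit, Finset.sum_sub_distrib, Finset.sum_add_distrib, Finset.sum_ite_eq',
    Finset.mem_univ, if_true]
  rw [h.integral_test_virialDensity hζj]
  have e1 : ∫ x, partialDeriv j ζ x * reForm 1 (φ x) (φ x)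
      = -(2 * ∫ x, ζ x * reForm 1 (φ' j x) (φ x)) := by
    rw [← integral_mul_const_mul]
    exact (h.hasWeakPartial_reForm Matrix.isHermitian_one j).2.2 ζ hζ
  have e2 : ∫ x, partialDeriv j ζ x * scalarDensity (φ x)
      = -(2 * ∫ x, ζ x * reForm beta (φ' j x) (φ x)) := by
    rw [← integral_mul_const_mul]
    exact (h.hasWeakPartial_reForm beta_isHermitian j).2.2 ζ hζ
  -- the second derivatives of the spinor enter only through null forms
  have e3 : (∑ k, ∫ x, partialDeriv j ζ x * imForm (alpha k) (φ x) (φ' k x))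
      - (∑ k, ∫ x, partialDeriv k ζ x * imForm (alpha k) (φ x) (φ' j x))
      = -(2 * ∑ k, ∫ x, ζ x * imForm (alpha k) (φ' j x) (φ' k x)) := by
    rw [← Finset.sum_sub_distrib, Finset.mul_sum, ← Finset.sum_neg_distrib]
    refine Finset.sum_congr rfl fun k _ => ?_
    have h1 := h.grad.null_form (imForm (alpha k)) h.grad j k hζ
    simp only [smul_eq_mul] at h1
    rw [h1]
    simp_rw [fun x => imForm_antisymm (alpha_isHermitian k) (φ' j x) (φ' k x), mul_neg,
      integral_neg]
    ring
  -- `∂_j G(φ̄φ) = 2 g(φ̄φ) Re(∂_jφ* β φ)`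
  have e4 : ∫ x, partialDeriv j ζ x * G (scalarDensity (φ x))
      = -(2 * ∫ x, ζ x * (deriv G (scalarDensity (φ x)) * reForm beta (φ' j x) (φ x))) := by
    have e : ∀ x, deriv G (reForm beta (φ x) (φ x)) *
        (reForm beta (φ' j x) (φ x) + reForm beta (φ x) (φ' j x))
        = 2 * (deriv G (scalarDensity (φ x)) * reForm beta (φ' j x) (φ x)) := by
      intro x
      rw [reForm_symm beta_isHermitian (φ' j x), scalarDensity_eq_reForm]; ring
    have h1 := h.grad.chain_rule_of_integrable (reForm beta) h.contDiff h.zero h.nonneg h.le_deriv j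
      h.integrable_G (by simpa only [e] using (h.integrable_coupling_grad j).const_mul 2) hζ
    simp only [e] at h1
    rw [← integral_mul_const_mul]
    exact h1
  have e5 : 2 * ∫ x, ζ x * (χ x * reForm beta (φ' j x) (φ x))
      = - (∫ x, partialDeriv j ζ x * (χ x * scalarDensity (φ x)))
        - ∫ x, ζ x * (χ' j x * scalarDensity (φ x)) := by
    obtain ⟨C, hC⟩ := h.mesonBounded
    have h1 := h.mesonGrad.integral_mul_of_bounded hC (h.hasWeakPartial_reForm beta_isHermitian j)
      (h.integrable_re_self beta) h.density ((h.integrable_re_left beta j).const_mul 2) hζ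
    rw [← integral_mul_const_mul]
    simp only [mul_left_comm (χ _) (2 : ℝ)] at h1
    exact h1
  have e6 := h.kleinGordon.virial h.mesonGrad (h.density.const_mul eta) j hζ
  simp only [mul_left_comm _ eta, integral_const_mul] at e6
  have e7 := h.integral_coupling_grad j hζ
  rw [e1, e2, e4, e7]
  linear_combination e3 - eta * e5 + e6

/-- The virial identities: the spatial mean of the stress tensor vanishes. -/
theorem virial (h : IsProfile m M eta ω G φ φ' χ χ') (k j : Fin 3) :
    (∫ x, imForm (alpha k) (φ x) (φ' j x)) + ∫ x, χ' k x * χ' j x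
      = if k = j then ∫ x, virialDensity M G φ χ χ' x else 0 := by
  have h1 := integral_eq_zero_of_divergence_free (fun k => h.integrable_stress k j)
    (fun ζ hζ => h.stress_divergence_free j hζ) k
  have hi := (h.integrable_im (alpha k) j).fun_add (h.integrable_meson_grad k j)
  by_cases hkj : k = j
  · simp only [stress, if_pos hkj] at h1 ⊢
    rw [MeasureTheory.integral_sub h.integrable_virialDensity hi, MeasureTheory.integral_add
      (h.integrable_im (alpha k) j) (h.integrable_meson_grad k j)] at h1
    linarith
  · simp only [stress, if_neg hkj, zero_sub] at h1 ⊢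
    rw [integral_neg, MeasureTheory.integral_add
      (h.integrable_im (alpha k) j) (h.integrable_meson_grad k j)] at h1
    linarith

end IsProfile

/-! ### The standing wave in its rest frame -/

/-- Both alternatives for the self-coupling give the properties used in the virial identities; for
`G ≥ 0` the growth condition with some `θ > 1` contains the one with `θ = 1`. -/
theorem coupling_properties {G : ℝ → ℝ} (hG : (∀ s, G s = 0) ∨ AdmissibleCoupling G) :
    ContDiff ℝ 1 G ∧ G 0 = 0 ∧ (∀ s, 0 ≤ G s) ∧ ∀ s, G s ≤ deriv G s * s := by
  rcases hG with h | ⟨h1, ⟨θ, hθ, hle⟩, ⟨h0, -⟩, hnn, -⟩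
  · obtain rfl : G = fun _ => 0 := funext h
    exact ⟨contDiff_const, rfl, fun _ => le_rfl, fun s => by simp⟩
  · exact ⟨h1.of_le one_le_two, h0, hnn, fun s => by nlinarith [hle s, hnn s]⟩

theorem HasL2Gradient.memLp_scalarDensity {φ : Space → Spinor} {φ' : Fin 3 → Space → Spinor}
    (h : HasL2Gradient φ φ') : MemLp (fun x => scalarDensity (φ x)) 2 := by
  have hi : Integrable fun x => scalarDensity (φ x) := integrable_bilin (reForm beta) h.1 h.1
  rw [memLp_two_iff_integrable_sq hi.1]
  have i2 : Integrable fun x => ‖φ x‖ ^ 2 := h.1.integrable_norm_pow two_ne_zero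
  have i6 : Integrable fun x => ‖φ x‖ ^ 6 := h.memLp_six.integrable_norm_pow (p := 6) (by norm_num)
  refine ((i2.add i6).const_mul (‖reForm beta‖ ^ 2)).mono' (hi.1.pow 2)
    (Eventually.of_forall fun x => ?_)
  have h1 : ‖scalarDensity (φ x)‖ ≤ ‖reForm beta‖ * ‖φ x‖ * ‖φ x‖ :=
    (reForm beta).le_opNorm₂ (φ x) (φ x)
  have h2 : ‖scalarDensity (φ x)‖ ^ 2 ≤ (‖reForm beta‖ * ‖φ x‖ * ‖φ x‖) ^ 2 :=
    pow_le_pow_left₀ (norm_nonneg _) h1 2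
  rw [norm_pow]
  refine h2.trans ?_
  -- `‖φ‖⁴ ≤ ‖φ‖² + ‖φ‖⁶`
  have h3 : ‖φ x‖ ^ 4 ≤ ‖φ x‖ ^ 2 + ‖φ x‖ ^ 6 := by
    nlinarith [sq_nonneg (‖φ x‖ * (‖φ x‖ ^ 2 - 1)), sq_nonneg (‖φ x‖ ^ 2)]
  calc (‖reForm beta‖ * ‖φ x‖ * ‖φ x‖) ^ 2 = ‖reForm beta‖ ^ 2 * ‖φ x‖ ^ 4 := by ring
    _ ≤ ‖reForm beta‖ ^ 2 * (‖φ x‖ ^ 2 + ‖φ x‖ ^ 6) := by gcongr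

theorem restMeson_eq_potential (M eta : ℝ) (φ : Space → Spinor) :
    restMeson M eta φ = potential (yukawa M) fun y => eta * scalarDensity (φ y) := by
  ext x
  rw [potential_apply]
  rfl

theorem IsStandingWave.isProfile {m M eta ω : ℝ} (hM : 0 < M) {G : ℝ → ℝ}
    (hG : (∀ s, G s = 0) ∨ AdmissibleCoupling G) {φ : Space → Spinor}
    (hφ : IsStandingWave m M eta ω G φ) :
    IsProfile m M eta ω G φ (fun k => weakPartial k φ) (restMeson M eta φ)
      (fun k => potential (yukawaGrad M k) fun y => eta * scalarDensity (φ y)) := by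
  obtain ⟨hG1, hG0, hnn, hle⟩ := coupling_properties hG
  have hgrad := hφ.1.hasL2Gradient
  have hs := hgrad.memLp_scalarDensity
  have hf : Integrable fun y => eta * scalarDensity (φ y) :=
    (integrable_bilin (reForm beta) hgrad.1 hgrad.1).const_mul eta
  have hf2 : MemLp (fun y => eta * scalarDensity (φ y)) 2 := hs.const_mul eta
  exact {
    grad := hgrad
    density := hs
    mesonGrad := restMeson_eq_potential M eta φ ▸ hasL2Gradient_yukawa hM hf hf2
    mesonBounded := restMeson_eq_potential M eta φ ▸ potential_yukawa_bounded hM hf2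
    kleinGordon := restMeson_eq_potential M eta φ ▸ weakKleinGordon_yukawa hM hf
    dirac := hφ.2
    contDiff := hG1
    zero := hG0
    nonneg := hnn
    le_deriv := hle }

theorem star_exp_mul_I_mul_self (a : ℝ) :
    star (Complex.exp ((a : ℂ) * Complex.I)) * Complex.exp ((a : ℂ) * Complex.I) = 1 := by
  rw [Complex.star_def, ← Complex.exp_conj, ← Complex.exp_add]
  simp

theorem sesq_smul_smul (A : Matrix (Fin 4) (Fin 4) ℂ) {c : ℂ} (hc : star c * c = 1) (u w : Spinor) :
    sesq A (c • u) (c • w) = sesq A u w := by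
  rw [sesq_apply, star_smul, Matrix.mulVec_smul, smul_dotProduct, dotProduct_smul, smul_smul, hc,
    one_smul, sesq_apply]

theorem hasWeakTimeDeriv_const {χ : Space → ℝ} (h : LocallyIntegrable χ) (t : ℝ) :
    HasWeakTimeDeriv (fun _ => χ) t 0 :=
  ⟨fun _ => h, locallyIntegrable_zero, fun ζ _ => by simpa using hasDerivAt_const t (∫ x, ζ x * χ x)⟩

theorem HasL2Gradient.clm_comp {F H : Type} [NormedAddCommGroup F] [NormedSpace ℝ F]
    [CompleteSpace F] [NormedAddCommGroup H] [NormedSpace ℝ H] [CompleteSpace H] {f : Space → F}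
    {f' : Fin 3 → Space → F} (h : HasL2Gradient f f') (T : F →L[ℝ] H) :
    HasL2Gradient (fun x => T (f x)) (fun k x => T (f' k x)) :=
  ⟨T.comp_memLp' h.1, fun k => ⟨(h.2 k).1.clm_comp T, T.comp_memLp' (h.2 k).2⟩⟩

namespace IsProfile

variable {m M eta ω : ℝ} {G : ℝ → ℝ} {φ : Space → Spinor} {φ' : Fin 3 → Space → Spinor}
  {χ : Space → ℝ} {χ' : Fin 3 → Space → ℝ}

theorem restDirac_hasL2Gradient (h : IsProfile m M eta ω G φ φ' χ χ') (t : ℝ) :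
    HasL2Gradient (restDirac ω φ t)
      (fun k x => Complex.exp (-Complex.I * ω * t) • φ' k x) :=
  h.grad.clm_comp (Complex.exp (-Complex.I * ω * t) • ContinuousLinearMap.id ℝ Spinor)

theorem fieldsInH1_rest (h : IsProfile m M eta ω G φ φ' χ χ') (t : ℝ) :
    FieldsInH1 (restDirac ω φ) (fun _ => χ) t :=
  ⟨(h.restDirac_hasL2Gradient t).memH1, h.mesonGrad.memH1, 0,
    hasWeakTimeDeriv_const (locallyIntegrable_of_memLp_two h.mesonGrad.1) t, MemLp.zero⟩

/-- By the Dirac equation, the energy density is `ω |φ|²` plus the density of the virial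
identities. -/
theorem energyDensity_rest (h : IsProfile m M eta ω G φ φ' χ χ') (t : ℝ) :
    energyDensity m M eta G (restDirac ω φ) (fun _ => χ) t =ᵐ[volume]
      fun x => ((ω * reForm 1 (φ x) (φ x) + virialDensity M G φ χ χ' x : ℝ) : ℂ) := by
  have e1 := ae_all_iff.2 fun k => ((h.restDirac_hasL2Gradient t).2 k).1.weakPartial_ae
  have e2 := ae_all_iff.2 fun k => (h.mesonGrad.2 k).1.weakPartial_ae
  have e3 := (hasWeakTimeDeriv_const (locallyIntegrable_of_memLp_two h.mesonGrad.1) t).weakTimeDeriv_ae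
  filter_upwards [e1, e2, e3, h.pairing] with x h1 h2 h3 h4
  have hc : star (Complex.exp (-Complex.I * ω * t)) * Complex.exp (-Complex.I * ω * t) = 1 := by
    have e : -Complex.I * ω * t = ((-(ω * t) : ℝ) : ℂ) * Complex.I := by push_cast; ring
    rw [e, star_exp_mul_I_mul_self]
  have hs : scalarDensity (restDirac ω φ t x) = scalarDensity (φ x) := by
    rw [scalarDensity_eq_reForm, reForm_apply, restDirac, sesq_smul_smul _ hc]; rfl
  have hd : star (restDirac ω φ t x) ⬝ᵥ (-Complex.I • ∑ k, alpha k *ᵥ weakPartial k (restDirac ω φ t) x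
      + (m : ℂ) • (beta *ᵥ restDirac ω φ t x))
      = -Complex.I * ∑ k, sesq (alpha k) (φ x) (φ' k x) + m * sesq beta (φ x) (φ x) := by
    simp only [h1, dotProduct_add, dotProduct_smul, dotProduct_sum, ← sesq_apply, smul_eq_mul,
      restDirac, sesq_smul_smul _ hc]
  have h5 := h4 (φ x)
  have hb : sesq beta (φ x) (φ x) = scalarDensity (φ x) := by
    rw [sesq_eq, imForm_self beta_isHermitian, scalarDensity_eq_reForm]; simp
  have h1' : sesq 1 (φ x) (φ x) = reForm 1 (φ x) (φ x) := by
    rw [sesq_eq, imForm_self Matrix.isHermitian_one]; simp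
  rw [energyDensity, hd, hs, h3]
  simp only [h2, virialDensity]
  rw [hb, h1'] at h5
  rw [hb]
  push_cast at h5 ⊢
  simp only [← pow_two, Pi.zero_apply, Complex.ofReal_zero]
  linear_combination -h5

theorem integrable_energyDensity_rest (h : IsProfile m M eta ω G φ φ' χ χ') (t : ℝ) :
    Integrable (energyDensity m M eta G (restDirac ω φ) (fun _ => χ) t) :=
  (((h.integrable_re_self 1).const_mul ω).add h.integrable_virialDensity).ofReal.congr
    (h.energyDensity_rest t).symm

theorem energy_rest (h : IsProfile m M eta ω G φ φ' χ χ') (t : ℝ) :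
    energy m M eta G (restDirac ω φ) (fun _ => χ) t
      = ((ω * (∫ x, reForm 1 (φ x) (φ x)) + ∫ x, virialDensity M G φ χ χ' x : ℝ) : ℂ) := by
  rw [energy, integral_congr_ae (h.energyDensity_rest t), integral_complex_ofReal,
    integral_add ((h.integrable_re_self 1).const_mul ω) h.integrable_virialDensity,
    integral_const_mul]

end IsProfile

/-! ### The Lorentz boost -/

theorem lorentzFactor_pos {v : Space} (hv : ‖v‖ < 1) : 0 < lorentzFactor v :=
  inv_pos.2 (Real.sqrt_pos.2 (by nlinarith [norm_nonneg v]))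

theorem lorentzFactor_sq {v : Space} (hv : ‖v‖ < 1) :
    lorentzFactor v ^ 2 * (1 - ‖v‖ ^ 2) = 1 := by
  have h1 : 0 < 1 - ‖v‖ ^ 2 := by nlinarith [norm_nonneg v]
  rw [lorentzFactor, inv_pow, Real.sq_sqrt h1.le, inv_mul_cancel₀ h1.ne']

/-- The linear map `x ↦ x + (γ - 1) v (v·x) / |v|²`, the spatial part of the boost at time `0`; it
stretches the direction of `v` by the factor `γ`. -/
noncomputable def boostMap (v : Space) : Space →L[ℝ] Space :=
  ContinuousLinearMap.id ℝ Space
    + (((lorentzFactor v - 1) / ‖v‖ ^ 2) • innerSL ℝ v).smulRight v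

theorem boostMap_apply (v x : Space) :
    boostMap v x = x + ((lorentzFactor v - 1) / ‖v‖ ^ 2 * inner ℝ v x) • v := by
  simp [boostMap]

theorem boostMap_self (v : Space) : boostMap v v = lorentzFactor v • v := by
  rcases eq_or_ne v 0 with rfl | hv
  · simp
  · have : ‖v‖ ^ 2 ≠ 0 := by positivity
    rw [boostMap_apply, real_inner_self_eq_norm_sq, div_mul_cancel₀ _ this, sub_smul, one_smul,
      add_sub_cancel]

theorem det_boostMap (v : Space) : (boostMap v).det = lorentzFactor v := by
  have e : ((boostMap v : Space →L[ℝ] Space) : Space →ₗ[ℝ] Space)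
      = LinearMap.transvection
        (((((lorentzFactor v - 1) / ‖v‖ ^ 2) • innerSL ℝ v : Space →L[ℝ] ℝ)) : Space →ₗ[ℝ] ℝ) v := by
    ext1 x
    simp [boostMap, LinearMap.transvection.apply]
  rw [ContinuousLinearMap.det, e, LinearMap.transvection.det]
  rcases eq_or_ne v 0 with rfl | hv
  · simp [lorentzFactor]
  · have : ‖v‖ ^ 2 ≠ 0 := by positivity
    simp [div_mul_cancel₀ _ this]

/-- The linear map `boostMap` as an isomorphism. -/
noncomputable def boostEquiv {v : Space} (hv : ‖v‖ < 1) : Space ≃L[ℝ] Space :=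
  (boostMap v).toContinuousLinearEquivOfDetNeZero
    (by rw [det_boostMap]; exact (lorentzFactor_pos hv).ne')

theorem boostEquiv_apply {v : Space} (hv : ‖v‖ < 1) (x : Space) :
    boostEquiv hv x = boostMap v x := rfl

theorem det_boostEquiv {v : Space} (hv : ‖v‖ < 1) :
    LinearMap.det (boostEquiv hv : Space →ₗ[ℝ] Space) = lorentzFactor v :=
  det_boostMap v

theorem boost_neg_fst (v : Space) (t : ℝ) (x : Space) :
    (boost (-v) (t, x)).1 = lorentzFactor v * (t - inner ℝ v x) := by
  simp [boost, lorentzFactor, sub_eq_add_neg]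

theorem boost_neg_snd {v : Space} (hv : ‖v‖ < 1) (t : ℝ) (x : Space) :
    (boost (-v) (t, x)).2 = boostEquiv hv x + (-(lorentzFactor v * t)) • v := by
  rw [boostEquiv_apply, boostMap_apply]
  have : lorentzFactor (-v) = lorentzFactor v := by simp [lorentzFactor]
  simp only [boost, this, norm_neg, inner_neg_right, smul_neg, neg_smul, real_inner_comm v x]
  rw [add_assoc, add_assoc, ← neg_smul]
  congr 3
  ring

/-- The matrix of the boost is symmetric and maps `v` to `γ v`. -/
theorem sum_boostMap_mul (v : Space) (k : Fin 3) :
    ∑ l, boostMap v (EuclideanSpace.single k 1) l * v l = lorentzFactor v * v k := by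
  have h1 : ∀ w : Space, ∑ l, w l * v l = inner ℝ v w := fun w => by
    simp [PiLp.inner_apply]
  rw [h1, boostMap_apply, inner_add_right, inner_smul_right, real_inner_self_eq_norm_sq,
    EuclideanSpace.inner_single_right]
  rcases eq_or_ne v 0 with rfl | hv
  · simp
  · have : ‖v‖ ^ 2 ≠ 0 := by positivity
    simp only [conj_trivial, one_mul]
    field_simp
    ring

theorem alpha_mul_self (k : Fin 3) : alpha k * alpha k = 1 := by
  ext i j; fin_cases k <;> fin_cases i <;> fin_cases j <;>
    simp [alpha, Matrix.mul_apply, Fin.sum_univ_four]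

theorem alpha_anticomm {j k : Fin 3} (h : j ≠ k) : alpha j * alpha k = - (alpha k * alpha j) := by
  ext a b
  fin_cases j <;> fin_cases k <;> first | exact absurd rfl h | skip
  all_goals
    fin_cases a <;> fin_cases b <;> simp [alpha, Matrix.mul_apply, Fin.sum_univ_four]

/-- `(α·v)² = |v|²`. -/
theorem alpha_dot_sq (v : Space) :
    (∑ k, ((v k : ℝ) : ℂ) • alpha k) * (∑ k, ((v k : ℝ) : ℂ) • alpha k)
      = ((‖v‖ ^ 2 : ℝ) : ℂ) • 1 := by
  have h01 := alpha_anticomm (j := 1) (k := 0) (by decide)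
  have h02 := alpha_anticomm (j := 2) (k := 0) (by decide)
  have h12 := alpha_anticomm (j := 2) (k := 1) (by decide)
  rw [EuclideanSpace.norm_sq_eq]
  simp only [Fin.sum_univ_three, add_mul, mul_add, smul_mul_smul_comm, alpha_mul_self, h01, h02,
    h12, Real.norm_eq_abs, sq_abs]
  push_cast
  module

theorem spinorBoost_isHermitian (v : Space) : (spinorBoost v).IsHermitian := by
  have h : ∀ k, (alpha k)ᴴ = alpha k := fun k => alpha_isHermitian k
  simp [Matrix.IsHermitian, spinorBoost, Matrix.conjTranspose_smul, Matrix.conjTranspose_sum, h]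

/-- `S_v* S_v = γ (1 + α·v)`. -/
theorem spinorBoost_sq {v : Space} (hv : ‖v‖ < 1) :
    (spinorBoost v)ᴴ * spinorBoost v
      = ((lorentzFactor v : ℝ) : ℂ) • (1 + ∑ k, ((v k : ℝ) : ℂ) • alpha k) := by
  rw [(spinorBoost_isHermitian v).eq, spinorBoost, smul_mul_smul_comm]
  have hg := lorentzFactor_pos hv
  have hsq := lorentzFactor_sq hv
  have ha := alpha_dot_sq v
  generalize (∑ k, ((v k : ℝ) : ℂ) • alpha k) = a at *
  have e : (1 + ((lorentzFactor v / (lorentzFactor v + 1) : ℝ) : ℂ) • a)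
      * (1 + ((lorentzFactor v / (lorentzFactor v + 1) : ℝ) : ℂ) • a)
      = (((1 + (lorentzFactor v / (lorentzFactor v + 1)) ^ 2 * ‖v‖ ^ 2 : ℝ)) : ℂ) • 1
        + ((2 * (lorentzFactor v / (lorentzFactor v + 1)) : ℝ) : ℂ) • a := by
    simp only [add_mul, mul_add, one_mul, mul_one, smul_mul_smul_comm, ha]
    push_cast
    module
  rw [e, ← Complex.ofReal_mul, Real.mul_self_sqrt (by positivity), smul_add, smul_add, smul_smul,
    smul_smul, ← Complex.ofReal_mul, ← Complex.ofReal_mul]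
  generalize lorentzFactor v = g at *
  generalize ‖v‖ ^ 2 = n at *
  have hn : g ^ 2 * n = g ^ 2 - 1 := by linarith
  have hg1 : g + 1 ≠ 0 := by positivity
  congr 3
  · rw [div_pow]
    field_simp
    linear_combination hn
  · field_simp

/-- The boosted density is `γ` times the density plus the current along `v`. -/
theorem sesq_mulVec_mulVec {v : Space} (hv : ‖v‖ < 1) (u w : Spinor) :
    sesq 1 (spinorBoost v *ᵥ u) (spinorBoost v *ᵥ w)
      = lorentzFactor v * (sesq 1 u w + ∑ k, ((v k : ℝ) : ℂ) * sesq (alpha k) u w) := by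
  rw [sesq_apply, Matrix.one_mulVec, Matrix.star_mulVec, ← Matrix.dotProduct_mulVec,
    Matrix.mulVec_mulVec, spinorBoost_sq hv, Matrix.smul_mulVec, dotProduct_smul, smul_eq_mul,
    Matrix.add_mulVec, dotProduct_add, Matrix.sum_mulVec, dotProduct_sum]
  simp only [Matrix.smul_mulVec, dotProduct_smul, smul_eq_mul, sesq_apply]

/-! ### The moving wave -/

theorem pd_comp_affine {c c' : ℝ → ℝ} (hc : ∀ r, HasDerivAt c (c' r) r) (a : ℝ) (κ : Space)
    (k : Fin 3) (x : Space) :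
    pd k (fun x => c (a + inner ℝ κ x)) x = c' (a + inner ℝ κ x) * κ k := by
  have h1 : HasFDerivAt (fun x : Space => a + inner ℝ κ x) (innerSL ℝ κ) x :=
    ((innerSL ℝ κ).hasFDerivAt).const_add a
  have h2 := (hc (a + inner ℝ κ x)).comp_hasFDerivAt x h1
  rw [pd, HasFDerivAt.fderiv (f := fun x => c (a + inner ℝ κ x)) h2]
  simp [EuclideanSpace.inner_single_right]

theorem contDiff_affine_inner (a : ℝ) (κ : Space) :
    ContDiff ℝ ((⊤ : ℕ∞) : WithTop ℕ∞) fun x : Space => a + inner ℝ κ x :=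
  contDiff_const.add (contDiff_const.inner ℝ contDiff_id)

theorem memLp_smul_phase {u : Space → Spinor} (hu : MemLp u 2) (a : ℝ) (κ : Space) :
    MemLp (fun x => Complex.exp (((a + inner ℝ κ x : ℝ) : ℂ) * Complex.I) • u x) 2 := by
  have hc : Continuous fun x => Complex.exp (((a + inner ℝ κ x : ℝ) : ℂ) * Complex.I) := by
    have := (contDiff_affine_inner a κ).continuous
    fun_prop
  refine hu.of_le (hc.aestronglyMeasurable.smul hu.1) (Eventually.of_forall fun x => ?_)
  rw [norm_smul, Complex.norm_exp_ofReal_mul_I, one_mul]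

theorem exp_mul_I_smul (r : ℝ) (z : Spinor) :
    Complex.exp ((r : ℂ) * Complex.I) • z = Real.cos r • z + Complex.I • Real.sin r • z := by
  rw [Complex.exp_mul_I, ← Complex.ofReal_cos, ← Complex.ofReal_sin, add_smul, mul_comm,
    ← smul_smul]
  rfl

theorem exp_mul_I_smul_deriv (r b : ℝ) (z w : Spinor) :
    Complex.exp ((r : ℂ) * Complex.I) • (((b : ℂ) * Complex.I) • z + w)
      = ((-Real.sin r * b) • z + Real.cos r • w)
        + Complex.I • ((Real.cos r * b) • z + Real.sin r • w) := by
  rw [Complex.exp_mul_I, ← Complex.ofReal_cos, ← Complex.ofReal_sin]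
  ext i
  simp only [Pi.add_apply, Pi.smul_apply, smul_eq_mul, Complex.real_smul]
  push_cast
  linear_combination ((Complex.sin r : ℂ) * b * z i) * Complex.I_mul_I

/-- Leibniz rule for the product with a plane wave. -/
theorem HasWeakPartial.smul_phase {k : Fin 3} {f g : Space → Spinor} (h : HasWeakPartial k f g)
    (a : ℝ) (κ : Space) :
    HasWeakPartial k (fun x => Complex.exp (((a + inner ℝ κ x : ℝ) : ℂ) * Complex.I) • f x)
      (fun x => Complex.exp (((a + inner ℝ κ x : ℝ) : ℂ) * Complex.I) •
        ((((κ k : ℝ) : ℂ) * Complex.I) • f x + g x)) := by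
  have hθ := contDiff_affine_inner a κ
  have h1 := h.smul_smooth (Real.contDiff_cos.comp hθ)
  have h2 := (h.smul_smooth (Real.contDiff_sin.comp hθ)).clm_comp
    (Complex.I • ContinuousLinearMap.id ℝ Spinor)
  simp only [Function.comp_def, pd_comp_affine Real.hasDerivAt_cos a κ k] at h1
  simp only [Function.comp_def, pd_comp_affine Real.hasDerivAt_sin a κ k] at h2
  simp only [exp_mul_I_smul_deriv]
  simp only [exp_mul_I_smul]
  exact h1.add h2

theorem HasL2Gradient.smul_phase {f : Space → Spinor} {f' : Fin 3 → Space → Spinor}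
    (h : HasL2Gradient f f') (a : ℝ) (κ : Space) :
    HasL2Gradient (fun x => Complex.exp (((a + inner ℝ κ x : ℝ) : ℂ) * Complex.I) • f x)
      (fun k x => Complex.exp (((a + inner ℝ κ x : ℝ) : ℂ) * Complex.I) •
        ((((κ k : ℝ) : ℂ) * Complex.I) • f x + f' k x)) := by
  refine ⟨memLp_smul_phase h.1 a κ, fun k => ⟨(h.2 k).1.smul_phase a κ, ?_⟩⟩
  have h1 : MemLp (fun x => (((κ k : ℝ) : ℂ) * Complex.I) • f x) 2 :=
    ((((κ k : ℝ) : ℂ) * Complex.I) • ContinuousLinearMap.id ℝ Spinor).comp_memLp' h.1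
  have h2 : MemLp (fun x => (((κ k : ℝ) : ℂ) * Complex.I) • f x + f' k x) 2 := h1.add (h.2 k).2
  exact memLp_smul_phase h2 a κ

/-- The derivative of a distribution along a uniform translation. -/
theorem hasDerivAt_integral_translate {ζ ξ : Space → ℝ} (hζ : IsTest ζ)
    (hξ : LocallyIntegrable ξ) (v : Space) (t : ℝ) :
    HasDerivAt (fun s : ℝ => ∫ x, ζ (x + s • v) * ξ x)
      (∫ x, fderiv ℝ ζ (x + t • v) v * ξ x) t := by
  -- up to a reflection this is the derivative of a convolution along the line `ℝ v`
  have hξ' : LocallyIntegrable fun x => ξ (-x) := by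
    simpa using locallyIntegrable_comp_affine (ContinuousLinearEquiv.neg ℝ) 0 hξ
  have h1 := hζ.2.hasFDerivAt_convolution_right (lsmul ℝ ℝ) hξ' hζ.contDiff_one (t • v)
  have h2 : HasDerivAt (fun s : ℝ => s • v) v t := by
    simpa using (hasDerivAt_id t).smul_const v
  have h3 := h1.comp_hasDerivAt t h2
  rw [convolution_precompR_apply (lsmul ℝ ℝ) hξ' (hζ.2.fderiv ℝ)
    (hζ.contDiff_one.continuous_fderiv one_ne_zero)] at h3
  have e : ∀ (u : Space → ℝ) (s : ℝ), ((fun x => ξ (-x)) ⋆[lsmul ℝ ℝ, volume] u) (s • v)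
      = ∫ x, u (x + s • v) * ξ x := by
    intro u s
    rw [convolution, ← integral_neg_eq_self]
    simp only [lsmul_apply, neg_neg, sub_neg_eq_add, smul_eq_mul, mul_comm (ξ _), add_comm (s • v)]
  rw [e (fun a => fderiv ℝ ζ a v)] at h3
  simpa only [Function.comp_def, e ζ] using h3

theorem movingMeson_eq {v : Space} (hv : ‖v‖ < 1) (χ : Space → ℝ) (t : ℝ) :
    movingMeson χ v t
      = fun x => χ (boostEquiv hv x + (-(lorentzFactor v * t)) • v) := by
  ext x
  rw [movingMeson, boost_neg_snd hv]

/-- In the coordinates moving with velocity `v`, the boosted profile is at rest. -/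
theorem integral_mul_comp_boost {v : Space} (hv : ‖v‖ < 1) (χ ζ : Space → ℝ) (t : ℝ) :
    ∫ x, ζ x * χ (boostEquiv hv x + (-(lorentzFactor v * t)) • v)
      = ∫ x, ζ (x + t • v) * χ (boostEquiv hv x) := by
  rw [← integral_add_right_eq_self _ (t • v)]
  congr 1
  ext x
  rw [map_add, map_smul, boostEquiv_apply hv v, boostMap_self, smul_smul, mul_comm t,
    add_assoc, ← add_smul, add_neg_cancel, zero_smul, add_zero]

/-- The boosted meson field is transported with velocity `v`: `∂_t χ_v = -γ (v·∇χ₀)(y)`. -/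
theorem HasL2Gradient.hasWeakTimeDeriv_moving {v : Space} (hv : ‖v‖ < 1) {χ : Space → ℝ}
    {χ' : Fin 3 → Space → ℝ} (h : HasL2Gradient χ χ') (t : ℝ) :
    HasWeakTimeDeriv (movingMeson χ v) t
      (fun x => -(lorentzFactor v) *
        ∑ l, v l * χ' l (boostEquiv hv x + (-(lorentzFactor v * t)) • v)) := by
  have hloc : ∀ {u : Space → ℝ}, MemLp u 2 → ∀ c, LocallyIntegrable fun x => u (boostEquiv hv x + c) :=
    fun hu c => locallyIntegrable_comp_affine _ c (locallyIntegrable_of_memLp_two hu)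
  refine ⟨fun s => ?_, ?_, fun ζ hζ => ?_⟩
  · rw [movingMeson_eq hv]
    exact hloc h.1 _
  · exact ((locallyIntegrable_finsetSum _ fun l _ =>
      (hloc (h.2 l).2 _).smul (v l)).smul (-lorentzFactor v))
  · simp only [movingMeson_eq hv]
    simp only [integral_mul_comp_boost hv χ ζ]
    have hχ : LocallyIntegrable fun x => χ (boostEquiv hv x) := by simpa using hloc h.1 0
    have hχ' : ∀ l, LocallyIntegrable fun x => χ' l (boostEquiv hv x) := fun l => by
      simpa using hloc (h.2 l).2 0
    have hd := hasDerivAt_integral_translate hζ hχ v t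
    have hζt := hζ.translate (t • v)
    convert hd using 1
    rw [integral_mul_comp_boost hv (fun y => -(lorentzFactor v) * ∑ l, v l * χ' l y) ζ t]
    have hw : ∀ k, HasWeakPartial k (fun x => χ (boostEquiv hv x))
        (fun x => ∑ l, boostEquiv hv (EuclideanSpace.single k 1) l • χ' l (boostEquiv hv x)) :=
      fun k => by
        simpa using HasWeakPartial.comp_affine (boostEquiv hv) 0 (fun k => (h.2 k).1) k
    have e1 : ∀ x, fderiv ℝ ζ (x + t • v) v * χ (boostEquiv hv x)
        = ∑ k, v k * (partialDeriv k (fun x => ζ (x + t • v)) x * χ (boostEquiv hv x)) := by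
      intro x
      rw [clm_apply_eq_sum _ v, Finset.sum_mul]
      refine Finset.sum_congr rfl fun k _ => ?_
      rw [partialDeriv_translate, partialDeriv, smul_eq_mul, mul_assoc]
    have i1 : ∀ k, Integrable fun x =>
        v k * (partialDeriv k (fun x => ζ (x + t • v)) x * χ (boostEquiv hv x)) := fun k =>
      ((hζt.partialDeriv k).integrable_smul hχ).const_mul (v k)
    have i2 : ∀ l, Integrable fun x => ζ (x + t • v) * χ' l (boostEquiv hv x) := fun l =>
      hζt.integrable_smul (hχ' l)
    simp only [e1]
    rw [integral_finsetSum _ fun k _ => i1 k]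
    have e2 : ∀ k, ∫ x, v k * (partialDeriv k (fun x => ζ (x + t • v)) x * χ (boostEquiv hv x))
        = - ∑ l, (v k * boostEquiv hv (EuclideanSpace.single k 1) l) *
          ∫ x, ζ (x + t • v) * χ' l (boostEquiv hv x) := by
      intro k
      have := (hw k).2.2 _ hζt
      simp only [smul_eq_mul, Finset.mul_sum] at this
      rw [integral_const_mul, this, integral_finsetSum _ fun l _ => ?_, mul_neg, Finset.mul_sum]
      · congr 1
        refine Finset.sum_congr rfl fun l _ => ?_
        simp only [mul_left_comm (ζ _)]
        rw [integral_const_mul]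
        ring
      · simp only [mul_left_comm (ζ _)]
        exact (i2 l).const_mul _
    simp only [e2, Finset.sum_neg_distrib]
    rw [Finset.sum_comm]
    have e3 : ∀ l, ∑ k, v k * boostEquiv hv (EuclideanSpace.single k 1) l = lorentzFactor v * v l := by
      intro l
      have := congrArg (fun w : Space => w l) (boostMap_self v)
      have h2 : boostMap v v l = ∑ k, v k * boostMap v (EuclideanSpace.single k 1) l :=
        clm_apply_eq_sum ((EuclideanSpace.proj l : Space →L[ℝ] ℝ) ∘L boostMap v) v
      simp only [boostEquiv_apply]
      rw [← h2, this]; rfl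
    simp only [← Finset.sum_mul, e3]
    have e4 : ∀ x, ζ (x + t • v) * (-(lorentzFactor v) * ∑ l, v l * χ' l (boostEquiv hv x))
        = ∑ l, -(lorentzFactor v * v l) * (ζ (x + t • v) * χ' l (boostEquiv hv x)) := by
      intro x
      rw [Finset.mul_sum, Finset.mul_sum]
      exact Finset.sum_congr rfl fun l _ => by ring
    simp only [e4]
    rw [integral_finsetSum _ fun l _ => (i2 l).const_mul _, ← Finset.sum_neg_distrib]
    refine Finset.sum_congr rfl fun l _ => ?_
    rw [integral_const_mul, neg_mul]

/-! ### The momentum of the moving wave -/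

/-- `f` is integrable with integral `a`. -/
def HasTotal (f : Space → ℂ) (a : ℂ) : Prop := Integrable f ∧ ∫ x, f x = a

namespace HasTotal

variable {f g : Space → ℂ} {a b : ℂ}

theorem add (hf : HasTotal f a) (hg : HasTotal g b) : HasTotal (fun x => f x + g x) (a + b) :=
  ⟨hf.1.add hg.1, by rw [integral_add hf.1 hg.1, hf.2, hg.2]⟩

theorem sub (hf : HasTotal f a) (hg : HasTotal g b) : HasTotal (fun x => f x - g x) (a - b) :=
  ⟨hf.1.sub hg.1, by rw [integral_sub hf.1 hg.1, hf.2, hg.2]⟩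

theorem const_mul (hf : HasTotal f a) (c : ℂ) : HasTotal (fun x => c * f x) (c * a) :=
  ⟨hf.1.const_mul c, by rw [integral_const_mul, hf.2]⟩

theorem sum {f : Fin 3 → Space → ℂ} {a : Fin 3 → ℂ} (hf : ∀ k, HasTotal (f k) (a k)) :
    HasTotal (fun x => ∑ k, f k x) (∑ k, a k) :=
  ⟨integrable_finsetSum _ fun k _ => (hf k).1, by
    rw [integral_finsetSum _ fun k _ => (hf k).1]
    exact Finset.sum_congr rfl fun k _ => (hf k).2⟩

theorem ofReal {f : Space → ℝ} (hf : Integrable f) :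
    HasTotal (fun x => (f x : ℂ)) ((∫ x, f x : ℝ) : ℂ) :=
  ⟨hf.ofReal, integral_complex_ofReal⟩

theorem sesq {A : Matrix (Fin 4) (Fin 4) ℂ} {u w : Space → Spinor} (hu : MemLp u 2)
    (hw : MemLp w 2) :
    HasTotal (fun x => KGD.sesq A (u x) (w x))
      ((∫ x, reForm A (u x) (w x) : ℝ) + (∫ x, imForm A (u x) (w x) : ℝ) * Complex.I) := by
  have h := (ofReal (integrable_bilin (reForm A) hu hw)).add
    ((ofReal (integrable_bilin (imForm A) hu hw)).const_mul Complex.I)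
  simp only [sesq_eq]
  convert h using 1
  · ext x; ring
  · ring

end HasTotal

theorem HasL2Gradient.mulVec {f : Space → Spinor} {f' : Fin 3 → Space → Spinor}
    (h : HasL2Gradient f f') (A : Matrix (Fin 4) (Fin 4) ℂ) :
    HasL2Gradient (fun x => A *ᵥ f x) (fun k x => A *ᵥ f' k x) :=
  h.clm_comp (LinearMap.toContinuousLinearMap ((Matrix.mulVecLin A).restrictScalars ℝ))

/-- The phase of the moving wave at time `t`. -/
noncomputable def boostPhase (ω : ℝ) (v : Space) (t : ℝ) (x : Space) : ℂ :=
  Complex.exp (((-(ω * lorentzFactor v * t) + inner ℝ ((ω * lorentzFactor v) • v) x : ℝ) : ℂ)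
    * Complex.I)

theorem movingDirac_eq {v : Space} (hv : ‖v‖ < 1) (ω : ℝ) (φ : Space → Spinor) (t : ℝ) :
    movingDirac ω φ v t = fun x => spinorBoost v *ᵥ
      (boostPhase ω v t x • φ (boostEquiv hv x + (-(lorentzFactor v * t)) • v)) := by
  ext1 x
  have e : -Complex.I * ω * ((lorentzFactor v * (t - inner ℝ v x) : ℝ) : ℂ)
      = ((-(ω * lorentzFactor v * t) + inner ℝ ((ω * lorentzFactor v) • v) x : ℝ) : ℂ)
        * Complex.I := by
    rw [inner_smul_left, conj_trivial]
    push_cast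
    ring
  rw [movingDirac, restDirac, boost_neg_fst, boost_neg_snd hv, boostPhase, e]

/-- The gradient of the boosted spinor without the factor `S_v` and the phase, in the coordinates of
the rest frame. -/
noncomputable def boostGrad (ω : ℝ) (v : Space) (φ : Space → Spinor) (φ' : Fin 3 → Space → Spinor)
    (k : Fin 3) (y : Space) : Spinor :=
  (((ω * lorentzFactor v * v k : ℝ) : ℂ) * Complex.I) • φ y
    + ∑ l, boostMap v (EuclideanSpace.single k 1) l • φ' l y

/-- Minus the momentum density of the moving wave in the coordinates of the rest frame. -/
noncomputable def boostedMomentum (ω : ℝ) (v : Space) (φ : Space → Spinor)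
    (φ' : Fin 3 → Space → Spinor) (χ' : Fin 3 → Space → ℝ) (k : Fin 3) (y : Space) : ℂ :=
  Complex.I * (lorentzFactor v *
      ((((ω * lorentzFactor v * v k : ℝ) : ℂ) * Complex.I) *
        (sesq 1 (φ y) (φ y) + ∑ n, ((v n : ℝ) : ℂ) * sesq (alpha n) (φ y) (φ y))
      + ∑ l, ((boostMap v (EuclideanSpace.single k 1) l : ℝ) : ℂ) *
        (sesq 1 (φ y) (φ' l y) + ∑ n, ((v n : ℝ) : ℂ) * sesq (alpha n) (φ y) (φ' l y))))
    - lorentzFactor v * ∑ l, ((boostMap v (EuclideanSpace.single k 1) l : ℝ) : ℂ) *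
        ∑ n, ((v n : ℝ) : ℂ) * ((χ' n y * χ' l y : ℝ) : ℂ)

theorem sesq_boostGrad (A : Matrix (Fin 4) (Fin 4) ℂ) (ω : ℝ) (v : Space) (φ : Space → Spinor)
    (φ' : Fin 3 → Space → Spinor) (k : Fin 3) (u : Spinor) (y : Space) :
    sesq A u (boostGrad ω v φ φ' k y)
      = (((ω * lorentzFactor v * v k : ℝ) : ℂ) * Complex.I) * sesq A u (φ y)
        + ∑ l, ((boostMap v (EuclideanSpace.single k 1) l : ℝ) : ℂ) * sesq A u (φ' l y) := by
  rw [boostGrad, map_add, map_sum]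
  simp only [map_smul, Complex.real_smul]
  rw [sesq_apply, Matrix.mulVec_smul, dotProduct_smul, smul_eq_mul, ← sesq_apply]

namespace IsProfile

variable {m M eta ω : ℝ} {G : ℝ → ℝ} {φ : Space → Spinor} {φ' : Fin 3 → Space → Spinor}
  {χ : Space → ℝ} {χ' : Fin 3 → Space → ℝ} {v : Space}

theorem movingDirac_hasL2Gradient (h : IsProfile m M eta ω G φ φ' χ χ') (hv : ‖v‖ < 1) (t : ℝ) :
    HasL2Gradient (movingDirac ω φ v t) (fun k x => spinorBoost v *ᵥ
      (boostPhase ω v t x • boostGrad ω v φ φ' k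
        (boostEquiv hv x + (-(lorentzFactor v * t)) • v))) := by
  have h1 := (h.grad.comp_affine (boostEquiv hv) ((-(lorentzFactor v * t)) • v)).smul_phase
    (-(ω * lorentzFactor v * t)) ((ω * lorentzFactor v) • v)
  have h2 : HasL2Gradient
      (fun x => boostPhase ω v t x • φ (boostEquiv hv x + (-(lorentzFactor v * t)) • v))
      (fun k x => boostPhase ω v t x • boostGrad ω v φ φ' k
        (boostEquiv hv x + (-(lorentzFactor v * t)) • v)) := by
    simp only [PiLp.smul_apply, smul_eq_mul] at h1
    simp only [boostPhase, boostGrad]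
    exact h1
  rw [movingDirac_eq hv]
  exact h2.mulVec (spinorBoost v)

theorem movingMeson_hasL2Gradient (h : IsProfile m M eta ω G φ φ' χ χ') (hv : ‖v‖ < 1) (t : ℝ) :
    HasL2Gradient (movingMeson χ v t) (fun k x =>
      ∑ l, boostMap v (EuclideanSpace.single k 1) l *
        χ' l (boostEquiv hv x + (-(lorentzFactor v * t)) • v)) := by
  rw [movingMeson_eq hv]
  exact h.mesonGrad.comp_affine (boostEquiv hv) ((-(lorentzFactor v * t)) • v)

theorem fieldsInH1_moving (h : IsProfile m M eta ω G φ φ' χ χ') (hv : ‖v‖ < 1) (t : ℝ) :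
    FieldsInH1 (movingDirac ω φ v) (movingMeson χ v) t := by
  refine ⟨(h.movingDirac_hasL2Gradient hv t).memH1, (h.movingMeson_hasL2Gradient hv t).memH1, _,
    h.mesonGrad.hasWeakTimeDeriv_moving hv t, ?_⟩
  have h1 : MemLp (fun y => ∑ l, v l * χ' l y) 2 :=
    memLp_finsetSum _ fun l _ => (h.mesonGrad.2 l).2.const_mul (v l)
  exact (memLp_comp_affine _ _ h1).const_mul (-lorentzFactor v)

theorem momentumDensity_moving (h : IsProfile m M eta ω G φ φ' χ χ') (hv : ‖v‖ < 1) (t : ℝ)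
    (k : Fin 3) :
    momentumDensity (movingDirac ω φ v) (movingMeson χ v) t k =ᵐ[volume]
      fun x => boostedMomentum ω v φ φ' χ' k
        (boostEquiv hv x + (-(lorentzFactor v * t)) • v) := by
  filter_upwards [((h.movingDirac_hasL2Gradient hv t).2 k).1.weakPartial_ae,
    ((h.movingMeson_hasL2Gradient hv t).2 k).1.weakPartial_ae,
    (h.mesonGrad.hasWeakTimeDeriv_moving hv t).weakTimeDeriv_ae] with x h1 h2 h3
  have hc : star (boostPhase ω v t x) * boostPhase ω v t x = 1 := star_exp_mul_I_mul_self _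
  rw [momentumDensity, h1, h2, h3, movingDirac_eq hv]
  beta_reduce
  generalize boostEquiv hv x + (-(lorentzFactor v * t)) • v = y
  have e1 := sesq_mulVec_mulVec hv (boostPhase ω v t x • φ y)
    (boostPhase ω v t x • boostGrad ω v φ φ' k y)
  simp only [sesq_smul_smul _ hc, sesq_boostGrad] at e1
  rw [sesq_apply, Matrix.one_mulVec] at e1
  rw [e1, boostedMomentum]
  have e2 : ((-lorentzFactor v * (∑ l, v l * χ' l y) *
      ∑ l, boostMap v (EuclideanSpace.single k 1) l * χ' l y : ℝ) : ℂ)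
      = -(lorentzFactor v * ∑ l, ((boostMap v (EuclideanSpace.single k 1) l : ℝ) : ℂ) *
        ∑ n, ((v n : ℝ) : ℂ) * ((χ' n y * χ' l y : ℝ) : ℂ)) := by
    simp only [Fin.sum_univ_three]
    push_cast
    ring
  rw [e2, ← sub_eq_add_neg]
  congr 3
  simp only [Fin.sum_univ_three]
  ring

/-- The bookkeeping of the factors `i` in the integral of `boostedMomentum`. -/
theorem momentum_algebra (g e N : ℂ) (a b : Fin 3 → ℂ) (T X : Fin 3 → Fin 3 → ℂ) :
    Complex.I * (g * (e * Complex.I * (N + ∑ n, b n * 0)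
        + ∑ l, a l * (0 + ∑ n, b n * (T n l * Complex.I)))) - g * ∑ l, a l * ∑ n, b n * X n l
      = -(g * (e * N + ∑ l, a l * ∑ n, b n * (T n l + X n l))) := by
  simp only [Fin.sum_univ_three]
  ring_nf
  simp only [Complex.I_sq]
  ring

theorem hasTotal_boostedMomentum (h : IsProfile m M eta ω G φ φ' χ χ')
    (hC1 : ∀ l, ∫ x, sesq 1 (φ x) (φ' l x) = 0) (k : Fin 3) :
    HasTotal (boostedMomentum ω v φ φ' χ' k)
      (-(lorentzFactor v * (lorentzFactor v * v k *
        (ω * (∫ x, reForm 1 (φ x) (φ x)) + ∫ x, virialDensity M G φ χ χ' x)) : ℝ) : ℂ) := by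
  have hN : HasTotal (fun x => sesq 1 (φ x) (φ x)) ((∫ x, reForm 1 (φ x) (φ x) : ℝ) : ℂ) := by
    have := HasTotal.sesq (A := 1) h.grad.1 h.grad.1
    simpa only [imForm_self Matrix.isHermitian_one, integral_zero, Complex.ofReal_zero, zero_mul,
      add_zero] using this
  have hJ : ∀ n, HasTotal (fun x => sesq (alpha n) (φ x) (φ x)) 0 := fun n => by
    have := HasTotal.sesq (A := alpha n) h.grad.1 h.grad.1
    simpa only [imForm_self (alpha_isHermitian n), h.integral_current, integral_zero,
      Complex.ofReal_zero, zero_mul, add_zero] using this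
  have hP : ∀ l, HasTotal (fun x => sesq 1 (φ x) (φ' l x)) 0 := fun l =>
    ⟨(HasTotal.sesq h.grad.1 (h.grad.2 l).2).1, hC1 l⟩
  have hT : ∀ n l, HasTotal (fun x => sesq (alpha n) (φ x) (φ' l x))
      ((∫ x, imForm (alpha n) (φ x) (φ' l x) : ℝ) * Complex.I) := fun n l => by
    have := HasTotal.sesq (A := alpha n) h.grad.1 (h.grad.2 l).2
    simpa only [h.integral_reForm_grad (alpha_isHermitian n), Complex.ofReal_zero, zero_add]
      using this
  have hX : ∀ n l, HasTotal (fun x => ((χ' n x * χ' l x : ℝ) : ℂ))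
      ((∫ x, χ' n x * χ' l x : ℝ) : ℂ) := fun n l => HasTotal.ofReal (h.integrable_meson_grad n l)
  have key := (((((hN.add (HasTotal.sum fun n => (hJ n).const_mul (v n))).const_mul
    (((ω * lorentzFactor v * v k : ℝ) : ℂ) * Complex.I)).add (HasTotal.sum fun l =>
      ((hP l).add (HasTotal.sum fun n => (hT n l).const_mul (v n))).const_mul
        ((boostMap v (EuclideanSpace.single k 1) l : ℝ) : ℂ))).const_mul
          (lorentzFactor v)).const_mul Complex.I).sub
    ((HasTotal.sum fun l => (HasTotal.sum fun n => (hX n l).const_mul (v n)).const_mul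
      ((boostMap v (EuclideanSpace.single k 1) l : ℝ) : ℂ)).const_mul (lorentzFactor v))
  refine ⟨key.1, key.2.trans ?_⟩
  -- by the virial identities only the diagonal terms of the stress tensor contribute
  have hvir : ∀ l, ∑ n, v n * ((∫ x, imForm (alpha n) (φ x) (φ' l x)) + ∫ x, χ' n x * χ' l x)
      = v l * ∫ x, virialDensity M G φ χ χ' x := fun l => by
    simp [h.virial]
  have hsum : ∑ l, boostMap v (EuclideanSpace.single k 1) l *
      ∑ n, v n * ((∫ x, imForm (alpha n) (φ x) (φ' l x)) + ∫ x, χ' n x * χ' l x)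
      = lorentzFactor v * v k * ∫ x, virialDensity M G φ χ χ' x := by
    rw [← sum_boostMap_mul, Finset.sum_mul]
    exact Finset.sum_congr rfl fun l _ => by rw [hvir]; ring
  rw [← Complex.ofReal_inj] at hsum
  push_cast at hsum ⊢
  rw [momentum_algebra, hsum]
  ring

theorem integrable_momentumDensity_moving (h : IsProfile m M eta ω G φ φ' χ χ') (hv : ‖v‖ < 1)
    (hC1 : ∀ l, ∫ x, sesq 1 (φ x) (φ' l x) = 0) (t : ℝ) (k : Fin 3) :
    Integrable (momentumDensity (movingDirac ω φ v) (movingMeson χ v) t k) :=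
  (integrable_comp_affine _ _ (h.hasTotal_boostedMomentum hC1 k).1).congr
    (h.momentumDensity_moving hv t k).symm

/-- The change of variables to the rest frame has Jacobian `γ`. -/
theorem momentum_moving (h : IsProfile m M eta ω G φ φ' χ χ') (hv : ‖v‖ < 1)
    (hC1 : ∀ l, ∫ x, sesq 1 (φ x) (φ' l x) = 0) (t : ℝ) (k : Fin 3) :
    momentum (movingDirac ω φ v) (movingMeson χ v) t k
      = ((lorentzFactor v * v k *
        (ω * (∫ x, reForm 1 (φ x) (φ x)) + ∫ x, virialDensity M G φ χ χ' x) : ℝ) : ℂ) := by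
  have hg := lorentzFactor_pos hv
  rw [momentum, integral_congr_ae (h.momentumDensity_moving hv t k),
    integral_comp_affine _ _ (boostedMomentum ω v φ φ' χ' k), det_boostEquiv hv,
    (h.hasTotal_boostedMomentum hC1 k).2, abs_of_pos (inv_pos.2 hg), Complex.real_smul,
    mul_neg, neg_neg, ← Complex.ofReal_mul, inv_mul_cancel_left₀ hg.ne']

end IsProfile

end

end KGD

theorem mainTheorem6
    (m M eta ω : ℝ) (hm : 0 < m) (hM : 0 < M) (hω : ω ∈ Set.Ioo (-m) m)
    (G : ℝ → ℝ) (hG : (∀ s, G s = 0) ∨ KGD.AdmissibleCoupling G)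
    (φ : KGD.Space → KGD.Spinor) (hφ : KGD.IsStandingWave m M eta ω G φ)
    (v : KGD.Space) (hv : ‖v‖ < 1)
    (hC1 : KGD.CondC1' φ)
    (hC2 : KGD.CondC2' v φ)
    (hC3 : KGD.CondC3' v (KGD.restMeson M eta φ)) :
    (∀ t : ℝ,
      KGD.FieldsInH1 (KGD.restDirac ω φ) (fun _ => KGD.restMeson M eta φ) t ∧
      Integrable (KGD.energyDensity m M eta G
        (KGD.restDirac ω φ) (fun _ => KGD.restMeson M eta φ) t) ∧
      KGD.FieldsInH1 (KGD.movingDirac ω φ v)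
        (KGD.movingMeson (KGD.restMeson M eta φ) v) t ∧
      ∀ k : Fin 3, Integrable (KGD.momentumDensity (KGD.movingDirac ω φ v)
        (KGD.movingMeson (KGD.restMeson M eta φ) v) t k)) ∧
    (∀ t s : ℝ, ∀ k : Fin 3,
      KGD.momentum (KGD.movingDirac ω φ v)
          (KGD.movingMeson (KGD.restMeson M eta φ) v) t k
        = ((KGD.lorentzFactor v * v k : ℝ) : ℂ) *
          KGD.energy m M eta G (KGD.restDirac ω φ) (fun _ => KGD.restMeson M eta φ) s) := by
  have h := hφ.isProfile hM hG
  have hC : ∀ l, ∫ x, KGD.sesq 1 (φ x) (KGD.weakPartial l φ x) = 0 := fun l => by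
    simpa only [KGD.sesq_apply, Matrix.one_mulVec] using hC1 l
  refine ⟨fun t => ⟨h.fieldsInH1_rest t, h.integrable_energyDensity_rest t,
    h.fieldsInH1_moving hv t, h.integrable_momentumDensity_moving hv hC t⟩, fun t s k => ?_⟩
  rw [h.momentum_moving hv hC t k, h.energy_rest s, ← Complex.ofReal_mul]
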